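/- **Global expected number of micro-minima.** Fix a star mass $m>0$, a density of continuous matter $0\le\kappa_c<1$ (subcritical) and an external shear $\gamma\ge 0$; put $\kappa_*=\pi m$. For each $g\in\mathbb N$ let $\boldsymbol\xi_1,\dots,\boldsymbol\xi_g$ be independent random points, uniformly distributed over the closed disc of radius $\sqrt{g/\pi}$ centred at the origin of $\mathbb R^2$. For $\mathbf x=(u,v)$ let $$\psi_g(\mathbf x)=\frac{\kappa_c}{2}|\mathbf x|^2-\frac{\gamma}{2}(u^2-v^2)+\sum_{j=1}^g m\log|\mathbf x-\boldsymbol\xi_j|,\qquad T_{g,\mathbf y}(\mathbf x)=\tfrac12|\mathbf x-\mathbf y|^2-\psi_g(\mathbf x),\qquad \boldsymbol\eta_g(\mathbf x)=\mathbf x-\nabla\psi_g(\mathbf x)$$ for $\mathbf x\in\mathbb R^2\setminus\{\boldsymbol\xi_1,\dots,\boldsymbol\xi_g\}$. A minimum image of a source at $\mathbf y\in\mathbb R^2$ is a point $\mathbf x\in\mathbb R^2\setminus\{\boldsymbol\xi_1,\dots,\boldsymbol\xi_g\}$ with $\boldsymbol\eta_g(\mathbf x)=\mathbf y$ at which $T_{g,\mathbf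 y}$ has a local minimum. Let $D\subset\mathbb R^2$ be a closed disc of positive radius, and let $N_{g,\min}(D,\mathbf y)$ be the number of minimum images in $D$ of a source at $\mathbf y$. Let $\{\mathfrak S\}$ be a countable covering of $\mathbb R^2$ by compact sets, all of the same area $|\mathfrak S_0|>0$, any two of which overlap in a set of measure zero. The global expectation of the number of minimum images in $D$ is the total over the family $$\widehat E_g=\sum_{\mathfrak S}\frac{1}{|\mathfrak S_0|}\int_{\mathfrak S}E\big[N_{g,\min}(D,\mathbf y)\big]\,d\mathbf y ,$$ that is, the sum of the expected numbers of minimum images in $D$ of sources uniformly distributed over the sets $\mathfrak S$. Write $\mu=|D|/|\mathfrak S_0|$, $a_0=\frac1{|D|}\int_D|\mathbf u|^2\,d\mathbf u$, $G=(z^2+w^2)^{1/2}$, let $\mathcal B$ be the closed disc of radius $1-\kappa_c$ centred at $(-\gamma,0)$, and let $$H_1(G)=\kappa_*^2\,\frac{9G^2-6\kappa_*^2}{4(\kappa_*^2+G^2)^2},$$ $$H_2(G;s)=\frac{\kappa_* s}{m}\,\frac{\kappa_*^2(6\kappa_*^2-9G^2)}{2(\kappa_*^2+G^2)^2}-\frac{\kappa_*^2(8\kappa_*^4-24\kappa_*^2G^2+3G^4)}{4(\kappa_*^2+G^2)^3}+\frac{15\kappa_*^4(8\kappa_*^4-40\kappa_*^2G^2+15G^4)}{32(\kappa_*^2+G^2)^4}.$$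 Then $\widehat E_g<\infty$ for every $g$ and, as $g\to\infty$ with everything else fixed, $$\widehat E_g=\frac{\kappa_*\,\mu}{2\pi}\int_{\mathcal B}\frac{(1-\kappa_c)^2-(\gamma+z)^2-w^2}{(\kappa_*^2+G^2)^{3/2}}\left[1+\frac{H_1(G)}{g}+\frac{H_2(G;a_0)}{g^2}\right]dz\,dw+O(g^{-3}).$$ -/

import Mathlib

open MeasureTheory ProbabilityTheory Filter Asymptotics
open scoped ENNReal

noncomputable section

namespace Microlensing

/-- The lens plane and the light source plane are both Euclidean `ℝ²`. -/
abbrev Plane : Type := EuclideanSpace ℝ (Fin 2)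

/-- Microlensing potential of `g` stars of mass `m` at the positions `ξ j`, continuous matter of
density `κc` and external shear `γ`. It is meaningful off the stars. -/
def potential {g : ℕ} (κc γ m : ℝ) (ξ : Fin g → Plane) (x : Plane) : ℝ :=
  κc / 2 * ‖x‖ ^ 2 - γ / 2 * (x 0 ^ 2 - x 1 ^ 2) + ∑ j, m * Real.log ‖x - ξ j‖

/-- The domain `L = ℝ² \ {ξ_1, …, ξ_g}` of the time delay function and of the lensing map. -/
def lensDomain {g : ℕ} (ξ : Fin g → Plane) : Set Plane := (Set.range ξ)ᶜ

/-- Time delay function of a source at `y`. -/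
def timeDelay {g : ℕ} (κc γ m : ℝ) (ξ : Fin g → Plane) (y x : Plane) : ℝ :=
  ‖x - y‖ ^ 2 / 2 - potential κc γ m ξ x

/-- Lensing map `η(x) = x - ∇ψ(x)`. -/
def lensingMap {g : ℕ} (κc γ m : ℝ) (ξ : Fin g → Plane) (x : Plane) : Plane :=
  x - gradient (potential κc γ m ξ) x

/-- The minimum micro-images of a source at `y`: the points of `η⁻¹(y)` at which the time delay
function has a local minimum. -/
def minImages {g : ℕ} (κc γ m : ℝ) (ξ : Fin g → Plane) (y : Plane) : Set Plane :=
  {x | x ∈ lensDomain ξ ∧ lensingMap κc γ m ξ x = y ∧ IsLocalMin (timeDelay κc γ m ξ y) x}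

/-- `E[N_min(D, y)]`: expected number of minimum images in `D` of a source at `y`, the stars being
at the random positions `ξ j`. -/
def expectedMinima {g : ℕ} {Ω : Type*} [MeasurableSpace Ω] (P : Measure Ω) (κc γ m : ℝ)
    (ξ : Fin g → Ω → Plane) (D : Set Plane) (y : Plane) : ℝ≥0∞ :=
  ∫⁻ ω, ((minImages κc γ m (fun j => ξ j ω) y ∩ D).encard : ℝ≥0∞) ∂P

/-- A covering of the light source plane by compact sets of the same positive area `A`, overlapping
only in null sets. -/
structure IsSourceCover {ι : Type*} (S : ι → Set Plane) (A : ℝ) : Prop where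
  isCompact : ∀ i, IsCompact (S i)
  iUnion_eq : ⋃ i, S i = Set.univ
  aedisjoint : Pairwise fun i j => AEDisjoint volume (S i) (S j)
  area_pos : 0 < A
  area_eq : ∀ i, volume (S i) = ENNReal.ofReal A

/-- Global expectation of the number of minimum images in `D`, for the family of random sources
`Y_i`, with `Y_i` uniformly distributed over `S i`: all the sets of the family have the same
weight 1, so it is the sum of the expectations `E[N_min(D, Y_i)]`. -/
def globalExpectedMinima {g : ℕ} {Ω : Type*} [MeasurableSpace Ω] (P : Measure Ω) (κc γ m : ℝ)
    (ξ : Fin g → Ω → Plane) (D : Set Plane) {ι : Type*} (S : ι → Set Plane) : ℝ≥0∞ :=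
  ∑' i, ∫⁻ y, expectedMinima P κc γ m ξ D y ∂(cond (volume : Measure Plane) (S i))

/-- `κ_* = π m`. -/
def kappaStar (m : ℝ) : ℝ := Real.pi * m

/-- First order correction `H₁(G)`, where `G` is the magnitude of the shear. -/
def H₁ (m G : ℝ) : ℝ :=
  kappaStar m ^ 2 * (9 * G ^ 2 - 6 * kappaStar m ^ 2) / (4 * (kappaStar m ^ 2 + G ^ 2) ^ 2)

/-- Second order correction `H₂`, as a function of the magnitude `G` of the shear and of the squared
distance `s = |x|²` from the origin. -/
def H₂ (m G s : ℝ) : ℝ :=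
  kappaStar m * s / m *
      (kappaStar m ^ 2 * (6 * kappaStar m ^ 2 - 9 * G ^ 2) /
        (2 * (kappaStar m ^ 2 + G ^ 2) ^ 2))
    - kappaStar m ^ 2 * (8 * kappaStar m ^ 4 - 24 * kappaStar m ^ 2 * G ^ 2 + 3 * G ^ 4) /
        (4 * (kappaStar m ^ 2 + G ^ 2) ^ 3)
    + 15 * kappaStar m ^ 4 * (8 * kappaStar m ^ 4 - 40 * kappaStar m ^ 2 * G ^ 2 + 15 * G ^ 4) /
        (32 * (kappaStar m ^ 2 + G ^ 2) ^ 4)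

/-- The mean `a₀` of `|u|²` over `D`. -/
def meanSq (D : Set Plane) : ℝ := (∫ u in D, ‖u‖ ^ 2) / volume.real D

/-- The integral over the disc `ℬ` of radius `1 - κ_c` centred at `(-γ, 0)`; the variable
`p = (z, w)` is the value of the shear, so that `G = ‖p‖`. -/
def shearIntegral (κc γ m a₀ : ℝ) (g : ℕ) : ℝ :=
  ∫ p in Metric.closedBall (!₂[-γ, 0] : Plane) (1 - κc),
    ((1 - κc) ^ 2 - (γ + p 0) ^ 2 - p 1 ^ 2) / (kappaStar m ^ 2 + ‖p‖ ^ 2) ^ (3 / 2 : ℝ) *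
      (1 + H₁ m ‖p‖ / g + H₂ m ‖p‖ a₀ / (g : ℝ) ^ 2)

end Microlensing

end

open Microlensing

noncomputable section

namespace Microlensing

open scoped Topology

section

/-! ### The Jacobian of the lensing map -/

/-! The Hessian of the time delay function is the Jacobian of the lensing map: `1 - κc` times the
identity plus a trace-free symmetric matrix whose entries are the total shear `q`. Its determinant
is `(1 - κc)² - |q|²`, and as `κc < 1` it is positive definite exactly when `|q| < 1 - κc`. Apart
from critical images, the minimum images are therefore the preimages at which the determinant is
positive. Critical values form a null set (Sard), so the area formula and Tonelli turn the number of
minima, integrated over all sources, into the integral over `x ∈ D` of the expected positive part of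
`(1 - κc)² - |q(x)|²` (`lintegral_expectedMinima`). The source sets cover the plane with equal
weight `1/A`, hence the global expectation is `1/A` times this integral (`globalExpectedMinima_eq`).
What remains is the law of the stars' shear at `x`, with error `O(g⁻³)` uniformly for `x ∈ D`.

That shear is a sum of `g` independent terms, so its characteristic function is `starChar ^ g`. In
polar coordinates with `u = r⁻²` the phase of one star is linear in `u`, and `starChar` reduces to
an angular average of tails of `∫ (1 - exp (i a u)) / u² du`. Pairing opposite rays cancels the
logarithms, and quarter turns change the sign of `a` and leave `π|a|` as leading term. With `T =
κ_*|t|/g` and `q = π|x|²/g` (now a number) this gives `1 - T + T²/4 + qT²/2` up to `O(T²/g² + T³/g +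
T⁴)` (`norm_starChar_sub_le`). The `g`-th power is then `exp(-κ_*|t|)` times a polynomial in
`κ_*|t|`, up to `O(g⁻³)` (`norm_pow_sub_charExpansion_le`), and its inverse Fourier transform is
explicit: it produces `(κ_*² + G²)^(-3/2)` with the corrections `H₁` and `H₂`
(`integral_charExpansion`).

For large `|t|` only the bound `‖starChar‖ ≤ 15/16` is used, which gives no integrability. The law
is therefore smoothed by a Gaussian of width `g⁻³`: the test function `minimaDensity` is Lipschitz,
so this costs `O(g⁻³)`, while the Gaussian integral over frequencies grows only like `g⁶` and is
beaten by `(15/16)^g` (`abs_integral_minimaDensity_sub_le`). Finally `H₂` is affine in `|x|²`, so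
averaging over `D` replaces `|x|²` by its mean. -/

/-- Shear of a star of unit mass at the origin. -/
def starShear (r : Plane) : Plane :=
  !₂[(r 0 ^ 2 - r 1 ^ 2) / ‖r‖ ^ 4, 2 * r 0 * r 1 / ‖r‖ ^ 4]

/-- Total shear of the stars at `x`. -/
def shear {g : ℕ} (m : ℝ) (ξ : Fin g → Plane) (x : Plane) : Plane :=
  m • ∑ j, starShear (x - ξ j)

/-- Total shear of the stars and of the external field. -/
def totalShear {g : ℕ} (γ m : ℝ) (ξ : Fin g → Plane) (x : Plane) : Plane :=
  !₂[γ, 0] + shear m ξ x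

/-- Closed form of the lensing map off the stars. -/
def lensField {g : ℕ} (κc γ m : ℝ) (ξ : Fin g → Plane) (x : Plane) : Plane :=
  (1 - κc) • x + γ • !₂[x 0, -x 1] - m • ∑ j, (‖x - ξ j‖ ^ 2)⁻¹ • (x - ξ j)

/-- The trace-free symmetric map with first row `p`. -/
def traceFree (p : Plane) : Plane →L[ℝ] Plane :=
  LinearMap.toContinuousLinearMap
    { toFun := fun h => !₂[p 0 * h 0 + p 1 * h 1, p 1 * h 0 - p 0 * h 1]
      map_add' := fun x y => by ext i; fin_cases i <;> simp <;> ring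
      map_smul' := fun c x => by ext i; fin_cases i <;> simp <;> ring }

@[simp] lemma traceFree_apply_zero (p h : Plane) :
    traceFree p h 0 = p 0 * h 0 + p 1 * h 1 := by simp [traceFree]

@[simp] lemma traceFree_apply_one (p h : Plane) :
    traceFree p h 1 = p 1 * h 0 - p 0 * h 1 := by simp [traceFree]

lemma Plane.norm_sq (x : Plane) : ‖x‖ ^ 2 = x 0 ^ 2 + x 1 ^ 2 := by
  rw [EuclideanSpace.norm_sq_eq]; simp

lemma Plane.inner_eq (x y : Plane) : inner ℝ x y = x 0 * y 0 + x 1 * y 1 := by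
  simp [PiLp.inner_apply, mul_comm]

lemma Plane.ext {x y : Plane} (h0 : x 0 = y 0) (h1 : x 1 = y 1) : x = y := by
  ext i; fin_cases i <;> assumption

lemma traceFree_add (p q : Plane) : traceFree (p + q) = traceFree p + traceFree q := by
  ext1 h; apply Plane.ext <;> simp <;> ring

lemma traceFree_smul (c : ℝ) (p : Plane) : traceFree (c • p) = c • traceFree p := by
  ext1 h; apply Plane.ext <;> simp <;> ring

lemma traceFree_zero : traceFree 0 = 0 := by
  ext1 h; apply Plane.ext <;> simp

lemma traceFree_sum {ι : Type*} (s : Finset ι) (p : ι → Plane) :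
    traceFree (∑ i ∈ s, p i) = ∑ i ∈ s, traceFree (p i) := by
  classical
  induction s using Finset.induction_on with
  | empty => simp [traceFree_zero]
  | insert a s ha ih => rw [Finset.sum_insert ha, Finset.sum_insert ha, traceFree_add, ih]

/-- Jacobian of the lensing map for a total shear `q`. -/
def lensJac (a : ℝ) (q : Plane) : Plane →L[ℝ] Plane :=
  a • ContinuousLinearMap.id ℝ Plane + traceFree q

lemma inner_lensJac (a : ℝ) (q h : Plane) :
    inner ℝ (lensJac a q h) h =
      (a + q 0) * h 0 ^ 2 + 2 * q 1 * h 0 * h 1 + (a - q 0) * h 1 ^ 2 := by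
  simp only [Plane.inner_eq, lensJac, add_apply,
    smul_apply, ContinuousLinearMap.id_apply, PiLp.add_apply,
    PiLp.smul_apply, smul_eq_mul, traceFree_apply_zero, traceFree_apply_one]
  ring

lemma det_lensJac (a : ℝ) (q : Plane) : (lensJac a q).det = a ^ 2 - ‖q‖ ^ 2 := by
  rw [ContinuousLinearMap.det,
    ← LinearMap.det_toMatrix (EuclideanSpace.basisFun (Fin 2) ℝ).toBasis, Matrix.det_fin_two]
  simp [LinearMap.toMatrix_apply, lensJac, Plane.norm_sq]
  ring

lemma inner_lensJac_pos {a : ℝ} (ha : 0 < a) {q h : Plane} (hq : ‖q‖ ^ 2 < a ^ 2) (hh : h ≠ 0) :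
    0 < inner ℝ (lensJac a q h) h := by
  rw [inner_lensJac]
  rw [Plane.norm_sq] at hq
  have h1 : 0 < a + q 0 := by
    have := (abs_lt_of_sq_lt_sq' (show q 0 ^ 2 < a ^ 2 by nlinarith [sq_nonneg (q 1)]) ha.le).1
    linarith
  -- Completing the square in `h 0`, after multiplication by the positive number `a + q 0`.
  have h2 : (a + q 0) * ((a + q 0) * h 0 ^ 2 + 2 * q 1 * h 0 * h 1 + (a - q 0) * h 1 ^ 2) =
      ((a + q 0) * h 0 + q 1 * h 1) ^ 2 + (a ^ 2 - (q 0 ^ 2 + q 1 ^ 2)) * h 1 ^ 2 := by ring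
  refine pos_of_mul_pos_right (a := a + q 0) ?_ h1.le
  rw [h2]
  by_cases h10 : h 1 = 0
  · have h00 : h 0 ≠ 0 := fun h00 => hh (Plane.ext (by simpa using h00) (by simpa using h10))
    have := mul_ne_zero h1.ne' h00
    simp only [h10, mul_zero, add_zero]
    positivity
  · have : 0 < a ^ 2 - (q 0 ^ 2 + q 1 ^ 2) := by linarith
    positivity

lemma norm_sq_le_of_inner_lensJac_nonneg {a : ℝ} {q : Plane}
    (H : ∀ h, 0 ≤ inner ℝ (lensJac a q h) h) : ‖q‖ ^ 2 ≤ a ^ 2 := by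
  rw [Plane.norm_sq]
  by_contra! hlt
  have H' : ∀ s t : ℝ, 0 ≤ (a + q 0) * s ^ 2 + 2 * q 1 * s * t + (a - q 0) * t ^ 2 := by
    intro s t; simpa [inner_lensJac] using H !₂[s, t]
  -- At this vector the form equals `(a + q 0) * (a ^ 2 - ‖q‖ ^ 2)`, so only the degenerate case `a
  -- + q 0 = 0` survives.
  have h1 := H' (-q 1) (a + q 0)
  have h2 := H' 1 0
  have h3 : a + q 0 = 0 := by
    by_contra hne
    have : 0 < a + q 0 := lt_of_le_of_ne (by simpa using h2) (Ne.symm hne)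
    nlinarith [mul_pos this (sub_pos.2 hlt)]
  have h4 : q 1 ≠ 0 := by
    intro h4
    rw [h4, show q 0 = -a by linarith] at hlt
    simp at hlt
  -- When `a + q 0 = 0`, the form is linear in the first coordinate; this value makes it `-1`.
  have h5 := H' (-(a - q 0 + 1) / (2 * q 1)) 1
  rw [h3] at h5
  have : 2 * q 1 * (-(a - q 0 + 1) / (2 * q 1)) = -(a - q 0 + 1) := by field_simp
  rw [this] at h5
  linarith

/-- In complex notation the map is the reciprocal of the conjugate of `x - p`, which is
antiholomorphic. Its derivative is thus symmetric and trace-free, and a star contributes pure shear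
away from its position. -/
lemma hasFDerivAt_inversion {p x : Plane} (hx : x ≠ p) :
    HasFDerivAt (fun x : Plane => (‖x - p‖ ^ 2)⁻¹ • (x - p)) (-traceFree (starShear (x - p))) x := by
  have h0 : HasFDerivAt (fun x : Plane => x - p) (ContinuousLinearMap.id ℝ Plane) x :=
    (hasFDerivAt_id x).sub_const p
  have hne : ‖x - p‖ ^ 2 ≠ 0 := by simpa [sub_eq_zero] using hx
  have h1 := ((hasDerivAt_inv hne).comp_hasFDerivAt x h0.norm_sq).smul h0
  simp only [Function.comp_apply] at h1
  refine h1.congr_fderiv ?_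
  have hN : ‖x - p‖ ^ 2 = (x - p) 0 ^ 2 + (x - p) 1 ^ 2 := Plane.norm_sq _
  have hN4 : ‖x - p‖ ^ 4 = ((x - p) 0 ^ 2 + (x - p) 1 ^ 2) ^ 2 := by rw [← hN]; ring
  set r := x - p with hr
  rw [hN] at hne
  ext1 h
  apply Plane.ext
  · simp [starShear, hN4, hN, Plane.inner_eq]
    field_simp
    ring
  · simp [starShear, hN4, hN, Plane.inner_eq]
    field_simp
    ring

variable {g : ℕ} {κc γ m : ℝ} {ξ : Fin g → Plane} {x y : Plane}

lemma ne_of_mem_lensDomain (hx : x ∈ lensDomain ξ) (j : Fin g) : x ≠ ξ j :=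
  fun h => hx ⟨j, h.symm⟩

lemma isOpen_lensDomain (ξ : Fin g → Plane) : IsOpen (lensDomain ξ) :=
  (Set.finite_range ξ).isClosed.isOpen_compl

lemma hasFDerivAt_lensField (hx : x ∈ lensDomain ξ) :
    HasFDerivAt (lensField κc γ m ξ) (lensJac (1 - κc) (totalShear γ m ξ x)) x := by
  have h1 : HasFDerivAt (fun x : Plane => (1 - κc) • x)
      ((1 - κc) • ContinuousLinearMap.id ℝ Plane) x := ((1 - κc) • ContinuousLinearMap.id ℝ Plane).hasFDerivAt
  have h2 : HasFDerivAt (fun x : Plane => γ • (!₂[x 0, -x 1] : Plane))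
      (traceFree !₂[γ, 0]) x := by
    refine (traceFree !₂[γ, 0]).hasFDerivAt.congr_of_eventuallyEq (.of_forall fun z => ?_)
    apply Plane.ext <;> simp
  have h3 := (HasFDerivAt.fun_sum (u := Finset.univ)
    fun j _ => hasFDerivAt_inversion (ne_of_mem_lensDomain hx j)).const_smul m
  refine ((h1.add h2).sub h3).congr_fderiv ?_
  rw [totalShear, lensJac, traceFree_add, shear, traceFree_smul, traceFree_sum,
    Finset.sum_neg_distrib]
  module

lemma hasGradientAt_log_norm {p x : Plane} (hx : x ≠ p) :
    HasGradientAt (fun x : Plane => Real.log ‖x - p‖) ((‖x - p‖ ^ 2)⁻¹ • (x - p)) x := by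
  have h0 : HasFDerivAt (fun x : Plane => x - p) (ContinuousLinearMap.id ℝ Plane) x :=
    (hasFDerivAt_id x).sub_const p
  have hne : ‖x - p‖ ^ 2 ≠ 0 := by simpa [sub_eq_zero] using hx
  have h1 := (h0.norm_sq.log hne).const_mul (1 / 2)
  rw [hasGradientAt_iff_hasFDerivAt]
  refine (h1.congr_fderiv ?_).congr_of_eventuallyEq (.of_forall fun z => ?_)
  · ext1 h
    simp
    ring
  · simp only [Real.log_pow]; push_cast; ring

lemma hasGradientAt_potential (hx : x ∈ lensDomain ξ) :
    HasGradientAt (potential κc γ m ξ) (x - lensField κc γ m ξ x) x := by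
  rw [hasGradientAt_iff_hasFDerivAt]
  have h1 : HasFDerivAt (fun x : Plane => κc / 2 * ‖x‖ ^ 2) ((κc / 2) • (2 • innerSL ℝ x)) x :=
    (hasFDerivAt_id x).norm_sq.const_mul _
  have hc : ∀ i, HasFDerivAt (fun x : Plane => x i)
      (EuclideanSpace.proj i : Plane →L[ℝ] ℝ) x := fun i =>
    (EuclideanSpace.proj i : Plane →L[ℝ] ℝ).hasFDerivAt
  have h2 := (((hc 0).pow 2).sub ((hc 1).pow 2)).const_mul (γ / 2)
  have h3 := HasFDerivAt.fun_sum (u := Finset.univ) fun j (_ : j ∈ Finset.univ) =>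
    (hasGradientAt_iff_hasFDerivAt.1
      (hasGradientAt_log_norm (ne_of_mem_lensDomain hx j))).const_mul m
  refine ((h1.sub h2).add h3).congr_fderiv ?_
  ext1 h
  simp only [lensField, add_apply, sub_apply,
    sum_apply, smul_apply,
    InnerProductSpace.toDual_apply_apply, inner_sub_left, inner_add_left, inner_smul_left,
    sum_inner, Finset.mul_sum, innerSL_apply_apply]
  simp [Plane.inner_eq]
  ring

lemma lensingMap_eq (hx : x ∈ lensDomain ξ) : lensingMap κc γ m ξ x = lensField κc γ m ξ x := by
  rw [lensingMap, (hasGradientAt_potential hx).gradient, sub_sub_cancel]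

lemma hasGradientAt_timeDelay (y : Plane) (hx : x ∈ lensDomain ξ) :
    HasGradientAt (timeDelay κc γ m ξ y) (lensField κc γ m ξ x - y) x := by
  rw [hasGradientAt_iff_hasFDerivAt]
  have h0 : HasFDerivAt (fun x : Plane => x - y) (ContinuousLinearMap.id ℝ Plane) x :=
    (hasFDerivAt_id x).sub_const y
  have h1 := h0.norm_sq.const_mul (1 / 2)
  have h2 := h1.sub (hasGradientAt_iff_hasFDerivAt.1
    (hasGradientAt_potential (κc := κc) (γ := γ) (m := m) hx))
  refine (h2.congr_fderiv ?_).congr_of_eventuallyEq (.of_forall fun z => ?_)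
  · ext1 h
    simp
  · simp [timeDelay]; ring

/-! ### Minimum images -/

lemma hasDerivAt_timeDelay_line (y h : Plane) (t : ℝ) (hx : x + t • h ∈ lensDomain ξ) :
    HasDerivAt (fun t : ℝ => timeDelay κc γ m ξ y (x + t • h))
      (inner ℝ (lensField κc γ m ξ (x + t • h) - y) h) t := by
  have h1 : HasDerivAt (fun t : ℝ => x + t • h) h t := by
    simpa using ((hasDerivAt_id t).smul_const h).const_add x
  simpa [Function.comp_def, inner_sub_left] using
    (hasGradientAt_iff_hasFDerivAt.1 (hasGradientAt_timeDelay (κc := κc) (γ := γ) (m := m) y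
      hx)).comp_hasDerivAt t h1

lemma hasDerivAt_inner_lensField_line (y h : Plane) (t : ℝ) (hx : x + t • h ∈ lensDomain ξ) :
    HasDerivAt (fun t : ℝ => inner ℝ (lensField κc γ m ξ (x + t • h) - y) h)
      (inner ℝ (lensJac (1 - κc) (totalShear γ m ξ (x + t • h)) h) h) t := by
  have h1 : HasDerivAt (fun t : ℝ => x + t • h) h t := by
    simpa using ((hasDerivAt_id t).smul_const h).const_add x
  have h2 := ((hasFDerivAt_lensField (κc := κc) (γ := γ) (m := m) hx).comp_hasDerivAt t h1).sub_const y
  simpa using h2.inner ℝ (hasDerivAt_const t h)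

/-- Second order necessary condition. Were the second derivative negative along a line, the point
would be a local maximum on that line as well as a local minimum; the time delay would be constant
there, and its second derivative zero. -/
lemma norm_totalShear_sq_le_of_mem_minImages (hx : x ∈ minImages κc γ m ξ y) :
    ‖totalShear γ m ξ x‖ ^ 2 ≤ (1 - κc) ^ 2 := by
  obtain ⟨hxL, hxy, hmin⟩ := hx
  rw [lensingMap_eq hxL] at hxy
  refine norm_sq_le_of_inner_lensJac_nonneg fun h => ?_
  by_contra! hneg
  have hcont : Continuous fun t : ℝ => x + t • h := by fun_prop
  have hev : ∀ᶠ t : ℝ in 𝓝 0, x + t • h ∈ lensDomain ξ := by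
    refine hcont.continuousAt.eventually ((isOpen_lensDomain ξ).mem_nhds ?_)
    simpa using hxL
  set f : ℝ → ℝ := fun t => timeDelay κc γ m ξ y (x + t • h) with hf
  have hd : deriv f =ᶠ[𝓝 0] fun t => inner ℝ (lensField κc γ m ξ (x + t • h) - y) h :=
    hev.mono fun t ht => (hasDerivAt_timeDelay_line y h t ht).deriv
  have hdd : deriv (deriv f) 0 = inner ℝ (lensJac (1 - κc) (totalShear γ m ξ x) h) h := by
    rw [hd.deriv_eq, (hasDerivAt_inner_lensField_line y h 0 hev.self_of_nhds).deriv]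
    simp
  have hd0 : deriv f 0 = 0 := by rw [hd.eq_of_nhds]; simp [hxy]
  have hfc : ContinuousAt f 0 := (hasDerivAt_timeDelay_line y h 0 hev.self_of_nhds).continuousAt
  have hmax := isLocalMax_of_deriv_deriv_neg (by rw [hdd]; exact hneg) hd0 hfc
  have hmin' : IsLocalMin f 0 := by
    have : Tendsto (fun t : ℝ => x + t • h) (𝓝 0) (𝓝 x) := by simpa using hcont.tendsto 0
    have := this.eventually hmin
    simpa [IsLocalMin, IsMinFilter, hf] using this
  have hconst : f =ᶠ[𝓝 0] fun _ => f 0 := by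
    filter_upwards [hmax, hmin'] with t h1 h2 using le_antisymm h1 h2
  have : deriv f =ᶠ[𝓝 0] fun _ => 0 := by
    simpa using hconst.deriv
  rw [this.deriv_eq, deriv_const] at hdd
  linarith

/-- A positive definite derivative on a convex set makes the field strictly monotone along segments.
This gives injectivity on the set, and also minimality, since the field minus `y` is the gradient of
the time delay. -/
lemma strictMonoOn_inner_lensField (hκ1 : κc < 1) {B : Set Plane} (hBc : Convex ℝ B)
    (hB : B ⊆ lensDomain ξ) (hBs : ∀ z ∈ B, ‖totalShear γ m ξ z‖ ^ 2 < (1 - κc) ^ 2)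
    {z : Plane} (hx : x ∈ B) (hz : z ∈ B) (hne : x ≠ z) (y : Plane) :
    StrictMonoOn (fun t : ℝ => inner ℝ (lensField κc γ m ξ (x + t • (z - x)) - y) (z - x))
      (Set.Icc 0 1) := by
  have hmem : ∀ t ∈ Set.Icc (0 : ℝ) 1, x + t • (z - x) ∈ B := fun t ht =>
    hBc.add_smul_sub_mem hx hz ht
  have hd : ∀ t ∈ Set.Icc (0 : ℝ) 1, _ := fun t ht =>
    hasDerivAt_inner_lensField_line (κc := κc) (γ := γ) (m := m) y (z - x) t (hB (hmem t ht))
  refine strictMonoOn_of_deriv_pos (convex_Icc 0 1)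
    (fun t ht => (hd t ht).continuousAt.continuousWithinAt) fun t ht => ?_
  have ht' := interior_subset ht
  rw [(hd t ht').deriv]
  exact inner_lensJac_pos (by linarith) (hBs _ (hmem t ht')) (sub_ne_zero.2 hne.symm)

lemma injOn_lensField (hκ1 : κc < 1) {B : Set Plane} (hBc : Convex ℝ B)
    (hB : B ⊆ lensDomain ξ) (hBs : ∀ z ∈ B, ‖totalShear γ m ξ z‖ ^ 2 < (1 - κc) ^ 2) :
    Set.InjOn (lensField κc γ m ξ) B := by
  intro x hx z hz hxz
  by_contra hne
  have := strictMonoOn_inner_lensField hκ1 hBc hB hBs hx hz hne 0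
    (Set.left_mem_Icc.2 zero_le_one) (Set.right_mem_Icc.2 zero_le_one) zero_lt_one
  simp [hxz] at this

lemma mem_minImages_of_norm_totalShear_lt (hκ1 : κc < 1) {B : Set Plane} (hBc : Convex ℝ B)
    (hBo : IsOpen B)
    (hB : B ⊆ lensDomain ξ) (hBs : ∀ z ∈ B, ‖totalShear γ m ξ z‖ ^ 2 < (1 - κc) ^ 2)
    (hx : x ∈ B) (hxy : lensField κc γ m ξ x = y) : x ∈ minImages κc γ m ξ y := by
  refine ⟨hB hx, (lensingMap_eq (hB hx)).trans hxy, ?_⟩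
  filter_upwards [hBo.mem_nhds hx] with z hz
  by_cases hne : x = z
  · rw [hne]
  have hmono := strictMonoOn_inner_lensField hκ1 hBc hB hBs hx hz hne y
  have hmem : ∀ t ∈ Set.Icc (0 : ℝ) 1, x + t • (z - x) ∈ B := fun t ht =>
    hBc.add_smul_sub_mem hx hz ht
  have hd : ∀ t ∈ Set.Icc (0 : ℝ) 1, _ := fun t ht =>
    hasDerivAt_timeDelay_line (κc := κc) (γ := γ) (m := m) y (z - x) t (hB (hmem t ht))
  have hm : MonotoneOn (fun t : ℝ => timeDelay κc γ m ξ y (x + t • (z - x))) (Set.Icc 0 1) := by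
    refine monotoneOn_of_deriv_nonneg (convex_Icc 0 1)
      (fun t ht => (hd t ht).continuousAt.continuousWithinAt)
      (fun t ht => (hd t (interior_subset ht)).differentiableAt.differentiableWithinAt)
      fun t ht => ?_
    have ht' := interior_subset ht
    rw [(hd t ht').deriv]
    have := hmono.monotoneOn (Set.left_mem_Icc.2 zero_le_one) ht' ht'.1
    simpa [hxy] using this
  simpa using hm (Set.left_mem_Icc.2 zero_le_one) (Set.right_mem_Icc.2 zero_le_one) zero_le_one

end

section

/-! ### Area formula for the minimum images -/

variable {g : ℕ} {κc γ m : ℝ}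

/-- Pairs of a point and a star configuration, the point being off the stars. -/
def regularPairs (g : ℕ) : Set (Plane × (Fin g → Plane)) := {p | p.1 ∈ lensDomain p.2}

/-- Pairs at which the lensing map has positive Jacobian determinant. -/
def positivePairs (g : ℕ) (κc γ m : ℝ) : Set (Plane × (Fin g → Plane)) :=
  {p | p ∈ regularPairs g ∧ ‖totalShear γ m p.2 p.1‖ ^ 2 < (1 - κc) ^ 2}

/-- Pairs at which the Jacobian determinant of the lensing map vanishes. -/
def criticalPairs (g : ℕ) (κc γ m : ℝ) : Set (Plane × (Fin g → Plane)) :=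
  {p | p ∈ regularPairs g ∧ ‖totalShear γ m p.2 p.1‖ ^ 2 = (1 - κc) ^ 2}

/-- The lensing map together with the star configuration. -/
def lensPair (g : ℕ) (κc γ m : ℝ) (p : Plane × (Fin g → Plane)) : Plane × (Fin g → Plane) :=
  (lensField κc γ m p.2 p.1, p.2)

lemma mem_regularPairs {p : Plane × (Fin g → Plane)} :
    p ∈ regularPairs g ↔ ∀ j, p.1 - p.2 j ≠ 0 := by
  simp [regularPairs, lensDomain, sub_eq_zero, eq_comm]

lemma isOpen_regularPairs : IsOpen (regularPairs g) := by
  have : regularPairs g = ⋂ j, {p : Plane × (Fin g → Plane) | p.1 - p.2 j ≠ 0} := by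
    ext p; simp only [mem_regularPairs, Set.mem_iInter, Set.mem_ofPred_eq]
  rw [this]
  exact isOpen_iInter_of_finite fun j => isOpen_ne_fun (by fun_prop) continuous_const

lemma measurable_starShear : Measurable starShear := by
  unfold starShear
  have : Measurable fun r : Plane => ![(r 0 ^ 2 - r 1 ^ 2) / ‖r‖ ^ 4, 2 * r 0 * r 1 / ‖r‖ ^ 4] := by
    refine measurable_pi_iff.2 fun i => ?_
    fin_cases i <;> simp <;> fun_prop
  exact (WithLp.measurable_toLp 2 _).comp this

lemma continuousOn_starShear : ContinuousOn starShear {0}ᶜ := by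
  unfold starShear
  refine (PiLp.continuous_toLp 2 _).comp_continuousOn (continuousOn_pi.2 fun i => ?_)
  have h : ∀ r ∈ ({0}ᶜ : Set Plane), ‖r‖ ^ 4 ≠ 0 := fun r hr => by simpa using hr
  fin_cases i
  · exact ContinuousOn.div (by fun_prop) (by fun_prop) h
  · exact ContinuousOn.div (by fun_prop) (by fun_prop) h

lemma measurable_totalShear (γ m : ℝ) :
    Measurable fun p : Plane × (Fin g → Plane) => totalShear γ m p.2 p.1 := by
  unfold totalShear shear
  have h : ∀ j, Measurable fun p : Plane × (Fin g → Plane) => starShear (p.1 - p.2 j) :=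
    fun j => measurable_starShear.comp (by fun_prop)
  exact ((Finset.measurable_fun_sum _ fun j _ => h j).const_smul m).const_add _

lemma continuousOn_totalShear (γ m : ℝ) :
    ContinuousOn (fun p : Plane × (Fin g → Plane) => totalShear γ m p.2 p.1) (regularPairs g) := by
  unfold totalShear shear
  have h : ∀ j, ContinuousOn (fun p : Plane × (Fin g → Plane) => starShear (p.1 - p.2 j))
      (regularPairs g) := fun j =>
    continuousOn_starShear.comp (by fun_prop) fun p hp => mem_regularPairs.1 hp j
  exact continuousOn_const.add ((continuousOn_finsetSum _ fun j _ => h j).const_smul m)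

lemma continuousOn_lensPair : ContinuousOn (lensPair g κc γ m) (regularPairs g) := by
  unfold lensPair lensField
  have h : ∀ j, ContinuousOn (fun p : Plane × (Fin g → Plane) =>
      (‖p.1 - p.2 j‖ ^ 2)⁻¹ • (p.1 - p.2 j)) (regularPairs g) := fun j => by
    have hc : Continuous fun p : Plane × (Fin g → Plane) => p.1 - p.2 j := by fun_prop
    refine ContinuousOn.smul (ContinuousOn.inv₀ (hc.norm.pow 2).continuousOn fun p hp => ?_)
      hc.continuousOn
    simpa using mem_regularPairs.1 hp j
  have h2 : Continuous fun p : Plane × (Fin g → Plane) => (!₂[p.1 0, -p.1 1] : Plane) := by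
    refine (PiLp.continuous_toLp 2 _).comp (continuous_pi fun i => ?_)
    fin_cases i
    · simp; fun_prop
    · simp; fun_prop
  refine ContinuousOn.prodMk (ContinuousOn.sub (ContinuousOn.add (by fun_prop)
    (h2.continuousOn.const_smul γ)) ((continuousOn_finsetSum _ fun j _ => h j).const_smul m))
    (by fun_prop)

lemma isOpen_positivePairs : IsOpen (positivePairs g κc γ m) :=
  ((continuousOn_totalShear γ m).norm.pow 2).isOpen_inter_preimage isOpen_regularPairs
    (isOpen_Iio (a := (1 - κc) ^ 2))

/-- Injectivity fails near critical points, so measurability comes from σ-compactness instead: the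
open set of regular pairs is a countable union of closed sets, the critical condition is closed on
each of them, and continuous images of compact sets are compact. -/
lemma measurableSet_image_criticalPairs :
    MeasurableSet (lensPair g κc γ m '' criticalPairs g κc γ m) := by
  obtain ⟨F, hFc, -, hFU, -⟩ := (isOpen_regularPairs (g := g)).exists_iUnion_isClosed
  have hFR : ∀ n, F n ⊆ regularPairs g := fun n => hFU ▸ Set.subset_iUnion F n
  have hcl : ∀ n, IsClosed (F n ∩
      (fun p : Plane × (Fin g → Plane) => ‖totalShear γ m p.2 p.1‖ ^ 2) ⁻¹' {(1 - κc) ^ 2}) :=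
    fun n => (((continuousOn_totalShear γ m).norm.pow 2).mono (hFR n)).preimage_isClosed_of_isClosed
      (hFc n) isClosed_singleton
  have hC : criticalPairs g κc γ m = ⋃ n, ⋃ k : ℕ, (F n ∩
      (fun p : Plane × (Fin g → Plane) => ‖totalShear γ m p.2 p.1‖ ^ 2) ⁻¹' {(1 - κc) ^ 2}) ∩
      Metric.closedBall 0 k := by
    simp_rw [← Set.inter_iUnion, Metric.iUnion_closedBall_nat, Set.inter_univ, ← Set.iUnion_inter]
    rw [hFU]
    rfl
  rw [hC, Set.image_iUnion]
  simp_rw [Set.image_iUnion]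
  refine .iUnion fun n => .iUnion fun k => IsCompact.measurableSet (IsCompact.image_of_continuousOn
    ((isCompact_closedBall _ _).inter_left (hcl n)) (continuousOn_lensPair.mono fun p hp =>
      hFR n hp.1.1))

/-- Sard's theorem for equal dimensions, applied with the stars fixed. -/
lemma volume_section_image_criticalPairs (ξ : Fin g → Plane) :
    volume {y | (y, ξ) ∈ lensPair g κc γ m '' criticalPairs g κc γ m} = 0 := by
  have : {y | (y, ξ) ∈ lensPair g κc γ m '' criticalPairs g κc γ m} ⊆
      lensField κc γ m ξ '' {x | (x, ξ) ∈ criticalPairs g κc γ m} := by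
    rintro y ⟨⟨x, ξ'⟩, hp, h⟩
    simp only [lensPair, Prod.mk.injEq] at h
    obtain ⟨h1, rfl⟩ := h
    exact ⟨x, hp, h1⟩
  refine measure_mono_null this (addHaar_image_eq_zero_of_det_fderivWithin_eq_zero volume
    (fun x hx => (hasFDerivAt_lensField hx.1).hasFDerivWithinAt) fun x hx => ?_)
  rw [det_lensJac, hx.2, sub_self]

/-- Boxes rather than general open sets: the convex first factor makes the lensing map injective for
each star configuration in the second, so `lensPair` is injective on each box. Balls of the sup
metric are such boxes. -/
lemma exists_box_cover_positivePairs (g : ℕ) (κc γ m : ℝ) :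
    ∃ W : ℕ → Set (Plane × (Fin g → Plane)),
      (∀ n, ∃ (B : Set Plane) (B' : Set (Fin g → Plane)), Convex ℝ B ∧ IsOpen B ∧ IsOpen B' ∧
        W n = B ×ˢ B' ∧ W n ⊆ positivePairs g κc γ m) ∧ ⋃ n, W n = positivePairs g κc γ m := by
  have hex : ∀ p ∈ positivePairs g κc γ m, ∃ ε > 0, Metric.ball p ε ⊆ positivePairs g κc γ m :=
    fun p hp => Metric.isOpen_iff.1 isOpen_positivePairs p hp
  choose! ε hε hsub using hex
  obtain ⟨t, htV, htc, hcov⟩ := TopologicalSpace.countable_cover_nhdsWithin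
    (f := fun p => Metric.ball p (ε p)) (s := positivePairs g κc γ m)
    fun p hp => mem_nhdsWithin_of_mem_nhds (Metric.ball_mem_nhds p (hε p hp))
  rcases t.eq_empty_or_nonempty with rfl | hne
  · refine ⟨fun _ => ∅, fun n => ⟨∅, ∅, convex_empty, isOpen_empty, isOpen_empty, by simp,
      Set.empty_subset _⟩, ?_⟩
    simpa [eq_comm] using hcov
  · obtain ⟨f, rfl⟩ := htc.exists_eq_range hne
    have hf : ∀ n, f n ∈ positivePairs g κc γ m := fun n => htV ⟨n, rfl⟩
    refine ⟨fun n => Metric.ball (f n) (ε (f n)), fun n =>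
      ⟨Metric.ball (f n).1 (ε (f n)), Metric.ball (f n).2 (ε (f n)), convex_ball _ _,
        Metric.isOpen_ball, Metric.isOpen_ball, (ball_prod_same _ _ _).symm, hsub _ (hf n)⟩,
      Set.Subset.antisymm (Set.iUnion_subset fun n => hsub _ (hf n)) ?_⟩
    simpa using hcov

lemma encard_iUnion_of_subsingleton {α : Type*} [MeasurableSpace α] [MeasurableSingletonClass α]
    {Z : ℕ → Set α} (hZ : ∀ n, (Z n).Subsingleton) (hd : Pairwise fun i j => Disjoint (Z i) (Z j)) :
    ((⋃ n, Z n).encard : ℝ≥0∞) = ∑' n, ((Z n).encard : ℝ≥0∞) := by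
  have hm : ∀ n, MeasurableSet (Z n) := fun n => (hZ n).measurableSet
  rw [← Measure.count_apply (.iUnion hm), measure_iUnion hd hm]
  exact tsum_congr fun n => Measure.count_apply (hm n)

lemma ae_mem_lensDomain (ξ : Fin g → Plane) : ∀ᵐ x ∂(volume : Measure Plane), x ∈ lensDomain ξ :=
  measure_eq_zero_iff_ae_notMem.1 ((Set.finite_range ξ).measure_zero volume)

/-- The number of nondegenerate minimum images is a measurable function of the source and the
stars, and its integral over all sources is given by the area formula. -/
lemma exists_measurable_count (hκ1 : κc < 1) {D : Set Plane} (hD : MeasurableSet D) :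
    ∃ N : Plane × (Fin g → Plane) → ℝ≥0∞, Measurable N ∧
      (∀ y ξ, N (y, ξ) =
        ({x | x ∈ D ∧ (x, ξ) ∈ positivePairs g κc γ m ∧ lensField κc γ m ξ x = y}.encard : ℝ≥0∞)) ∧
      ∀ ξ, ∫⁻ y, N (y, ξ) =
        ∫⁻ x in D, ENNReal.ofReal ((1 - κc) ^ 2 - ‖totalShear γ m ξ x‖ ^ 2) := by
  obtain ⟨W, hW, hWU⟩ := exists_box_cover_positivePairs g κc γ m
  have hWm : ∀ n, MeasurableSet (W n) := fun n => by
    obtain ⟨B, B', -, h1, h2, h3, -⟩ := hW n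
    rw [h3]; exact (h1.prod h2).measurableSet
  have hinj : ∀ n (ξ : Fin g → Plane) x x', (x, ξ) ∈ W n → (x', ξ) ∈ W n →
      lensField κc γ m ξ x = lensField κc γ m ξ x' → x = x' := by
    intro n ξ x x' hx hx' h
    obtain ⟨B, B', hBc, -, -, h3, h4⟩ := hW n
    rw [h3] at hx hx' h4
    have hB : ∀ z ∈ B, (z, ξ) ∈ positivePairs g κc γ m := fun z hz => h4 ⟨hz, hx.2⟩
    exact injOn_lensField hκ1 hBc (fun z hz => (hB z hz).1) (fun z hz => (hB z hz).2) hx.1 hx'.1 h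
  -- Disjoint pieces: each nondegenerate image in `D` is counted once, and injectivity is inherited
  -- from the boxes.
  set E : ℕ → Set (Plane × (Fin g → Plane)) := fun n => disjointed W n ∩ (D ×ˢ Set.univ) with hE
  have hEW : ∀ n, E n ⊆ W n := fun n p hp => disjointed_subset W n hp.1
  have hEP : ∀ n, E n ⊆ positivePairs g κc γ m := fun n p hp =>
    hWU ▸ Set.mem_iUnion.2 ⟨n, hEW n hp⟩
  have hEm : ∀ n, MeasurableSet (E n) := fun n =>
    (MeasurableSet.disjointed hWm n).inter (hD.prod .univ)
  have hEd : Pairwise fun i j => Disjoint (E i) (E j) := fun i j hij =>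
    (disjoint_disjointed W hij).mono Set.inter_subset_left Set.inter_subset_left
  have hEU : ⋃ n, E n = positivePairs g κc γ m ∩ (D ×ˢ Set.univ) := by
    rw [← Set.iUnion_inter, iUnion_disjointed, hWU]
  -- Lusin–Souslin: an injective continuous image of a Borel set is Borel. This is the source of
  -- joint measurability in the source and the stars.
  have hIm : ∀ n, MeasurableSet (lensPair g κc γ m '' E n) := fun n => by
    refine (hEm n).image_of_continuousOn_injOn
      (continuousOn_lensPair.mono fun p hp => (hEP n hp).1) ?_
    rintro ⟨x, ξ⟩ hp ⟨x', ξ'⟩ hp' h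
    simp only [lensPair, Prod.mk.injEq] at h
    obtain ⟨h1, rfl⟩ := h
    rw [hinj n ξ x x' (hEW n hp) (hEW n hp') h1]
  have hmemIm : ∀ n y ξ, (y, ξ) ∈ lensPair g κc γ m '' E n ↔
      ∃ x, (x, ξ) ∈ E n ∧ lensField κc γ m ξ x = y := by
    intro n y ξ
    constructor
    · rintro ⟨⟨x, ξ'⟩, hp, h⟩
      simp only [lensPair, Prod.mk.injEq] at h
      obtain ⟨h1, rfl⟩ := h
      exact ⟨x, hp, h1⟩
    · rintro ⟨x, hx, h⟩
      exact ⟨(x, ξ), hx, by simp [lensPair, h]⟩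
  refine ⟨fun p => ∑' n, (lensPair g κc γ m '' E n).indicator 1 p,
    Measurable.tsum fun n => measurable_one.indicator (hIm n), fun y ξ => ?_, fun ξ => ?_⟩
  · have hZ : {x | x ∈ D ∧ (x, ξ) ∈ positivePairs g κc γ m ∧ lensField κc γ m ξ x = y} =
        ⋃ n, {x | (x, ξ) ∈ E n ∧ lensField κc γ m ξ x = y} := by
      ext x
      have : (x, ξ) ∈ ⋃ n, E n ↔ (x, ξ) ∈ positivePairs g κc γ m ∧ x ∈ D := by rw [hEU]; simp
      simp only [Set.mem_iUnion] at this
      simp only [Set.mem_ofPred_eq, Set.mem_iUnion, exists_and_right, this]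
      tauto
    have hsub : ∀ n, {x | (x, ξ) ∈ E n ∧ lensField κc γ m ξ x = y}.Subsingleton :=
      fun n x hx x' hx' => hinj n ξ x x' (hEW n hx.1) (hEW n hx'.1) (hx.2.trans hx'.2.symm)
    rw [hZ, encard_iUnion_of_subsingleton hsub fun i j hij => ?_]
    · refine tsum_congr fun n => ?_
      by_cases h : (y, ξ) ∈ lensPair g κc γ m '' E n
      · obtain ⟨x, hx⟩ := (hmemIm n y ξ).1 h
        rw [Set.indicator_of_mem h, (hsub n).eq_singleton_of_mem (x := x) hx]
        simp
      · have he : {x | (x, ξ) ∈ E n ∧ lensField κc γ m ξ x = y} = ∅ :=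
          Set.eq_empty_of_forall_notMem fun x hx => h ((hmemIm n y ξ).2 ⟨x, hx⟩)
        rw [Set.indicator_of_notMem h, he]
        simp
    · exact Set.disjoint_left.2 fun x hx hx' => Set.disjoint_left.1 (hEd hij) hx.1 hx'.1
  · have hsec : Measurable fun y : Plane => (y, ξ) := by fun_prop
    change ∫⁻ y, ∑' n, (lensPair g κc γ m '' E n).indicator (1 : Plane × (Fin g → Plane) → ℝ≥0∞) (y, ξ) = _
    rw [lintegral_tsum (f := fun n y => (lensPair g κc γ m '' E n).indicator (1 : Plane × (Fin g → Plane) → ℝ≥0∞) (y, ξ))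
      fun n => ((measurable_one.indicator (hIm n)).comp hsec).aemeasurable]
    have h1 : ∀ n, ∫⁻ y, (lensPair g κc γ m '' E n).indicator (1 : Plane × (Fin g → Plane) → ℝ≥0∞) (y, ξ) =
        ∫⁻ x in {x | (x, ξ) ∈ E n},
          ENNReal.ofReal ((1 - κc) ^ 2 - ‖totalShear γ m ξ x‖ ^ 2) := by
      intro n
      have h2 : (fun y => (lensPair g κc γ m '' E n).indicator (1 : Plane × (Fin g → Plane) → ℝ≥0∞) (y, ξ)) =
          (lensField κc γ m ξ '' {x | (x, ξ) ∈ E n}).indicator 1 := by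
        ext y
        by_cases h : (y, ξ) ∈ lensPair g κc γ m '' E n
        · rw [Set.indicator_of_mem h, Set.indicator_of_mem]
          · simp
          · exact (hmemIm n y ξ).1 h
        · rw [Set.indicator_of_notMem h, Set.indicator_of_notMem]
          exact fun h' => h ((hmemIm n y ξ).2 h')
      have hSm : MeasurableSet {x | (x, ξ) ∈ E n} := hEm n |>.preimage hsec
      have hder : ∀ x ∈ {x | (x, ξ) ∈ E n}, HasFDerivWithinAt (lensField κc γ m ξ)
          (lensJac (1 - κc) (totalShear γ m ξ x)) {x | (x, ξ) ∈ E n} x := fun x hx =>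
        (hasFDerivAt_lensField (hEP n hx).1).hasFDerivWithinAt
      have hinjS : Set.InjOn (lensField κc γ m ξ) {x | (x, ξ) ∈ E n} := fun x hx x' hx' h =>
        hinj n ξ x x' (hEW n hx) (hEW n hx') h
      rw [h2, lintegral_indicator_one (measurable_image_of_fderivWithin hSm hder hinjS),
        ← lintegral_abs_det_fderiv_eq_addHaar_image volume hSm hder hinjS]
      refine setLIntegral_congr_fun hSm fun x hx => ?_
      simp only [det_lensJac]
      rw [abs_of_pos (sub_pos.2 (hEP n hx).2)]
    simp_rw [h1]
    rw [← lintegral_iUnion (s := fun n => {x | (x, ξ) ∈ E n}) (fun n => (hEm n).preimage hsec)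
      (fun i j hij => (hEd hij).preimage _)]
    have h3 : (⋃ n, {x | (x, ξ) ∈ E n}) = {x | (x, ξ) ∈ positivePairs g κc γ m} ∩ D := by
      ext x
      have : (x, ξ) ∈ ⋃ n, E n ↔ (x, ξ) ∈ positivePairs g κc γ m ∧ x ∈ D := by rw [hEU]; simp
      simpa using this
    have hVm : MeasurableSet {x | (x, ξ) ∈ positivePairs g κc γ m} :=
      isOpen_positivePairs.measurableSet.preimage hsec
    -- Off the positive set the determinant is `≤ 0` and `ENNReal.ofReal` kills it, so the
    -- restriction can be dropped; the stars themselves form a null set.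
    rw [h3, ← Measure.restrict_restrict hVm, ← lintegral_indicator hVm]
    refine lintegral_congr_ae ?_
    filter_upwards [ae_restrict_of_ae (ae_mem_lensDomain ξ)] with x hx
    by_cases h : (x, ξ) ∈ positivePairs g κc γ m
    · rw [Set.indicator_of_mem (show x ∈ {x | (x, ξ) ∈ positivePairs g κc γ m} from h)]
    · rw [Set.indicator_of_notMem (show x ∉ {x | (x, ξ) ∈ positivePairs g κc γ m} from h)]
      symm
      rw [ENNReal.ofReal_eq_zero, sub_nonpos]
      by_contra! hlt
      exact h ⟨hx, hlt⟩

lemma subset_minImages (hκ1 : κc < 1) (D : Set Plane) (ξ : Fin g → Plane) (y : Plane) :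
    {x | x ∈ D ∧ (x, ξ) ∈ positivePairs g κc γ m ∧ lensField κc γ m ξ x = y} ⊆
      minImages κc γ m ξ y ∩ D := by
  rintro x ⟨hxD, hxV, hxy⟩
  refine ⟨?_, hxD⟩
  have ho : IsOpen {z | (z, ξ) ∈ positivePairs g κc γ m} :=
    isOpen_positivePairs.preimage (by fun_prop)
  obtain ⟨ε, hε, hsub⟩ := Metric.isOpen_iff.1 ho x hxV
  exact mem_minImages_of_norm_totalShear_lt hκ1 (convex_ball x ε) Metric.isOpen_ball
    (fun z hz => (hsub hz).1) (fun z hz => (hsub hz).2) (Metric.mem_ball_self hε) hxy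

lemma minImages_subset (D : Set Plane) (ξ : Fin g → Plane) (y : Plane) :
    minImages κc γ m ξ y ∩ D ⊆
      {x | x ∈ D ∧ (x, ξ) ∈ positivePairs g κc γ m ∧ lensField κc γ m ξ x = y} ∪
      {x | (x, ξ) ∈ criticalPairs g κc γ m ∧ lensField κc γ m ξ x = y} := by
  rintro x ⟨hx, hxD⟩
  have hxy : lensField κc γ m ξ x = y := (lensingMap_eq hx.1).symm.trans hx.2.1
  rcases (norm_totalShear_sq_le_of_mem_minImages hx).lt_or_eq with h | h
  · exact Or.inl ⟨hxD, ⟨hx.1, h⟩, hxy⟩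
  · exact Or.inr ⟨⟨hx.1, h⟩, hxy⟩

/-- Area formula for the expected number of minimum images. -/
theorem lintegral_expectedMinima (hκ1 : κc < 1) {Ω : Type*} [MeasurableSpace Ω] (P : Measure Ω)
    [SFinite P] {ξ : Fin g → Ω → Plane} (hξ : AEMeasurable (fun ω j => ξ j ω) P) {D : Set Plane}
    (hD : MeasurableSet D) :
    ∫⁻ y, expectedMinima P κc γ m ξ D y =
      ∫⁻ x in D, ∫⁻ ζ, ENNReal.ofReal ((1 - κc) ^ 2 - ‖totalShear γ m ζ x‖ ^ 2)
        ∂(P.map fun ω j => ξ j ω) := by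
  obtain ⟨N, hNm, hN, hNi⟩ := exists_measurable_count (g := g) (γ := γ) (m := m) hκ1 hD
  set X : Ω → Fin g → Plane := fun ω j => ξ j ω
  set μ := P.map X
  set I : Set (Plane × (Fin g → Plane)) := lensPair g κc γ m '' criticalPairs g κc γ m
  have hIm : MeasurableSet I := measurableSet_image_criticalPairs
  have hmain : ∫⁻ y, ∫⁻ ζ, N (y, ζ) ∂μ = ∫⁻ x in D, ∫⁻ ζ, ENNReal.ofReal
      ((1 - κc) ^ 2 - ‖totalShear γ m ζ x‖ ^ 2) ∂μ := by
    rw [lintegral_lintegral_swap (f := fun y ζ => N (y, ζ)) hNm.aemeasurable]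
    simp_rw [hNi]
    rw [lintegral_lintegral_swap]
    have h := (measurable_totalShear (g := g) γ m).comp measurable_swap
    exact (ENNReal.measurable_ofReal.comp ((h.norm.pow_const 2).const_sub _)).aemeasurable
  rw [← hmain]
  apply le_antisymm
  -- Measurability of the number of minima is never needed: it lies between `N` and `N'`, which is
  -- infinite on critical values. Integrating `N'` over the source first, with the stars fixed,
  -- removes the infinite part.
  · set N' : Plane × (Fin g → Plane) → ℝ≥0∞ := fun p => N p + I.indicator (fun _ => ⊤) p with hN'
    have hN'm : Measurable N' := hNm.add (measurable_const.indicator hIm)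
    calc ∫⁻ y, expectedMinima P κc γ m ξ D y ≤ ∫⁻ y, ∫⁻ ζ, N' (y, ζ) ∂μ := by
          refine lintegral_mono fun y => ?_
          rw [lintegral_map' (f := fun ζ => N' (y, ζ)) (hN'm.comp (by fun_prop)).aemeasurable hξ]
          refine lintegral_mono fun ω => ?_
          simp only [hN', hN]
          by_cases hmem : (y, X ω) ∈ I
          · simp [hmem]
          · rw [Set.indicator_of_notMem hmem, add_zero]
            refine ENat.toENNReal_le.2 (Set.encard_le_encard ?_)
            refine (minImages_subset D (X ω) y).trans (Set.union_subset subset_rfl fun x hx => ?_)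
            exact absurd ⟨(x, X ω), hx.1, by simp [lensPair, hx.2]⟩ hmem
      _ = ∫⁻ ζ, (∫⁻ y, N' (y, ζ)) ∂μ := lintegral_lintegral_swap (f := fun y ζ => N' (y, ζ)) hN'm.aemeasurable
      _ = ∫⁻ ζ, (∫⁻ y, N (y, ζ)) ∂μ := by
          refine lintegral_congr (μ := μ) fun ζ => ?_
          refine lintegral_congr_ae ?_
          filter_upwards [measure_eq_zero_iff_ae_notMem.1
            (volume_section_image_criticalPairs (κc := κc) (γ := γ) (m := m) ζ)] with y hy
          simp only [hN']
          rw [Set.indicator_of_notMem (show (y, ζ) ∉ I from hy), add_zero]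
      _ = ∫⁻ y, ∫⁻ ζ, N (y, ζ) ∂μ := (lintegral_lintegral_swap (f := fun y ζ => N (y, ζ)) hNm.aemeasurable).symm
  · refine lintegral_mono fun y => ?_
    rw [lintegral_map' (f := fun ζ => N (y, ζ)) (hNm.comp (by fun_prop)).aemeasurable hξ]
    refine lintegral_mono fun ω => ?_
    simp only [hN]
    exact ENat.toENNReal_le.2 (Set.encard_le_encard (subset_minImages hκ1 D (X ω) y))

lemma globalExpectedMinima_eq {Ω : Type*} [MeasurableSpace Ω] (P : Measure Ω)
    (ξ : Fin g → Ω → Plane) (D : Set Plane) {ι : Type*} [Countable ι] {S : ι → Set Plane} {A : ℝ}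
    (hS : IsSourceCover S A) :
    globalExpectedMinima P κc γ m ξ D S =
      (ENNReal.ofReal A)⁻¹ * ∫⁻ y, expectedMinima P κc γ m ξ D y := by
  unfold globalExpectedMinima ProbabilityTheory.cond
  simp_rw [lintegral_smul_measure, hS.area_eq, smul_eq_mul]
  rw [ENNReal.tsum_mul_left, ← lintegral_iUnion₀
    (fun i => (hS.isCompact i).measurableSet.nullMeasurableSet) hS.aedisjoint, hS.iUnion_eq,
    Measure.restrict_univ]

end

/-! ### Oscillatory tail integrals -/

open Set in
lemma integrableOn_Ioi_inv_sq {U : ℝ} (hU : 0 < U) : IntegrableOn (fun u : ℝ => (u ^ 2)⁻¹) (Ioi U) := by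
  refine (integrableOn_Ioi_rpow_of_lt (a := -2) (by norm_num) hU).congr_fun (fun u hu => ?_)
    measurableSet_Ioi
  simp only
  rw [Real.rpow_neg (hU.le.trans (le_of_lt hu))]
  norm_num

open Set in
lemma integral_Ioi_inv_sq {U : ℝ} (hU : 0 < U) : ∫ u in Ioi U, (u ^ 2)⁻¹ = U⁻¹ := by
  rw [← setIntegral_congr_fun (f := fun u : ℝ => u ^ (-2 : ℝ)) measurableSet_Ioi fun u hu => ?_,
    integral_Ioi_rpow_of_lt (by norm_num) hU]
  · norm_num
    rw [Real.rpow_neg_one]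
  · simp only
    rw [Real.rpow_neg (hU.le.trans (le_of_lt hu))]
    norm_num

open Set in
lemma integral_Ioi_mul_exp_neg {u : ℝ} (hu : 0 < u) :
    ∫ s in Ioi (0 : ℝ), s * Real.exp (-(u * s)) = (u ^ 2)⁻¹ := by
  have := Real.integral_rpow_mul_exp_neg_mul_Ioi (a := 2) (by norm_num) hu
  norm_num at this
  exact this

open Set in
lemma integral_Ioi_one_sub_cos_mul_exp_neg {s : ℝ} (hs : 0 < s) :
    IntegrableOn (fun u => (1 - Real.cos u) * Real.exp (-(u * s))) (Ioi 0) ∧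
    ∫ u in Ioi (0 : ℝ), (1 - Real.cos u) * Real.exp (-(u * s)) = s⁻¹ - s / (s ^ 2 + 1) := by
  have h1 : ∀ c : ℂ, c.re < 0 → IntegrableOn (fun u : ℝ => (Complex.exp (c * u)).re) (Ioi 0) ∧
      ∫ u in Ioi (0 : ℝ), (Complex.exp (c * u)).re = (-1 / c).re := by
    intro c hc
    have h := integrableOn_exp_mul_complex_Ioi hc 0
    have h2 := integral_exp_mul_complex_Ioi hc 0
    refine ⟨h.re, ?_⟩
    have := integral_re h
    simp only [RCLike.re_eq_complex_re] at this
    rw [this, h2]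
    simp
  obtain ⟨i1, e1⟩ := h1 (-s) (by simpa using hs)
  obtain ⟨i2, e2⟩ := h1 (-s + Complex.I) (by simpa using hs)
  have hre : ∀ u : ℝ, (1 - Real.cos u) * Real.exp (-(u * s)) =
      (Complex.exp (-s * u)).re - (Complex.exp ((-s + Complex.I) * u)).re := by
    intro u
    simp [Complex.exp_re]
    ring_nf
  simp_rw [hre]
  refine ⟨i1.sub i2, ?_⟩
  rw [integral_sub i1 i2, e1, e2]
  simp [Complex.div_re, Complex.normSq_apply]
  field_simp

open Set in
-- Write `u⁻²` as the Laplace transform of `s` and exchange the integrals, all terms being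
-- nonnegative; the inner integral becomes `1 / (1 + s²)`.
lemma integral_Ioi_one_sub_cos_div_sq :
    ∫ u in Ioi (0 : ℝ), (u ^ 2)⁻¹ * (1 - Real.cos u) = Real.pi / 2 := by
  have hnn : ∀ u : ℝ, 0 ≤ 1 - Real.cos u := fun u => by linarith [Real.cos_le_one u]
  rw [integral_eq_lintegral_of_nonneg_ae (ae_of_all _ fun u => mul_nonneg (by positivity) (hnn u))
    (by fun_prop)]
  have h1 : ∫⁻ u in Ioi (0 : ℝ), ENNReal.ofReal ((u ^ 2)⁻¹ * (1 - Real.cos u)) =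
      ∫⁻ u in Ioi (0 : ℝ), ∫⁻ s in Ioi (0 : ℝ),
        ENNReal.ofReal (s * Real.exp (-(u * s)) * (1 - Real.cos u)) := by
    refine setLIntegral_congr_fun measurableSet_Ioi fun u hu => ?_
    have hint : IntegrableOn (fun s => s * Real.exp (-(u * s))) (Ioi 0) := by
      by_contra h
      have := integral_Ioi_mul_exp_neg (mem_Ioi.1 hu)
      rw [integral_undef h] at this
      have h0 : (0 : ℝ) < (u ^ 2)⁻¹ := by have : (0:ℝ) < u := hu; positivity
      linarith
    rw [← ofReal_integral_eq_lintegral_ofReal (hint.mul_const _), integral_mul_const,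
      integral_Ioi_mul_exp_neg hu]
    filter_upwards [ae_restrict_mem measurableSet_Ioi] with s hs
    have : (0:ℝ) < s := hs
    exact mul_nonneg (by positivity) (hnn u)
  have h2 : ∫⁻ u in Ioi (0 : ℝ), ∫⁻ s in Ioi (0 : ℝ),
        ENNReal.ofReal (s * Real.exp (-(u * s)) * (1 - Real.cos u)) =
      ∫⁻ s in Ioi (0 : ℝ), ENNReal.ofReal (1 + s ^ 2)⁻¹ := by
    rw [lintegral_lintegral_swap (by fun_prop)]
    refine setLIntegral_congr_fun measurableSet_Ioi fun s hs => ?_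
    have hs0 : (0 : ℝ) < s := hs
    obtain ⟨i1, e1⟩ := integral_Ioi_one_sub_cos_mul_exp_neg hs0
    have he : ∀ u, s * Real.exp (-(u * s)) * (1 - Real.cos u) =
        s * ((1 - Real.cos u) * Real.exp (-(u * s))) := fun u => by ring
    simp_rw [he]
    rw [← ofReal_integral_eq_lintegral_ofReal (i1.const_mul _), integral_const_mul, e1]
    · congr 1
      field_simp
      ring
    · exact ae_of_all _ fun u => mul_nonneg hs0.le (mul_nonneg (hnn u) (Real.exp_pos _).le)
  rw [h1, h2, ← ofReal_integral_eq_lintegral_ofReal (integrable_inv_one_add_sq.integrableOn)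
    (ae_of_all _ fun s => by positivity), integral_Ioi_inv_one_add_sq]
  rw [ENNReal.toReal_ofReal] <;> simp
  positivity

open Set in
lemma integral_Ioi_one_sub_cos_mul_div_sq (a : ℝ) :
    ∫ u in Ioi (0 : ℝ), (u ^ 2)⁻¹ * (1 - Real.cos (a * u)) = Real.pi / 2 * |a| := by
  rcases eq_or_ne a 0 with rfl | ha
  · simp
  have h := integral_comp_mul_left_Ioi (fun u => (u ^ 2)⁻¹ * (1 - Real.cos u)) 0 (abs_pos.2 ha)
  rw [mul_zero, integral_Ioi_one_sub_cos_div_sq] at h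
  have h2 : ∀ u : ℝ, ((|a| * u) ^ 2)⁻¹ * (1 - Real.cos (|a| * u)) =
      (|a| ^ 2)⁻¹ * ((u ^ 2)⁻¹ * (1 - Real.cos (a * u))) := by
    intro u
    have : Real.cos (|a| * u) = Real.cos (a * u) := by
      rcases abs_choice a with h | h <;> rw [h]
      rw [neg_mul, Real.cos_neg]
    rw [this, mul_pow, mul_inv]
    ring
  simp_rw [h2] at h
  rw [integral_const_mul] at h
  have := abs_pos.2 ha
  field_simp at h
  simp only [smul_eq_mul] at h
  field_simp at h
  field_simp
  linarith

/-- For `|y| ≤ 1` the constant bounds `e`; for `|y| > 1` every term is at most `|y|⁴`, and `1 + 1 +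
1 + 1/2 + 1/6 < 4`. -/
lemma norm_exp_I_sub_taylor_le (y : ℝ) :
    ‖Complex.exp (y * Complex.I) - (1 + y * Complex.I - y ^ 2 / 2 - Complex.I * y ^ 3 / 6)‖
      ≤ 4 * y ^ 4 := by
  have hy4 : y ^ 4 = |y| ^ 4 := by rw [← abs_pow, abs_of_nonneg (by positivity)]
  rcases le_or_gt |y| 1 with h | h
  · have h1 := Complex.norm_exp_sub_sum_le_norm_mul_exp (y * Complex.I) 4
    have h2 : ‖(y * Complex.I : ℂ)‖ = |y| := by simp
    rw [h2] at h1
    have h3 : ∑ n ∈ Finset.range 4, (y * Complex.I : ℂ) ^ n / (n.factorial : ℂ) =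
        1 + y * Complex.I - y ^ 2 / 2 - Complex.I * y ^ 3 / 6 := by
      simp [Finset.sum_range_succ, Nat.factorial, mul_pow, Complex.I_sq, Complex.I_pow_three]
      ring
    rw [h3] at h1
    refine h1.trans ?_
    have h4 : Real.exp |y| ≤ 4 := by
      have := Real.exp_le_exp.2 h
      have := Real.exp_one_lt_d9
      linarith
    rw [hy4]
    nlinarith [pow_nonneg (abs_nonneg y) 4]
  · have h1 : ‖Complex.exp (y * Complex.I)‖ = 1 := Complex.norm_exp_ofReal_mul_I y
    have h2 : ‖(1 + y * Complex.I - y ^ 2 / 2 - Complex.I * y ^ 3 / 6 : ℂ)‖ ≤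
        1 + |y| + |y| ^ 2 / 2 + |y| ^ 3 / 6 := by
      refine (norm_sub_le _ _).trans (add_le_add ((norm_sub_le _ _).trans (add_le_add
        ((norm_add_le _ _).trans ?_) ?_)) ?_) <;> simp
    refine (norm_sub_le _ _).trans ?_
    rw [h1, hy4]
    have h3 : 1 ≤ |y| ^ 4 := one_le_pow₀ h.le
    have h4 : |y| ≤ |y| ^ 4 := le_self_pow₀ h.le (by norm_num)
    have h5 : |y| ^ 2 ≤ |y| ^ 4 := pow_le_pow_right₀ h.le (by norm_num)
    have h6 : |y| ^ 3 ≤ |y| ^ 4 := pow_le_pow_right₀ h.le (by norm_num)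
    linarith

/-- The tail integral of `(1 - exp (i a u)) / u²`. -/
def oscTail (a U : ℝ) : ℂ :=
  ∫ u in Set.Ioi U, (((u ^ 2)⁻¹ : ℝ) : ℂ) * (1 - Complex.exp ((a * u : ℝ) * Complex.I))

lemma norm_one_sub_exp_I_le (y : ℝ) : ‖1 - Complex.exp (y * Complex.I)‖ ≤ 2 :=
  (norm_sub_le _ _).trans (by rw [Complex.norm_exp_ofReal_mul_I, norm_one]; norm_num)

lemma integrableOn_oscTail (a : ℝ) {U : ℝ} (hU : 0 < U) :
    IntegrableOn (fun u : ℝ => (((u ^ 2)⁻¹ : ℝ) : ℂ) *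
      (1 - Complex.exp ((a * u : ℝ) * Complex.I))) (Set.Ioi U) := by
  refine Integrable.mono' ((integrableOn_Ioi_inv_sq hU).mul_const 2) (by fun_prop)
    (ae_of_all _ fun u => ?_)
  rw [norm_mul, Complex.norm_real, Real.norm_of_nonneg (by positivity)]
  exact mul_le_mul_of_nonneg_left (norm_one_sub_exp_I_le _) (by positivity)

lemma intervalIntegrable_osc (a : ℝ) {U V : ℝ} (hU : 0 < U) (hV : 0 < V) :
    IntervalIntegrable (fun u : ℝ => (((u ^ 2)⁻¹ : ℝ) : ℂ) *
      (1 - Complex.exp ((a * u : ℝ) * Complex.I))) volume U V := by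
  rw [intervalIntegrable_iff]
  exact (integrableOn_oscTail a (lt_min hU hV)).mono_set fun u hu => hu.1

/-- Only the interval between `U` and `V` matters, where the integrand is `-ia/u + a²/2 + ia³u/6` up
to `4a⁴u²`. The first term gives the logarithms, which cancel later between opposite rays. -/
lemma norm_oscTail_sub_le (a : ℝ) {U V : ℝ} (hU : 0 < U) (hV : 0 < V) :
    ‖oscTail a U - oscTail a V - (-(Complex.I * a * (Real.log V - Real.log U)) +
      a ^ 2 / 2 * (V - U) + Complex.I * a ^ 3 / 12 * (V ^ 2 - U ^ 2))‖ ≤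
      4 * a ^ 4 * max U V ^ 2 * |V - U| := by
  have h1 : oscTail a U - oscTail a V = ∫ u in U..V, (((u ^ 2)⁻¹ : ℝ) : ℂ) *
      (1 - Complex.exp ((a * u : ℝ) * Complex.I)) :=
    intervalIntegral.integral_Ioi_sub_Ioi' (integrableOn_oscTail a hU) (integrableOn_oscTail a hV)
  have hpos : ∀ u ∈ Set.uIcc U V, 0 < u := fun u hu => (lt_min hU hV).trans_le hu.1
  have hcont : ContinuousOn (fun u : ℝ => (-(Complex.I * a * ((u⁻¹ : ℝ) : ℂ)) + a ^ 2 / 2 +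
      Complex.I * a ^ 3 / 6 * u : ℂ)) (Set.uIcc U V) := by
    have : ContinuousOn (fun u : ℝ => ((u⁻¹ : ℝ) : ℂ)) (Set.uIcc U V) :=
      Complex.continuous_ofReal.comp_continuousOn
        (continuousOn_inv₀.mono fun u hu => (hpos u hu).ne')
    fun_prop
  have h2 : ∫ u in U..V, (-(Complex.I * a * ((u⁻¹ : ℝ) : ℂ)) + a ^ 2 / 2 +
      Complex.I * a ^ 3 / 6 * u : ℂ) = -(Complex.I * a * (Real.log V - Real.log U)) +
      a ^ 2 / 2 * (V - U) + Complex.I * a ^ 3 / 12 * (V ^ 2 - U ^ 2) := by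
    rw [intervalIntegral.integral_eq_sub_of_hasDerivAt (f := fun u : ℝ =>
      (-(Complex.I * a * Real.log u) + a ^ 2 / 2 * u + Complex.I * a ^ 3 / 12 * u ^ 2 : ℂ))
      (fun u hu => ?_) hcont.intervalIntegrable]
    · ring
    · have e1 := (Real.hasDerivAt_log (hpos u hu).ne').ofReal_comp
      have e2 : HasDerivAt (fun u : ℝ => (u : ℂ)) 1 u := Complex.ofRealCLM.hasDerivAt
      refine (((e1.const_mul (Complex.I * a)).neg.add (e2.const_mul (a ^ 2 / 2 : ℂ))).add
        ((e2.pow 2).const_mul (Complex.I * a ^ 3 / 12))).congr_deriv ?_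
      simp only [Nat.cast_ofNat, Nat.add_one_sub_one, pow_one]
      ring
  rw [h1, ← h2, ← intervalIntegral.integral_sub (intervalIntegrable_osc a hU hV)
    hcont.intervalIntegrable]
  refine intervalIntegral.norm_integral_le_of_norm_le_const fun u hu => ?_
  have hu' := Set.uIoc_subset_uIcc hu
  have hu0 := hpos u hu'
  have hueq : ((((u ^ 2)⁻¹ : ℝ) : ℂ) * (1 - Complex.exp ((a * u : ℝ) * Complex.I)) -
      (-(Complex.I * a * ((u⁻¹ : ℝ) : ℂ)) + a ^ 2 / 2 + Complex.I * a ^ 3 / 6 * u : ℂ)) =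
      -((((u ^ 2)⁻¹ : ℝ) : ℂ) * (Complex.exp ((a * u : ℝ) * Complex.I) -
        (1 + (a * u : ℝ) * Complex.I - (a * u : ℝ) ^ 2 / 2 - Complex.I * (a * u : ℝ) ^ 3 / 6))) := by
    have : (u : ℂ) ≠ 0 := by exact_mod_cast hu0.ne'
    push_cast
    field_simp
    ring
  rw [hueq, norm_neg, norm_mul, Complex.norm_real, Real.norm_of_nonneg (by positivity)]
  calc (u ^ 2)⁻¹ * _ ≤ (u ^ 2)⁻¹ * (4 * (a * u) ^ 4) :=
        mul_le_mul_of_nonneg_left (norm_exp_I_sub_taylor_le (a * u)) (by positivity)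
    _ = 4 * a ^ 4 * u ^ 2 := by field_simp
    _ ≤ 4 * a ^ 4 * max U V ^ 2 := by gcongr; exact hu'.2

open Set in
lemma integrableOn_one_sub_cos (a : ℝ) :
    IntegrableOn (fun u : ℝ => (u ^ 2)⁻¹ * (1 - Real.cos (a * u))) (Ioi 0) := by
  rw [← Ioc_union_Ioi_eq_Ioi zero_le_one]
  refine IntegrableOn.union ?_ ?_
  · refine Measure.integrableOn_of_bounded (M := a ^ 2 / 2) (by simp) (by fun_prop) ?_
    filter_upwards [ae_restrict_mem measurableSet_Ioc] with u hu
    rw [Real.norm_of_nonneg (mul_nonneg (by positivity) (by linarith [Real.cos_le_one (a * u)]))]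
    have := Real.one_sub_sq_div_two_le_cos (x := a * u)
    have hu0 := hu.1
    rw [inv_mul_le_iff₀ (by positivity)]
    nlinarith
  · refine Integrable.mono' ((integrableOn_Ioi_inv_sq one_pos).mul_const 2) (by fun_prop)
      (ae_of_all _ fun u => ?_)
    rw [Real.norm_of_nonneg (mul_nonneg (by positivity) (by linarith [Real.cos_le_one (a * u)]))]
    exact mul_le_mul_of_nonneg_left (by linarith [Real.neg_one_le_cos (a * u)]) (by positivity)

open Set in
-- The sum over both signs is twice the tail of `(1 - cos (a u)) / u²`, which is integrable at `0`:
-- the tail is the full integral minus the part on `(0, U]`, where `1 - cos (a u)` is close to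
-- `a²u²/2`.
lemma norm_oscTail_add_oscTail_neg_sub_le (a : ℝ) {U : ℝ} (hU : 0 < U) :
    ‖oscTail a U + oscTail (-a) U - (Real.pi * |a| - a ^ 2 * U : ℝ)‖ ≤ 8 * a ^ 4 * U ^ 3 := by
  have h1 : oscTail a U + oscTail (-a) U =
      ((2 * ∫ u in Ioi U, (u ^ 2)⁻¹ * (1 - Real.cos (a * u)) : ℝ) : ℂ) := by
    rw [oscTail, oscTail, ← integral_add (integrableOn_oscTail a hU) (integrableOn_oscTail (-a) hU),
      ← integral_const_mul, ← integral_complex_ofReal]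
    refine integral_congr_ae (ae_of_all _ fun u => ?_)
    simp only
    push_cast
    rw [Complex.cos]
    ring_nf
  have h2 : ∫ u in Ioi U, (u ^ 2)⁻¹ * (1 - Real.cos (a * u)) =
      Real.pi / 2 * |a| - ∫ u in (0 : ℝ)..U, (u ^ 2)⁻¹ * (1 - Real.cos (a * u)) := by
    rw [← integral_Ioi_one_sub_cos_mul_div_sq,
      ← intervalIntegral.integral_Ioi_sub_Ioi (integrableOn_one_sub_cos a) hU.le]
    ring
  have hii : IntervalIntegrable (fun u : ℝ => (u ^ 2)⁻¹ * (1 - Real.cos (a * u))) volume 0 U := by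
    rw [intervalIntegrable_iff, uIoc_of_le hU.le]
    exact (integrableOn_one_sub_cos a).mono_set Ioc_subset_Ioi_self
  have h3 : |(∫ u in (0 : ℝ)..U, (u ^ 2)⁻¹ * (1 - Real.cos (a * u))) - a ^ 2 / 2 * U| ≤
      4 * a ^ 4 * U ^ 2 * |U - 0| := by
    have e : a ^ 2 / 2 * U = ∫ u in (0 : ℝ)..U, a ^ 2 / 2 := by simp; ring
    rw [e, ← intervalIntegral.integral_sub hii (by simp), ← Real.norm_eq_abs]
    refine intervalIntegral.norm_integral_le_of_norm_le_const fun u hu => ?_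
    rw [uIoc_of_le hU.le] at hu
    have hu0 := hu.1
    have h4 := norm_exp_I_sub_taylor_le (a * u)
    have h5 := (Complex.abs_re_le_norm _).trans h4
    have h6 : (Complex.exp ((a * u : ℝ) * Complex.I) - (1 + (a * u : ℝ) * Complex.I -
        (a * u : ℝ) ^ 2 / 2 - Complex.I * (a * u : ℝ) ^ 3 / 6)).re =
        Real.cos (a * u) - 1 + (a * u) ^ 2 / 2 := by
      have e1 : (((a * u : ℝ) : ℂ) ^ 2 / 2).re = (a * u) ^ 2 / 2 := by
        rw [← Complex.ofReal_pow, Complex.div_ofNat_re, Complex.ofReal_re]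
      have e2 : (Complex.I * ((a * u : ℝ) : ℂ) ^ 3 / 6).re = 0 := by
        rw [← Complex.ofReal_pow, Complex.div_ofNat_re, Complex.re_mul_ofReal, Complex.I_re]
        simp
      rw [Complex.sub_re, Complex.sub_re, Complex.sub_re, Complex.add_re, e1, e2,
        Complex.exp_ofReal_mul_I_re]
      simp
      ring
    rw [h6] at h5
    have h7 : (u ^ 2)⁻¹ * (1 - Real.cos (a * u)) - a ^ 2 / 2 =
        -((u ^ 2)⁻¹ * (Real.cos (a * u) - 1 + (a * u) ^ 2 / 2)) := by
      field_simp; ring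
    rw [h7, norm_neg, norm_mul, Real.norm_of_nonneg (by positivity)]
    calc (u ^ 2)⁻¹ * _ ≤ (u ^ 2)⁻¹ * (4 * (a * u) ^ 4) :=
          mul_le_mul_of_nonneg_left h5 (by positivity)
      _ = 4 * a ^ 4 * u ^ 2 := by field_simp
      _ ≤ 4 * a ^ 4 * U ^ 2 := by gcongr; exact hu.2
  rw [h1, h2, ← Complex.ofReal_sub, Complex.norm_real, Real.norm_eq_abs]
  rw [sub_zero, abs_of_pos hU] at h3
  have h8 : 2 * (Real.pi / 2 * |a| - ∫ u in (0 : ℝ)..U, (u ^ 2)⁻¹ * (1 - Real.cos (a * u))) -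
      (Real.pi * |a| - a ^ 2 * U) =
      -(2 * ((∫ u in (0 : ℝ)..U, (u ^ 2)⁻¹ * (1 - Real.cos (a * u))) - a ^ 2 / 2 * U)) := by ring
  rw [h8, abs_neg, abs_mul, abs_two]
  nlinarith

/-- Cancellation bound for the tail of an oscillating integral, by a shift of half a period. -/
lemma norm_integral_exp_div_sq_le (a : ℝ) {U : ℝ} (hU : 0 < U) :
    ‖∫ u in Set.Ioi U, (((u ^ 2)⁻¹ : ℝ) : ℂ) * Complex.exp ((a * u : ℝ) * Complex.I)‖ ≤
      Real.pi / (U * (|a| * U + Real.pi)) := by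
  have hint : ∀ {V : ℝ}, 0 < V → IntegrableOn (fun u : ℝ => (((u ^ 2)⁻¹ : ℝ) : ℂ) *
      Complex.exp ((a * u : ℝ) * Complex.I)) (Set.Ioi V) := fun hV => by
    refine Integrable.mono' (integrableOn_Ioi_inv_sq hV) (by fun_prop) (ae_of_all _ fun u => ?_)
    rw [norm_mul, Complex.norm_real, Real.norm_of_nonneg (by positivity),
      Complex.norm_exp_ofReal_mul_I, mul_one]
  rcases eq_or_ne a 0 with rfl | ha
  · have : ∫ u in Set.Ioi U, (((u ^ 2)⁻¹ : ℝ) : ℂ) = ((U⁻¹ : ℝ) : ℂ) := by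
      rw [← integral_Ioi_inv_sq hU]; exact integral_complex_ofReal
    simp only [zero_mul, Complex.ofReal_zero, Complex.exp_zero, mul_one, this]
    rw [Complex.norm_real, Real.norm_of_nonneg (by positivity)]
    apply le_of_eq
    simp
    field_simp
  have ha' := abs_pos.2 ha
  set h := Real.pi / |a| with hh
  have hpos : 0 < h := by positivity
  set F : ℝ → ℂ := fun u => Complex.exp ((a * u : ℝ) * Complex.I) with hF
  have hFs : ∀ u, F (u - h) = -F u := by
    intro u
    simp only [hF]
    rcases lt_or_gt_of_ne ha with hn | hp
    · have : ((a * (u - h) : ℝ) : ℂ) * Complex.I = (a * u : ℝ) * Complex.I + Real.pi * Complex.I := by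
        rw [hh, abs_of_neg hn]
        have : (a : ℂ) ≠ 0 := by exact_mod_cast ha
        push_cast
        field_simp
        ring
      rw [this, Complex.exp_add, Complex.exp_pi_mul_I]; ring
    · have : ((a * (u - h) : ℝ) : ℂ) * Complex.I = (a * u : ℝ) * Complex.I - Real.pi * Complex.I := by
        rw [hh, abs_of_pos hp]
        have : (a : ℂ) ≠ 0 := by exact_mod_cast ha
        push_cast
        field_simp
      rw [this, Complex.exp_sub, Complex.exp_pi_mul_I]; ring
  have hFn : ∀ u, ‖F u‖ = 1 := fun u => Complex.norm_exp_ofReal_mul_I _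
  set J := ∫ u in Set.Ioi U, (((u ^ 2)⁻¹ : ℝ) : ℂ) * F u with hJ
  have hUh : 0 < U + h := by positivity
  have hshift : J = -∫ u in Set.Ioi (U + h), ((((u - h) ^ 2)⁻¹ : ℝ) : ℂ) * F u := by
    have e := (measurePreserving_sub_right volume h).setIntegral_preimage_emb
      (measurableEmbedding_subRight h) (fun u => (((u ^ 2)⁻¹ : ℝ) : ℂ) * F u) (Set.Ioi U)
    rw [hJ, ← e, ← integral_neg, Set.preimage_sub_const_Ioi]
    simp only [hFs, mul_neg]
  have hsplit : J = (∫ u in U..(U + h), (((u ^ 2)⁻¹ : ℝ) : ℂ) * F u) +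
      ∫ u in Set.Ioi (U + h), (((u ^ 2)⁻¹ : ℝ) : ℂ) * F u :=
    (intervalIntegral.integral_interval_add_Ioi (hint hU) (hint hUh)).symm
  have hint2 : IntegrableOn (fun u : ℝ => ((u - h) ^ 2)⁻¹) (Set.Ioi (U + h)) := by
    have := (measurePreserving_sub_right volume h).integrableOn_comp_preimage
      (measurableEmbedding_subRight h) (f := fun u : ℝ => (u ^ 2)⁻¹) (s := Set.Ioi U)
    rw [Set.preimage_sub_const_Ioi] at this
    exact this.2 (integrableOn_Ioi_inv_sq hU)
  have hval2 : ∫ u in Set.Ioi (U + h), ((u - h) ^ 2)⁻¹ = U⁻¹ := by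
    have e := (measurePreserving_sub_right volume h).setIntegral_preimage_emb
      (measurableEmbedding_subRight h) (fun u : ℝ => (u ^ 2)⁻¹) (Set.Ioi U)
    rw [Set.preimage_sub_const_Ioi, integral_Ioi_inv_sq hU] at e
    exact e
  have hint3 : IntegrableOn (fun u : ℝ => ((((u - h) ^ 2)⁻¹ : ℝ) : ℂ) * F u) (Set.Ioi (U + h)) := by
    refine Integrable.mono' hint2 (by fun_prop) (ae_of_all _ fun u => ?_)
    rw [norm_mul, Complex.norm_real, Real.norm_of_nonneg (by positivity), hFn, mul_one]
  have h2J : J + J = (∫ u in U..(U + h), (((u ^ 2)⁻¹ : ℝ) : ℂ) * F u) +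
      ∫ u in Set.Ioi (U + h), (((u ^ 2)⁻¹ : ℝ) : ℂ) * F u - ((((u - h) ^ 2)⁻¹ : ℝ) : ℂ) * F u := by
    rw [integral_sub (hint hUh) hint3]
    nth_rewrite 1 [hsplit]
    rw [hshift]
    ring
  have b1 : ‖∫ u in U..(U + h), (((u ^ 2)⁻¹ : ℝ) : ℂ) * F u‖ ≤ U⁻¹ - (U + h)⁻¹ := by
    rw [← integral_Ioi_inv_sq hU, ← integral_Ioi_inv_sq hUh,
      intervalIntegral.integral_Ioi_sub_Ioi (integrableOn_Ioi_inv_sq hU) (by linarith)]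
    refine intervalIntegral.norm_integral_le_of_norm_le (by linarith) (ae_of_all _ fun u _ => ?_) ?_
    · rw [norm_mul, Complex.norm_real, Real.norm_of_nonneg (by positivity), hFn, mul_one]
    · rw [intervalIntegrable_iff, Set.uIoc_of_le (by linarith)]
      exact (integrableOn_Ioi_inv_sq hU).mono_set fun u hu => hu.1
  -- The weight is decreasing, so the difference of the two weights has a constant sign and the
  -- bound by absolute values integrates exactly.
  have b2 : ‖∫ u in Set.Ioi (U + h), (((u ^ 2)⁻¹ : ℝ) : ℂ) * F u -
      ((((u - h) ^ 2)⁻¹ : ℝ) : ℂ) * F u‖ ≤ U⁻¹ - (U + h)⁻¹ := by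
    rw [← hval2, ← integral_Ioi_inv_sq hUh, ← integral_sub hint2 (integrableOn_Ioi_inv_sq hUh)]
    refine norm_integral_le_of_norm_le (hint2.sub (integrableOn_Ioi_inv_sq hUh)) ?_
    filter_upwards [ae_restrict_mem measurableSet_Ioi] with u hu
    have hu1 : 0 < u - h := by have : U + h < u := hu; linarith
    rw [← sub_mul, norm_mul, hFn, mul_one, ← Complex.ofReal_sub, Complex.norm_real, norm_sub_rev,
      Real.norm_of_nonneg]
    rw [sub_nonneg]
    exact inv_anti₀ (by positivity) (by gcongr; linarith)
  have hfin : ‖J + J‖ ≤ 2 * (U⁻¹ - (U + h)⁻¹) := by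
    rw [h2J]; exact (norm_add_le _ _).trans (by linarith)
  have : ‖J + J‖ = 2 * ‖J‖ := by rw [← two_mul, norm_mul]; norm_num
  have hJ' : ‖J‖ ≤ U⁻¹ - (U + h)⁻¹ := by linarith
  refine hJ'.trans (le_of_eq ?_)
  rw [hh]
  field_simp
  ring

/-! ### Polar coordinates in the plane -/

/-- Unit vector in the direction `θ`. -/
def dirVec (θ : ℝ) : Plane := !₂[Real.cos θ, Real.sin θ]

@[simp] lemma dirVec_zero (θ : ℝ) : dirVec θ 0 = Real.cos θ := rfl
@[simp] lemma dirVec_one (θ : ℝ) : dirVec θ 1 = Real.sin θ := rfl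

lemma norm_sq_dirVec (θ : ℝ) : ‖dirVec θ‖ ^ 2 = 1 := by
  rw [Plane.norm_sq]; simp

lemma norm_dirVec (θ : ℝ) : ‖dirVec θ‖ = 1 := by
  have := norm_sq_dirVec θ
  nlinarith [norm_nonneg (dirVec θ)]

lemma dirVec_add_pi (θ : ℝ) : dirVec (θ + Real.pi) = -dirVec θ := by
  apply Plane.ext <;> simp

lemma exists_eq_norm_smul_dirVec (t : Plane) : ∃ α, t = ‖t‖ • dirVec α := by
  refine ⟨Complex.arg ⟨t 0, t 1⟩, ?_⟩
  have hn : ‖(⟨t 0, t 1⟩ : ℂ)‖ = ‖t‖ := by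
    rw [← sq_eq_sq₀ (norm_nonneg _) (norm_nonneg _), Plane.norm_sq, Complex.sq_norm,
      Complex.normSq_mk]
    ring
  apply Plane.ext
  · simpa [hn] using (Complex.norm_mul_cos_arg (⟨t 0, t 1⟩ : ℂ)).symm
  · simpa [hn] using (Complex.norm_mul_sin_arg (⟨t 0, t 1⟩ : ℂ)).symm

@[fun_prop] lemma continuous_dirVec : Continuous dirVec := by
  unfold dirVec
  refine (PiLp.continuous_toLp 2 _).comp (continuous_pi fun i => ?_)
  fin_cases i
  · exact Real.continuous_cos
  · exact Real.continuous_sin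

/-- The plane as a product. -/
def planeEquiv : ℝ × ℝ ≃ᵐ Plane :=
  (MeasurableEquiv.finTwoArrow (α := ℝ)).symm.trans (MeasurableEquiv.toLp 2 (Fin 2 → ℝ))

lemma planeEquiv_apply (p : ℝ × ℝ) : planeEquiv p = !₂[p.1, p.2] := rfl

lemma measurePreserving_planeEquiv : MeasurePreserving planeEquiv :=
  ((volume_preserving_finTwoArrow ℝ).symm).trans (PiLp.volume_preserving_toLp (Fin 2))

lemma planeEquiv_polarCoord_symm (p : ℝ × ℝ) :
    planeEquiv (polarCoord.symm p) = p.1 • dirVec p.2 := by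
  rw [planeEquiv_apply, polarCoord_symm_apply]
  apply Plane.ext <;> simp

lemma integrableOn_polar {f : Plane → ℂ} (hfm : Measurable f) (hf : Integrable f) :
    IntegrableOn (fun p : ℝ × ℝ => (p.1 : ℂ) * f (p.1 • dirVec p.2)) polarCoord.target := by
  refine ⟨?_, ?_⟩
  · refine (Measurable.mul (by fun_prop) (hfm.comp ?_)).aestronglyMeasurable
    exact (Continuous.smul continuous_fst (continuous_dirVec.comp continuous_snd)).measurable
  · have h1 := lintegral_comp_polarCoord_symm fun p => ‖f (planeEquiv p)‖ₑ
    have h2 := (measurePreserving_planeEquiv.integrable_comp_emb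
      planeEquiv.measurableEmbedding (g := f)).2 hf
    rw [hasFiniteIntegral_iff_enorm]
    have h3 : ∫⁻ p in polarCoord.target, ‖(p.1 : ℂ) * f (p.1 • dirVec p.2)‖ₑ =
        ∫⁻ p, ‖f (planeEquiv p)‖ₑ := by
      rw [← h1]
      refine setLIntegral_congr_fun polarCoord.open_target.measurableSet fun p hp => ?_
      simp only [planeEquiv_polarCoord_symm, smul_eq_mul]
      rw [enorm_mul, ← ofReal_norm (p.1 : ℂ), Complex.norm_real,
        Real.norm_of_nonneg (le_of_lt (show (0 : ℝ) < p.1 from hp.1))]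
    rw [h3]
    exact h2.2

open Set in
lemma integral_eq_polar {f : Plane → ℂ} (hfm : Measurable f) (hf : Integrable f) :
    IntegrableOn (fun θ => ∫ r in Ioi (0 : ℝ), (r : ℂ) * f (r • dirVec θ))
      (Ioo (-Real.pi) Real.pi) ∧
    ∫ p, f p = ∫ θ in Ioo (-Real.pi) Real.pi, ∫ r in Ioi (0 : ℝ), (r : ℂ) * f (r • dirVec θ) := by
  have hi := integrableOn_polar hfm hf
  rw [polarCoord_target] at hi
  have h1 : ∫ p, f p = ∫ p in Ioi (0 : ℝ) ×ˢ Ioo (-Real.pi) Real.pi,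
      (p.1 : ℂ) * f (p.1 • dirVec p.2) := by
    rw [← measurePreserving_planeEquiv.integral_comp planeEquiv.measurableEmbedding,
      ← integral_comp_polarCoord_symm, polarCoord_target]
    simp only [planeEquiv_polarCoord_symm, Complex.real_smul]
  unfold IntegrableOn at hi ⊢
  rw [Measure.volume_eq_prod, ← Measure.prod_restrict] at hi h1
  refine ⟨hi.integral_prod_right, ?_⟩
  rw [h1, integral_prod_symm _ hi]

open Set in
-- The substitution `u = r⁻²`, suited to a shear of magnitude `r⁻²`.
lemma integral_Ioi_mul_eq_inv_sq (F : ℝ → ℂ) :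
    ∫ r in Ioi (0 : ℝ), (r : ℂ) * F r =
      1 / 2 * ∫ u in Ioi (0 : ℝ), (((u ^ 2)⁻¹ : ℝ) : ℂ) * F (Real.sqrt u)⁻¹ := by
  rw [← integral_const_mul, ← integral_comp_rpow_Ioi (fun u : ℝ =>
    (1 / 2 * ((((u ^ 2)⁻¹ : ℝ) : ℂ) * F (Real.sqrt u)⁻¹) : ℂ)) (p := -2) (by norm_num)]
  refine setIntegral_congr_fun measurableSet_Ioi fun r hr => ?_
  have hr0 : (0 : ℝ) < r := hr
  have e1 : r ^ (-2 : ℝ) = (r ^ 2)⁻¹ := by rw [Real.rpow_neg hr0.le]; norm_num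
  have e2 : r ^ (-2 - 1 : ℝ) = (r ^ 3)⁻¹ := by
    rw [show (-2 - 1 : ℝ) = -3 by norm_num, Real.rpow_neg hr0.le]; norm_num
  have e3 : (Real.sqrt ((r ^ 2)⁻¹))⁻¹ = r := by
    rw [Real.sqrt_inv, Real.sqrt_sq hr0.le, inv_inv]
  simp only [e1, e2, e3, Complex.real_smul]
  have : (r : ℂ) ≠ 0 := by exact_mod_cast hr0.ne'
  norm_num
  field_simp

/-! ### Shear of a star seen in polar coordinates -/

/-- Viewed as a complex number, the shear at polar angle `θ` and radius `r` is `r⁻² exp (2iθ)`. -/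
lemma inner_starShear (τ α : ℝ) {u : ℝ} (hu : 0 < u) (θ : ℝ) :
    inner ℝ (τ • dirVec α) (starShear ((Real.sqrt u)⁻¹ • dirVec θ)) =
      τ * Real.cos (2 * θ - α) * u := by
  have hs := Real.sqrt_pos.2 hu
  have hs2 : Real.sqrt u ^ 2 = u := Real.sq_sqrt hu.le
  have hn : ‖(Real.sqrt u)⁻¹ • dirVec θ‖ ^ 4 = (u ^ 2)⁻¹ := by
    rw [norm_smul, norm_dirVec, mul_one, norm_inv, Real.norm_of_nonneg hs.le, inv_pow]
    rw [show Real.sqrt u ^ 4 = (Real.sqrt u ^ 2) ^ 2 by ring, hs2]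
  rw [Plane.inner_eq, starShear, hn, Real.cos_sub, Real.cos_two_mul', Real.sin_two_mul]
  simp
  have : (Real.sqrt u)⁻¹ ^ 2 = u⁻¹ := by rw [inv_pow, hs2]
  have e1 : ((Real.sqrt u)⁻¹ * Real.cos θ) ^ 2 - ((Real.sqrt u)⁻¹ * Real.sin θ) ^ 2 =
    u⁻¹ * (Real.cos θ ^ 2 - Real.sin θ ^ 2) := by rw [mul_pow, mul_pow, this]; ring
  have e2 : 2 * ((Real.sqrt u)⁻¹ * Real.cos θ) * ((Real.sqrt u)⁻¹ * Real.sin θ) =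
    u⁻¹ * (2 * Real.cos θ * Real.sin θ) := by rw [← this]; ring
  rw [e1, e2]
  field_simp

/-- Inverse square of the distance from the origin to the boundary of the disc of radius `R`
about `x`, in the direction `θ`. -/
def exitInvSq (x : Plane) (R θ : ℝ) : ℝ :=
  ((-inner ℝ x (dirVec θ) + Real.sqrt (inner ℝ x (dirVec θ) ^ 2 + (R ^ 2 - ‖x‖ ^ 2))) /
    (R ^ 2 - ‖x‖ ^ 2)) ^ 2


lemma exitInvSq_pos {x : Plane} {R : ℝ} (hx : ‖x‖ ^ 2 < R ^ 2) (θ : ℝ) : 0 < exitInvSq x R θ := by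
  have hV : 0 < R ^ 2 - ‖x‖ ^ 2 := sub_pos.2 hx
  have h : inner ℝ x (dirVec θ) <
      Real.sqrt (inner ℝ x (dirVec θ) ^ 2 + (R ^ 2 - ‖x‖ ^ 2)) :=
    Real.lt_sqrt_of_sq_lt (by linarith)
  exact pow_pos (div_pos (by linarith) hV) 2

lemma mem_closedBall_iff_exitInvSq_le {x : Plane} {R : ℝ} (hR : 0 ≤ R) (hx : ‖x‖ ^ 2 < R ^ 2)
    (θ : ℝ) {u : ℝ} (hu : 0 < u) :
    (Real.sqrt u)⁻¹ • dirVec θ ∈ Metric.closedBall x R ↔ exitInvSq x R θ ≤ u := by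
  have hs := Real.sqrt_pos.2 hu
  have hs2 : Real.sqrt u ^ 2 = u := Real.sq_sqrt hu.le
  set v := Real.sqrt u with hv
  set b := inner ℝ x (dirVec θ) with hb
  set V := R ^ 2 - ‖x‖ ^ 2 with hVdef
  have hV : 0 < V := sub_pos.2 hx
  set w := Real.sqrt (b ^ 2 + V) with hw
  have hw2 : w ^ 2 = b ^ 2 + V := Real.sq_sqrt (by positivity)
  have hw0 : 0 ≤ w := Real.sqrt_nonneg _
  have hbw : |b| < w := by
    rw [hw]; exact Real.lt_sqrt_of_sq_lt (by rw [sq_abs]; linarith)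
  obtain ⟨hb1, hb2⟩ := abs_lt.1 hbw
  rw [mem_closedBall_iff_norm, ← sq_le_sq₀ (norm_nonneg _) hR, norm_sub_sq_real, norm_smul,
    norm_dirVec, inner_smul_left, real_inner_comm, ← hb]
  have hex : exitInvSq x R θ = ((-b + w) / V) ^ 2 := rfl
  rw [hex, ← hs2, sq_le_sq₀ (div_nonneg (by linarith) hV.le) hs.le, div_le_iff₀ hV]
  have hfac : ‖v⁻¹‖ ^ 2 = v⁻¹ ^ 2 := by rw [norm_inv, Real.norm_of_nonneg hs.le]
  rw [mul_one, hfac]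
  -- In `v = r⁻¹` membership reads `V v² + 2 b v - 1 ≥ 0`. This factors over the two roots, of which
  -- one is negative; only the other factor decides the sign.
  have hkey : (v * V - (-b + w)) * (v * V + (b + w)) = V * v ^ 2 *
      (R ^ 2 - (v⁻¹ ^ 2 - 2 * (v⁻¹ * b) + ‖x‖ ^ 2)) := by
    have : R ^ 2 = V + ‖x‖ ^ 2 := by rw [hVdef]; ring
    rw [this]
    field_simp
    linear_combination (-1 : ℝ) * hw2
  have hp : 0 < v * V + (b + w) := by have := mul_pos hs hV; linarith
  have hq : 0 < V * v ^ 2 := by positivity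
  simp only [conj_trivial]
  constructor
  · intro h
    have := mul_nonneg hq.le (sub_nonneg.2 h)
    rw [← hkey] at this
    linarith [nonneg_of_mul_nonneg_left this hp]
  · intro h
    have := mul_nonneg (sub_nonneg.2 h) hp.le
    rw [hkey] at this
    linarith [nonneg_of_mul_nonneg_right this hq]

/-- Power of a point: the two distances from the origin to the circle along a chord multiply to `R²
- ‖x‖²`. -/
lemma exitInvSq_add_pi_mul (x : Plane) {R : ℝ} (hx : ‖x‖ ^ 2 < R ^ 2) (θ : ℝ) :
    exitInvSq x R θ * exitInvSq x R (θ + Real.pi) = ((R ^ 2 - ‖x‖ ^ 2)⁻¹) ^ 2 := by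
  have hV : 0 < R ^ 2 - ‖x‖ ^ 2 := sub_pos.2 hx
  unfold exitInvSq
  rw [dirVec_add_pi, inner_neg_right, ← mul_pow, neg_sq]
  congr 1
  set b := inner ℝ x (dirVec θ)
  have hw2 : Real.sqrt (b ^ 2 + (R ^ 2 - ‖x‖ ^ 2)) ^ 2 = b ^ 2 + (R ^ 2 - ‖x‖ ^ 2) :=
    Real.sq_sqrt (by positivity)
  field_simp
  linear_combination hw2

lemma exitInvSq_add_pi_add (x : Plane) {R : ℝ} (hx : ‖x‖ ^ 2 < R ^ 2) (θ : ℝ) :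
    exitInvSq x R θ + exitInvSq x R (θ + Real.pi) = 2 * (R ^ 2 - ‖x‖ ^ 2)⁻¹ +
      4 * inner ℝ x (dirVec θ) ^ 2 * ((R ^ 2 - ‖x‖ ^ 2)⁻¹) ^ 2 := by
  have hV : 0 < R ^ 2 - ‖x‖ ^ 2 := sub_pos.2 hx
  unfold exitInvSq
  rw [dirVec_add_pi, inner_neg_right, neg_sq]
  set b := inner ℝ x (dirVec θ)
  have hw2 : Real.sqrt (b ^ 2 + (R ^ 2 - ‖x‖ ^ 2)) ^ 2 = b ^ 2 + (R ^ 2 - ‖x‖ ^ 2) :=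
    Real.sq_sqrt (by positivity)
  field_simp
  linear_combination 2 * hw2

open Set in
lemma integral_disc_shear {φ : ℝ → ℂ} (hφ : Continuous φ) {M : ℝ} (hM : ∀ y, ‖φ y‖ ≤ M)
    (τ α : ℝ) {x : Plane} {R : ℝ} (hR : 0 ≤ R) (hx : ‖x‖ ^ 2 < R ^ 2) :
    IntegrableOn (fun θ => ∫ u in Ioi (exitInvSq x R θ),
      (((u ^ 2)⁻¹ : ℝ) : ℂ) * φ (τ * Real.cos (2 * θ - α) * u)) (Ioo (-Real.pi) Real.pi) ∧
    ∫ ζ in Metric.closedBall x R, φ (inner ℝ (τ • dirVec α) (starShear ζ)) =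
      1 / 2 * ∫ θ in Ioo (-Real.pi) Real.pi, ∫ u in Ioi (exitInvSq x R θ),
        (((u ^ 2)⁻¹ : ℝ) : ℂ) * φ (τ * Real.cos (2 * θ - α) * u) := by
  set f : Plane → ℂ := (Metric.closedBall x R).indicator
    fun ζ => φ (inner ℝ (τ • dirVec α) (starShear ζ)) with hf
  have hm : Measurable fun ζ => φ (inner ℝ (τ • dirVec α) (starShear ζ)) :=
    hφ.measurable.comp (measurable_const.inner measurable_starShear)
  have hfm : Measurable f := hm.indicator measurableSet_closedBall
  have hfi : Integrable f := by
    rw [hf, integrable_indicator_iff measurableSet_closedBall]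
    exact Measure.integrableOn_of_bounded measure_closedBall_lt_top.ne hm.aestronglyMeasurable
      (ae_of_all _ fun ζ => hM _)
  have hinner : ∀ θ, ∫ r in Ioi (0 : ℝ), (r : ℂ) * f (r • dirVec θ) =
      1 / 2 * ∫ u in Ioi (exitInvSq x R θ),
        (((u ^ 2)⁻¹ : ℝ) : ℂ) * φ (τ * Real.cos (2 * θ - α) * u) := by
    intro θ
    rw [integral_Ioi_mul_eq_inv_sq fun r => f (r • dirVec θ),
      ← integral_Ici_eq_integral_Ioi (x := exitInvSq x R θ)]
    congr 1
    have hU := exitInvSq_pos hx θ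
    rw [← inter_eq_right.2 (Ici_subset_Ioi.2 hU), ← setIntegral_indicator measurableSet_Ici]
    refine setIntegral_congr_fun measurableSet_Ioi fun u hu => ?_
    have hmem := mem_closedBall_iff_exitInvSq_le hR hx θ (mem_Ioi.1 hu)
    simp only [hf]
    by_cases h : exitInvSq x R θ ≤ u
    · rw [indicator_of_mem (hmem.2 h), indicator_of_mem (mem_Ici.2 h), inner_starShear τ α hu]
    · rw [indicator_of_notMem (fun h' => h (hmem.1 h')), mul_zero,
        indicator_of_notMem (s := Ici (exitInvSq x R θ)) (by simpa using h)]
  obtain ⟨h1, h2⟩ := integral_eq_polar hfm hfi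
  simp_rw [hinner] at h1 h2
  refine ⟨?_, ?_⟩
  · have := h1.const_mul 2
    simpa [IntegrableOn, ← mul_assoc] using this
  · rw [← integral_indicator measurableSet_closedBall, ← integral_const_mul]
    exact h2

lemma integral_add_eq_of_periodic {E : Type*} [NormedAddCommGroup E] [NormedSpace ℝ E] {f : ℝ → E}
    (hf : Function.Periodic f (2 * Real.pi)) (c : ℝ) :
    ∫ θ in (-Real.pi)..Real.pi, f (θ + c) = ∫ θ in (-Real.pi)..Real.pi, f θ := by
  rw [intervalIntegral.integral_comp_add_right]
  have := hf.intervalIntegral_add_eq (-Real.pi + c) (-Real.pi)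
  rwa [show -Real.pi + c + 2 * Real.pi = Real.pi + c by ring,
    show -Real.pi + 2 * Real.pi = Real.pi by ring] at this

lemma cos_two_mul_add_pi_div_two (θ α : ℝ) :
    Real.cos (2 * (θ + Real.pi / 2) - α) = -Real.cos (2 * θ - α) := by
  rw [show 2 * (θ + Real.pi / 2) - α = 2 * θ - α + Real.pi by ring, Real.cos_add_pi]

lemma cos_two_mul_add_pi (θ α : ℝ) :
    Real.cos (2 * (θ + Real.pi) - α) = Real.cos (2 * θ - α) := by
  rw [show 2 * (θ + Real.pi) - α = 2 * θ - α + 2 * Real.pi by ring, Real.cos_add_two_pi]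

lemma cos_two_mul_add_two_pi (θ α : ℝ) :
    Real.cos (2 * (θ + 2 * Real.pi) - α) = Real.cos (2 * θ - α) := by
  rw [two_mul Real.pi, ← add_assoc, cos_two_mul_add_pi, cos_two_mul_add_pi]

lemma integral_cos_two_mul_sq (α : ℝ) :
    ∫ θ in (-Real.pi)..Real.pi, Real.cos (2 * θ - α) ^ 2 = Real.pi := by
  have hp : Function.Periodic (fun θ => Real.cos (2 * θ - α) ^ 2) (2 * Real.pi) := fun θ => by
    simp only [cos_two_mul_add_two_pi]
  have h := integral_add_eq_of_periodic hp (Real.pi / 4)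
  have h2 : ∀ θ, Real.cos (2 * (θ + Real.pi / 4) - α) ^ 2 = 1 - Real.cos (2 * θ - α) ^ 2 := by
    intro θ
    rw [show 2 * (θ + Real.pi / 4) - α = 2 * θ - α + Real.pi / 2 by ring, Real.cos_add_pi_div_two,
      neg_sq, Real.sin_sq]
  simp_rw [h2] at h
  rw [intervalIntegral.integral_sub (by simp) (Continuous.intervalIntegrable (by fun_prop) _ _)] at h
  simp only [intervalIntegral.integral_const, smul_eq_mul, mul_one] at h
  linarith

/-- The argument runs over four arches of `|cos|`, each of area `2`, and the substitution halves the
total. -/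
lemma integral_abs_cos_two_mul (α : ℝ) :
    ∫ θ in (-Real.pi)..Real.pi, |Real.cos (2 * θ - α)| = 4 := by
  have hper : Function.Periodic (fun y => |Real.cos y|) Real.pi := fun y => by
    simp only [Real.cos_add_pi, abs_neg]
  have h1 : ∫ y in (-(Real.pi / 2))..(-(Real.pi / 2) + Real.pi), |Real.cos y| = 2 := by
    have : ∫ y in (-(Real.pi / 2))..(-(Real.pi / 2) + Real.pi), |Real.cos y| =
        ∫ y in (-(Real.pi / 2))..(-(Real.pi / 2) + Real.pi), Real.cos y := by
      refine intervalIntegral.integral_congr fun y hy => ?_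
      rw [Set.uIcc_of_le (by linarith [Real.pi_pos])] at hy
      exact abs_of_nonneg (Real.cos_nonneg_of_mem_Icc ⟨hy.1, by linarith [hy.2]⟩)
    rw [this, integral_cos, show -(Real.pi / 2) + Real.pi = Real.pi / 2 by ring]
    simp; norm_num
  rw [intervalIntegral.integral_comp_mul_sub (fun y => |Real.cos y|) two_ne_zero α]
  have h2 := hper.intervalIntegral_add_zsmul_eq 4 (2 * -Real.pi - α)
  rw [show 2 * -Real.pi - α + (4 : ℤ) • Real.pi = 2 * Real.pi - α by
    simp only [zsmul_eq_mul]; push_cast; ring,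
    hper.intervalIntegral_add_eq (2 * -Real.pi - α) (-(Real.pi / 2)), h1] at h2
  rw [h2 fun _ _ => Continuous.intervalIntegrable (by fun_prop) _ _]
  norm_num

/-- A quarter turn preserves `cos² (2θ - α)` and sends the squared component of `x` along the ray to
its complement in `‖x‖²`; so that component may be replaced by `‖x‖² / 2`. -/
lemma integral_cos_sq_mul_inner_sq (α : ℝ) (x : Plane) :
    ∫ θ in (-Real.pi)..Real.pi, Real.cos (2 * θ - α) ^ 2 * inner ℝ x (dirVec θ) ^ 2 =
      Real.pi / 2 * ‖x‖ ^ 2 := by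
  have hdp : ∀ θ, dirVec (θ + 2 * Real.pi) = dirVec θ := fun θ => by
    apply Plane.ext <;> simp
  have hp : Function.Periodic
      (fun θ => Real.cos (2 * θ - α) ^ 2 * inner ℝ x (dirVec θ) ^ 2) (2 * Real.pi) := fun θ => by
    simp only [cos_two_mul_add_two_pi, hdp]
  have h := integral_add_eq_of_periodic hp (Real.pi / 2)
  have h2 : ∀ θ, Real.cos (2 * (θ + Real.pi / 2) - α) ^ 2 *
      inner ℝ x (dirVec (θ + Real.pi / 2)) ^ 2 = Real.cos (2 * θ - α) ^ 2 * ‖x‖ ^ 2 -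
        Real.cos (2 * θ - α) ^ 2 * inner ℝ x (dirVec θ) ^ 2 := by
    intro θ
    rw [cos_two_mul_add_pi_div_two, Plane.inner_eq, Plane.inner_eq, Plane.norm_sq]
    simp only [dirVec_zero, dirVec_one, Real.cos_add_pi_div_two, Real.sin_add_pi_div_two]
    linear_combination (Real.cos (2 * θ - α) ^ 2 * (x 0 ^ 2 + x 1 ^ 2)) * Real.sin_sq_add_cos_sq θ
  simp_rw [h2] at h
  rw [intervalIntegral.integral_sub (Continuous.intervalIntegrable (by fun_prop) _ _)
    (Continuous.intervalIntegrable (by fun_prop) _ _), intervalIntegral.integral_mul_const,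
    integral_cos_two_mul_sq] at h
  linarith

/-! ### Characteristic function of the shear of one star -/

lemma continuous_oscTail {U : ℝ} (hU : 0 < U) : Continuous fun a => oscTail a U := by
  unfold oscTail
  refine continuous_of_dominated (bound := fun u => (u ^ 2)⁻¹ * 2) (fun a => by fun_prop)
    (fun a => ae_of_all _ fun u => ?_) ((integrableOn_Ioi_inv_sq hU).mul_const 2)
    (ae_of_all _ fun u => by fun_prop)
  rw [norm_mul, Complex.norm_real, Real.norm_of_nonneg (by positivity)]
  exact mul_le_mul_of_nonneg_left (norm_one_sub_exp_I_le _) (by positivity)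

/-- Two opposite rays: the logarithms cancel. -/
lemma norm_oscTail_pair_sub_le (a b : ℝ) {s U V W : ℝ} (hU : 0 < U) (hV : 0 < V) (hW : 0 < W)
    (hprod : U * V = W ^ 2) (hsum : U + V = 2 * W + 4 * b ^ 2 * W ^ 2) (hb : b ^ 2 ≤ s)
    (hsW : s * W ≤ 1) :
    ‖oscTail a U + oscTail a V - 2 * oscTail a W - (-(2 * a ^ 2 * b ^ 2 * W ^ 2) : ℝ)‖ ≤
      3 * |a| ^ 3 * s * W ^ 3 + 2000 * a ^ 4 * W ^ 3 := by
  have hs0 : 0 ≤ s := (sq_nonneg b).trans hb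
  have hbW : b ^ 2 * W ≤ 1 := (mul_le_mul_of_nonneg_right hb hW.le).trans hsW
  have hsum6 : U + V ≤ 6 * W := by nlinarith
  have h1 := norm_oscTail_sub_le a hU hW
  have h2 := norm_oscTail_sub_le a hV hW
  have hlog : Real.log U + Real.log V = 2 * Real.log W := by
    rw [← Real.log_mul hU.ne' hV.ne', hprod, Real.log_pow]; norm_num
  -- Both `U` and `V` are at most `6 W`, which gives `4 · 6² · 6 = 864` for each ray, rounded up to
  -- `1000`.
  have hb4 : ∀ X, 0 < X → X ≤ 6 * W →
      4 * a ^ 4 * max X W ^ 2 * |W - X| ≤ 1000 * a ^ 4 * W ^ 3 := by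
    intro X hX hX6
    have h3 : max X W ≤ 6 * W := max_le hX6 (by linarith)
    have h4 : |W - X| ≤ 6 * W := abs_le.2 ⟨by linarith, by linarith⟩
    have ha4 : 0 ≤ a ^ 4 := by positivity
    calc 4 * a ^ 4 * max X W ^ 2 * |W - X| ≤ 4 * a ^ 4 * (6 * W) ^ 2 * (6 * W) := by gcongr
      _ = 864 * (a ^ 4 * W ^ 3) := by ring
      _ ≤ 1000 * a ^ 4 * W ^ 3 := by
        have : 0 ≤ a ^ 4 * W ^ 3 := by positivity
        linarith
  have h1' := h1.trans (hb4 U hU (by linarith))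
  have h2' := h2.trans (hb4 V hV (by linarith))
  set E1 := oscTail a U - oscTail a W - (-(Complex.I * a * (Real.log W - Real.log U)) +
      a ^ 2 / 2 * (W - U) + Complex.I * a ^ 3 / 12 * (W ^ 2 - U ^ 2))
  set E2 := oscTail a V - oscTail a W - (-(Complex.I * a * (Real.log W - Real.log V)) +
      a ^ 2 / 2 * (W - V) + Complex.I * a ^ 3 / 12 * (W ^ 2 - V ^ 2))
  -- The cubic terms do not cancel, but their sum carries a factor `b² W³`, which provides the
  -- factor `s` in the error.
  have hUV2 : U ^ 2 + V ^ 2 - 2 * W ^ 2 = 4 * b ^ 2 * W ^ 2 * (4 * W + 4 * b ^ 2 * W ^ 2) := by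
    have : U ^ 2 + V ^ 2 = (U + V) ^ 2 - 2 * (U * V) := by ring
    rw [this, hprod, hsum]; ring
  have hid : oscTail a U + oscTail a V - 2 * oscTail a W - (-(2 * a ^ 2 * b ^ 2 * W ^ 2) : ℝ) =
      E1 + E2 - Complex.I * ((a ^ 3 / 12 * (U ^ 2 + V ^ 2 - 2 * W ^ 2) : ℝ) : ℂ) := by
    have hlog' : (Real.log U : ℂ) + Real.log V = 2 * Real.log W := by exact_mod_cast hlog
    have hsum' : (U : ℂ) + V = 2 * W + 4 * b ^ 2 * W ^ 2 := by exact_mod_cast hsum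
    simp only [E1, E2]
    push_cast
    linear_combination (Complex.I * a) * hlog' + (-(a : ℂ) ^ 2 / 2) * hsum'
  rw [hid]
  have h3 : ‖Complex.I * ((a ^ 3 / 12 * (U ^ 2 + V ^ 2 - 2 * W ^ 2) : ℝ) : ℂ)‖ ≤
      3 * |a| ^ 3 * s * W ^ 3 := by
    rw [norm_mul, Complex.norm_I, one_mul, Complex.norm_real, Real.norm_eq_abs, abs_mul, abs_div,
      abs_pow, hUV2]
    have h4 : 0 ≤ 4 * b ^ 2 * W ^ 2 * (4 * W + 4 * b ^ 2 * W ^ 2) := by positivity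
    rw [abs_of_nonneg h4]
    have h5 : 4 * b ^ 2 * W ^ 2 * (4 * W + 4 * b ^ 2 * W ^ 2) ≤ 32 * s * W ^ 3 := by
      calc 4 * b ^ 2 * W ^ 2 * (4 * W + 4 * b ^ 2 * W ^ 2)
          = 16 * b ^ 2 * W ^ 3 * (1 + b ^ 2 * W) := by ring
        _ ≤ 16 * s * W ^ 3 * (1 + 1) := by gcongr
        _ = 32 * s * W ^ 3 := by ring
    have h6 : 0 ≤ |a| ^ 3 := by positivity
    have h7 : 0 ≤ |a| ^ 3 * (s * W ^ 3) := by positivity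
    norm_num
    nlinarith [mul_le_mul_of_nonneg_left h5 h6]
  calc _ ≤ ‖E1 + E2‖ + _ := norm_sub_le _ _
    _ ≤ (‖E1‖ + ‖E2‖) + _ := by gcongr; exact norm_add_le _ _
    _ ≤ _ := by linarith

/-- The half turn pairs the two ends of a chord and removes the logarithms; the quarter turn flips
the sign of `cos (2θ - α)`, so the tails at the common value `W` may be averaged over the sign of
the frequency. The surviving terms have elementary angular means. -/
lemma norm_integral_disc_one_sub_exp_sub_le {τ : ℝ} (hτ : 0 ≤ τ) (α : ℝ) {x : Plane} {R : ℝ}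
    (hR : 0 < R) (hx : 2 * ‖x‖ ^ 2 ≤ R ^ 2) {W : ℝ} (hW : W = (R ^ 2 - ‖x‖ ^ 2)⁻¹) :
    ‖(∫ ζ in Metric.closedBall x R,
        (1 - Complex.exp ((inner ℝ (τ • dirVec α) (starShear ζ) : ℝ) * Complex.I))) -
      (Real.pi * τ - Real.pi * τ ^ 2 / 4 * (W + ‖x‖ ^ 2 * W ^ 2) : ℝ)‖ ≤
      Real.pi * (2 * τ ^ 3 * ‖x‖ ^ 2 * W ^ 3 + 1004 * τ ^ 4 * W ^ 3) := by
  have hR2 : 0 < R ^ 2 := by positivity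
  have hxlt : ‖x‖ ^ 2 < R ^ 2 := by nlinarith
  have hW0 : 0 < W := by rw [hW]; exact inv_pos.2 (sub_pos.2 hxlt)
  have hsW : ‖x‖ ^ 2 * W ≤ 1 := by
    rw [hW, ← div_eq_mul_inv, div_le_one (sub_pos.2 hxlt)]; linarith
  obtain ⟨hint, heq⟩ := integral_disc_shear (φ := fun y => 1 - Complex.exp (y * Complex.I))
    (by fun_prop) norm_one_sub_exp_I_le τ α hR.le hxlt
  set a : ℝ → ℝ := fun θ => τ * Real.cos (2 * θ - α) with ha
  set f : ℝ → ℂ := fun θ => oscTail (a θ) (exitInvSq x R θ) with hf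
  have hacont : Continuous a := by fun_prop
  have hpi := Real.pi_pos
  have hpile : -Real.pi ≤ Real.pi := by linarith
  have hfi : IntervalIntegrable f volume (-Real.pi) Real.pi := by
    rw [intervalIntegrable_iff_integrableOn_Ioo_of_le hpile]
    exact hint
  have hdp : ∀ θ, dirVec (θ + 2 * Real.pi) = dirVec θ := fun θ => by
    apply Plane.ext <;> simp
  have hfp : Function.Periodic f (2 * Real.pi) := fun θ => by
    simp only [hf, ha, exitInvSq, cos_two_mul_add_two_pi, hdp]
  have hap : ∀ θ, a (θ + Real.pi) = a θ := fun θ => by simp only [ha, cos_two_mul_add_pi]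
  have hfi' : IntervalIntegrable (fun θ => f (θ + Real.pi)) volume (-Real.pi) Real.pi := by
    have h := hfp.intervalIntegrable (by positivity) (t := -Real.pi)
      (by rwa [show -Real.pi + 2 * Real.pi = Real.pi by ring]) (-Real.pi + Real.pi)
      (Real.pi + Real.pi)
    simpa using h.comp_add_right Real.pi
  have hi1 : Continuous fun θ => oscTail (a θ) W := (continuous_oscTail hW0).comp hacont
  have hi2 : Continuous fun θ => oscTail (-a θ) W := (continuous_oscTail hW0).comp hacont.neg
  have hflip : ∫ θ in (-Real.pi)..Real.pi, oscTail (-a θ) W =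
      ∫ θ in (-Real.pi)..Real.pi, oscTail (a θ) W := by
    have hp : Function.Periodic (fun θ => oscTail (a θ) W) (2 * Real.pi) := fun θ => by
      simp only [ha, cos_two_mul_add_two_pi]
    rw [← integral_add_eq_of_periodic hp (Real.pi / 2)]
    simp only [ha, cos_two_mul_add_pi_div_two, mul_neg]
  set main : ℝ → ℝ := fun θ => Real.pi * |a θ| - a θ ^ 2 * W -
    2 * a θ ^ 2 * inner ℝ x (dirVec θ) ^ 2 * W ^ 2 with hmain
  have hmaincont : Continuous main := by fun_prop
  -- The last two terms have opposite integrals, so `G` integrates to twice `f`. Pointwise, `G` is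
  -- the pair error relative to `2 * oscTail (a θ) W` plus the sum of the tails for `a θ` and `-a
  -- θ`, and both are known.
  set G : ℝ → ℂ := fun θ => f θ + f (θ + Real.pi) - oscTail (a θ) W + oscTail (-a θ) W with hG
  have hGint : ∫ θ in (-Real.pi)..Real.pi, G θ = 2 * ∫ θ in (-Real.pi)..Real.pi, f θ := by
    rw [hG, intervalIntegral.integral_add ((hfi.add hfi').sub (hi1.intervalIntegrable _ _))
      (hi2.intervalIntegrable _ _), intervalIntegral.integral_sub (hfi.add hfi')
      (hi1.intervalIntegrable _ _), intervalIntegral.integral_add hfi hfi', hflip,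
      integral_add_eq_of_periodic hfp]
    ring
  have hGi : IntervalIntegrable G volume (-Real.pi) Real.pi :=
    ((hfi.add hfi').sub (hi1.intervalIntegrable _ _)).add (hi2.intervalIntegrable _ _)
  have hmainint : ∫ θ in (-Real.pi)..Real.pi, main θ =
      4 * (Real.pi * τ - Real.pi * τ ^ 2 / 4 * (W + ‖x‖ ^ 2 * W ^ 2)) := by
    have e : ∀ θ, main θ = Real.pi * τ * |Real.cos (2 * θ - α)| -
        τ ^ 2 * W * Real.cos (2 * θ - α) ^ 2 - 2 * τ ^ 2 * W ^ 2 *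
        (Real.cos (2 * θ - α) ^ 2 * inner ℝ x (dirVec θ) ^ 2) := fun θ => by
      simp only [hmain, ha, abs_mul, abs_of_nonneg hτ]; ring
    simp_rw [e]
    rw [intervalIntegral.integral_sub (Continuous.intervalIntegrable (by fun_prop) _ _)
      (Continuous.intervalIntegrable (by fun_prop) _ _),
      intervalIntegral.integral_sub (Continuous.intervalIntegrable (by fun_prop) _ _)
      (Continuous.intervalIntegrable (by fun_prop) _ _), intervalIntegral.integral_const_mul,
      intervalIntegral.integral_const_mul, intervalIntegral.integral_const_mul,
      integral_abs_cos_two_mul, integral_cos_two_mul_sq, integral_cos_sq_mul_inner_sq]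
    ring
  have hpt : ∀ θ, ‖G θ - (main θ : ℂ)‖ ≤ 3 * τ ^ 3 * ‖x‖ ^ 2 * W ^ 3 + 2008 * τ ^ 4 * W ^ 3 := by
    intro θ
    have hale : |a θ| ≤ τ := by
      simp only [ha, abs_mul, abs_of_nonneg hτ]
      exact mul_le_of_le_one_right hτ (Real.abs_cos_le_one _)
    have hb : inner ℝ x (dirVec θ) ^ 2 ≤ ‖x‖ ^ 2 := by
      have := abs_real_inner_le_norm x (dirVec θ)
      rw [norm_dirVec, mul_one] at this
      exact sq_le_sq' (by linarith [(abs_le.1 this).1]) (abs_le.1 this).2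
    have h1 := norm_oscTail_pair_sub_le (a θ) (inner ℝ x (dirVec θ)) (s := ‖x‖ ^ 2)
      (exitInvSq_pos hxlt θ) (exitInvSq_pos hxlt (θ + Real.pi)) hW0
      (by rw [exitInvSq_add_pi_mul x hxlt, hW]) (by rw [exitInvSq_add_pi_add x hxlt, hW]) hb hsW
    have h2 := norm_oscTail_add_oscTail_neg_sub_le (a θ) hW0
    have e : G θ - (main θ : ℂ) = (oscTail (a θ) (exitInvSq x R θ) +
        oscTail (a θ) (exitInvSq x R (θ + Real.pi)) - 2 * oscTail (a θ) W -
        (-(2 * a θ ^ 2 * inner ℝ x (dirVec θ) ^ 2 * W ^ 2) : ℝ)) +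
        (oscTail (a θ) W + oscTail (-a θ) W - (Real.pi * |a θ| - a θ ^ 2 * W : ℝ)) := by
      simp only [hG, hf, hmain, hap]
      push_cast
      ring
    have ha4 : a θ ^ 4 ≤ τ ^ 4 := by
      rw [← abs_of_nonneg (show 0 ≤ a θ ^ 4 by positivity), abs_pow]; gcongr
    rw [e]
    refine (norm_add_le _ _).trans ((add_le_add h1 h2).trans ?_)
    calc 3 * |a θ| ^ 3 * ‖x‖ ^ 2 * W ^ 3 + 2000 * a θ ^ 4 * W ^ 3 + 8 * a θ ^ 4 * W ^ 3
        ≤ 3 * τ ^ 3 * ‖x‖ ^ 2 * W ^ 3 + 2000 * τ ^ 4 * W ^ 3 + 8 * τ ^ 4 * W ^ 3 := by gcongr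
      _ = _ := by ring
  have hfin : ‖(∫ θ in (-Real.pi)..Real.pi, G θ) - ((∫ θ in (-Real.pi)..Real.pi, main θ : ℝ) : ℂ)‖ ≤
      (3 * τ ^ 3 * ‖x‖ ^ 2 * W ^ 3 + 2008 * τ ^ 4 * W ^ 3) * |Real.pi - -Real.pi| := by
    rw [← intervalIntegral.integral_ofReal, ← intervalIntegral.integral_sub hGi
      (Continuous.intervalIntegrable (by fun_prop) _ _)]
    exact intervalIntegral.norm_integral_le_of_norm_le_const fun θ _ => hpt θ
  rw [hGint, hmainint] at hfin
  have hI : (∫ ζ in Metric.closedBall x R,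
      (1 - Complex.exp ((inner ℝ (τ • dirVec α) (starShear ζ) : ℝ) * Complex.I))) =
      1 / 2 * ∫ θ in (-Real.pi)..Real.pi, f θ := by
    rw [heq, intervalIntegral.integral_of_le hpile, integral_Ioc_eq_integral_Ioo]
    rfl
  rw [hI]
  have e2 : (1 / 2 * (∫ θ in (-Real.pi)..Real.pi, f θ) -
      ((Real.pi * τ - Real.pi * τ ^ 2 / 4 * (W + ‖x‖ ^ 2 * W ^ 2) : ℝ) : ℂ)) =
      1 / 4 * (2 * (∫ θ in (-Real.pi)..Real.pi, f θ) -
      ((4 * (Real.pi * τ - Real.pi * τ ^ 2 / 4 * (W + ‖x‖ ^ 2 * W ^ 2)) : ℝ) : ℂ)) := by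
    push_cast; ring
  rw [e2, norm_mul]
  have : |Real.pi - -Real.pi| = 2 * Real.pi := by rw [abs_of_nonneg (by linarith)]; ring
  rw [this] at hfin
  have h14 : ‖(1 / 4 : ℂ)‖ = 1 / 4 := by norm_num
  rw [h14]
  have : 0 ≤ τ ^ 3 * ‖x‖ ^ 2 * W ^ 3 := by positivity
  nlinarith

/-- A gain over the trivial bound, valid for all frequencies. The disc contains the disc of radius
`R / 2` about the origin, where rays have constant length and oscillation yields cancellation; the
remaining three quarters of the area are estimated trivially. -/
lemma norm_integral_disc_exp_le {τ : ℝ} (hτ : 0 ≤ τ) (α : ℝ) {x : Plane} {R : ℝ}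
    (hR : 0 < R) (hx : 2 * ‖x‖ ≤ R) :
    ‖∫ ζ in Metric.closedBall x R,
        Complex.exp ((inner ℝ (τ • dirVec α) (starShear ζ) : ℝ) * Complex.I)‖ ≤
      Real.pi * R ^ 2 * (1 - (4 * τ / R ^ 2) / (8 * (4 * τ / R ^ 2 + Real.pi))) := by
  have hpi := Real.pi_pos
  have hpile : -Real.pi ≤ Real.pi := by linarith
  set f : Plane → ℂ := fun ζ =>
    Complex.exp ((inner ℝ (τ • dirVec α) (starShear ζ) : ℝ) * Complex.I) with hf
  have hfm : Measurable f := by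
    have : Measurable fun ζ => inner ℝ (τ • dirVec α) (starShear ζ) :=
      measurable_const.inner measurable_starShear
    fun_prop
  have hfn : ∀ ζ, ‖f ζ‖ = 1 := fun ζ => Complex.norm_exp_ofReal_mul_I _
  have hfi : ∀ c r, IntegrableOn f (Metric.closedBall c r) := fun c r =>
    Measure.integrableOn_of_bounded (M := 1) measure_closedBall_lt_top.ne hfm.aestronglyMeasurable
      (ae_of_all _ fun ζ => (hfn ζ).le)
  have hvol : ∀ (c : Plane) r, 0 ≤ r → volume.real (Metric.closedBall c r) = Real.pi * r ^ 2 := by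
    intro c r hr
    rw [Measure.real, EuclideanSpace.volume_closedBall_fin_two]
    simp [hr, mul_comm, Real.pi_pos.le]
  have hsub : Metric.closedBall (0 : Plane) (R / 2) ⊆ Metric.closedBall x R := by
    refine Metric.closedBall_subset_closedBall' ?_
    rw [dist_zero_left]; linarith
  have hR2 : 0 < R ^ 2 := by positivity
  set y := 4 * τ / R ^ 2 with hy
  have hy0 : 0 ≤ y := by positivity
  have hsplit : ∫ ζ in Metric.closedBall x R, f ζ =
      (∫ ζ in Metric.closedBall x R \ Metric.closedBall 0 (R / 2), f ζ) +
      ∫ ζ in Metric.closedBall 0 (R / 2), f ζ := by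
    rw [setIntegral_sdiff measurableSet_closedBall (hfi _ _) hsub]; ring
  have hb1 : ‖∫ ζ in Metric.closedBall x R \ Metric.closedBall 0 (R / 2), f ζ‖ ≤
      Real.pi * R ^ 2 * (3 / 4) := by
    refine (norm_setIntegral_le_of_norm_le_const (C := 1)
      ((measure_mono Set.sdiff_subset).trans_lt measure_closedBall_lt_top)
      fun ζ _ => (hfn ζ).le).trans ?_
    rw [measureReal_sdiff hsub measurableSet_closedBall measure_closedBall_lt_top.ne, hvol _ _ hR.le, hvol _ _ (by positivity)]
    apply le_of_eq; ring
  have hb2 : ‖∫ ζ in Metric.closedBall 0 (R / 2), f ζ‖ ≤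
      Real.pi * R ^ 2 * (1 / 4 - y / (8 * (y + Real.pi))) := by
    obtain ⟨-, heq⟩ := integral_disc_shear (φ := fun y => Complex.exp (y * Complex.I))
      (by fun_prop) (M := 1) (fun y => (Complex.norm_exp_ofReal_mul_I y).le) τ α
      (x := 0) (R := R / 2) (by positivity) (by simp; positivity)
    have hU : ∀ θ, exitInvSq 0 (R / 2) θ = 4 / R ^ 2 := by
      intro θ
      simp only [exitInvSq, inner_zero_left, norm_zero]
      rw [show (0 : ℝ) ^ 2 + ((R / 2) ^ 2 - 0 ^ 2) = (R / 2) ^ 2 by ring,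
        Real.sqrt_sq (by positivity)]
      field_simp
      ring
    have hfe : ∫ ζ in Metric.closedBall 0 (R / 2), f ζ = _ := heq
    rw [hfe, ← integral_Ioc_eq_integral_Ioo, ← intervalIntegral.integral_of_le hpile]
    have hpt : ∀ θ, ‖∫ u in Set.Ioi (exitInvSq 0 (R / 2) θ), (((u ^ 2)⁻¹ : ℝ) : ℂ) *
        Complex.exp ((τ * Real.cos (2 * θ - α) * u : ℝ) * Complex.I)‖ ≤
        R ^ 2 / 4 * (1 - y / (y + Real.pi) * Real.cos (2 * θ - α) ^ 2) := by
      intro θ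
      rw [hU]
      refine (norm_integral_exp_div_sq_le _ (by positivity)).trans ?_
      set c := Real.cos (2 * θ - α)
      have hc : c ^ 2 ≤ |c| := by
        rw [← sq_abs, sq]
        exact mul_le_of_le_one_left (abs_nonneg c) (Real.abs_cos_le_one _)
      have hc1 : |c| ≤ 1 := Real.abs_cos_le_one _
      rw [abs_mul, abs_of_nonneg hτ]
      have e : τ * |c| * (4 / R ^ 2) = y * |c| := by rw [hy]; ring
      rw [e]
      have e2 : Real.pi / (4 / R ^ 2 * (y * |c| + Real.pi)) =
          R ^ 2 / 4 * (Real.pi / (y * |c| + Real.pi)) := by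
        have : 0 < y * |c| + Real.pi := by positivity
        field_simp
      rw [e2]
      refine mul_le_mul_of_nonneg_left ?_ (by positivity)
      have h1 : 0 < y * |c| + Real.pi := by positivity
      have h2 : 0 < y + Real.pi := by positivity
      have e3 : Real.pi / (y * |c| + Real.pi) = 1 - y * |c| / (y * |c| + Real.pi) := by
        field_simp; ring
      rw [e3]
      -- Bounding the gain below by a multiple of `c²` makes its angular mean computable.
      have h3 : y / (y + Real.pi) * c ^ 2 ≤ y * |c| / (y * |c| + Real.pi) := by
        calc y / (y + Real.pi) * c ^ 2 ≤ y / (y + Real.pi) * |c| := by gcongr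
          _ = y * |c| / (y + Real.pi) := by ring
          _ ≤ y * |c| / (y * |c| + Real.pi) := by
            gcongr; exact mul_le_of_le_one_right hy0 hc1
      linarith
    rw [norm_mul]
    have hn := intervalIntegral.norm_integral_le_of_norm_le (μ := volume) hpile
      (ae_of_all _ fun θ _ => hpt θ) (Continuous.intervalIntegrable (by fun_prop) _ _)
    rw [intervalIntegral.integral_const_mul, intervalIntegral.integral_sub (by simp)
      (Continuous.intervalIntegrable (by fun_prop) _ _), intervalIntegral.integral_const_mul,
      integral_cos_two_mul_sq, intervalIntegral.integral_const] at hn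
    have h12 : ‖(1 / 2 : ℂ)‖ = 1 / 2 := by norm_num
    rw [h12]
    have hyp : 0 < y + Real.pi := by positivity
    calc _ ≤ 1 / 2 * (R ^ 2 / 4 * ((Real.pi - -Real.pi) • (1 : ℝ) - y / (y + Real.pi) * Real.pi)) := by
          gcongr
      _ = _ := by simp only [smul_eq_mul]; field_simp; ring
  change ‖∫ ζ in Metric.closedBall x R, f ζ‖ ≤ _
  rw [hsplit]
  refine (norm_add_le _ _).trans ((add_le_add hb1 hb2).trans (le_of_eq ?_))
  ring

/-! ### Expansion of the `g`-th power of the characteristic function -/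

/-- Second order approximation of the characteristic function of the shear, as a function of
`v = κ_* ‖t‖` and `s = ‖x‖²`. -/
def charExpansion (s g v : ℝ) : ℝ :=
  Real.exp (-v) * (1 - v ^ 2 / (4 * g) +
    (Real.pi * s * v ^ 2 / 2 - v ^ 3 / 12 + v ^ 4 / 32) / g ^ 2)

/-- Exponent approximating `log (1 - T + T² / 4 + q T² / 2)`. -/
def logExpansion (q T : ℝ) : ℝ := -T - T ^ 2 / 4 - T ^ 3 / 12 + q * T ^ 2 / 2

lemma abs_exp_sub_sum_le (y : ℝ) (n : ℕ) :
    |Real.exp y - ∑ i ∈ Finset.range n, y ^ i / (i.factorial : ℝ)| ≤ |y| ^ n * Real.exp |y| := by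
  have h := Complex.norm_exp_sub_sum_le_norm_mul_exp (y : ℂ) n
  have e : (Complex.exp y - ∑ i ∈ Finset.range n, (y : ℂ) ^ i / (i.factorial : ℂ)) =
      ((Real.exp y - ∑ i ∈ Finset.range n, y ^ i / (i.factorial : ℝ) : ℝ) : ℂ) := by push_cast; rfl
  rw [e, Complex.norm_real, Complex.norm_real] at h
  exact h

lemma abs_exp_logExpansion_sub_le {q T : ℝ} (hq0 : 0 ≤ q) (hq : q ≤ 1 / 2) (hT0 : 0 ≤ T)
    (hT : T ≤ 1) :
    |Real.exp (logExpansion q T) - (1 - T + T ^ 2 / 4 + q * T ^ 2 / 2)| ≤ q * T ^ 3 + 200 * T ^ 4 := by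
  set Y := logExpansion q T with hY
  have hYabs : |Y| ≤ 2 * T := by
    rw [hY, logExpansion, abs_le]
    have h2 : T ^ 2 ≤ T := by nlinarith
    have h3 : T ^ 3 ≤ T := by nlinarith
    have : 0 ≤ q * T ^ 2 := by positivity
    have : q * T ^ 2 ≤ T := by nlinarith
    constructor <;> nlinarith [pow_nonneg hT0 2, pow_nonneg hT0 3]
  have h1 := abs_exp_sub_sum_le Y 4
  have h2 : |Y| ^ 4 * Real.exp |Y| ≤ 160 * T ^ 4 := by
    have e1 : |Y| ^ 4 ≤ (2 * T) ^ 4 := by gcongr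
    have e2 : Real.exp |Y| ≤ 10 := by
      have : Real.exp |Y| ≤ Real.exp (1 + 1) := Real.exp_le_exp.2 (by linarith)
      rw [Real.exp_add] at this
      have := Real.exp_one_lt_d9
      have := Real.exp_pos 1
      nlinarith
    calc |Y| ^ 4 * Real.exp |Y| ≤ (2 * T) ^ 4 * 10 := by gcongr
      _ = 160 * T ^ 4 := by ring
  have h3 : ∑ i ∈ Finset.range 4, Y ^ i / (i.factorial : ℝ) = 1 + Y + Y ^ 2 / 2 + Y ^ 3 / 6 := by
    simp [Finset.sum_range_succ, Nat.factorial]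
  rw [h3] at h1
  set r1 := (1 / 4 + T / 12 - q / 2) ^ 2 + 1 / 6 with hr1
  -- Here `Y = -T - c T²`. The expansion then agrees with the polynomial through `T³`, except for
  -- the cross term `-q T³ / 2`.
  set c := 1 / 4 + T / 12 - q / 2 with hc
  have hcabs : |c| ≤ 1 := by rw [abs_le, hc]; constructor <;> linarith
  have hpoly : 1 + Y + Y ^ 2 / 2 + Y ^ 3 / 6 - (1 - T + T ^ 2 / 4 + q * T ^ 2 / 2) =
      -(q * T ^ 3 / 2) + T ^ 4 * (r1 / 2 - (3 * c + 3 * c ^ 2 * T + c ^ 3 * T ^ 2) / 6) := by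
    rw [hr1, hY, hc, logExpansion]; ring
  have hr : |r1 / 2 - (3 * c + 3 * c ^ 2 * T + c ^ 3 * T ^ 2) / 6| ≤ 10 := by
    obtain ⟨c1, c2⟩ := abs_le.1 hcabs
    have hc2 : c ^ 2 ≤ 1 := by nlinarith
    have hc3 : |c ^ 3 * T ^ 2| ≤ 1 := by
      rw [abs_mul, abs_pow, abs_of_nonneg (by positivity : 0 ≤ T ^ 2)]
      exact mul_le_one₀ (pow_le_one₀ (abs_nonneg c) hcabs) (by positivity) (pow_le_one₀ hT0 hT)
    have hc2T : 0 ≤ c ^ 2 * T := by positivity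
    have hc2T' : c ^ 2 * T ≤ 1 := by nlinarith [sq_nonneg c]
    obtain ⟨d1, d2⟩ := abs_le.1 hc3
    have hc20 := sq_nonneg c
    rw [abs_le, hr1]
    clear_value c
    constructor <;> linarith
  have hpoly' : |1 + Y + Y ^ 2 / 2 + Y ^ 3 / 6 - (1 - T + T ^ 2 / 4 + q * T ^ 2 / 2)| ≤
      q * T ^ 3 + 10 * T ^ 4 := by
    rw [hpoly]
    have h0 : 0 ≤ q * T ^ 3 := by positivity
    refine (abs_add_le _ _).trans ?_
    rw [abs_neg, abs_of_nonneg (by positivity), abs_mul, abs_of_nonneg (by positivity : 0 ≤ T ^ 4)]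
    nlinarith [mul_le_mul_of_nonneg_left hr (by positivity : 0 ≤ T ^ 4)]
  have := abs_sub_le (Real.exp Y) (1 + Y + Y ^ 2 / 2 + Y ^ 3 / 6)
    (1 - T + T ^ 2 / 4 + q * T ^ 2 / 2)
  have : 0 ≤ T ^ 4 := by positivity
  linarith

lemma norm_pow_sub_pow_le {a b : ℂ} {M : ℝ} (ha : ‖a‖ ≤ M) (hb : ‖b‖ ≤ M) (n : ℕ) :
    ‖a ^ n - b ^ n‖ ≤ n * ‖a - b‖ * M ^ (n - 1) := by
  have hM : 0 ≤ M := (norm_nonneg a).trans ha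
  rw [← Commute.geom_sum₂_mul (Commute.all a b), norm_mul]
  have : ‖∑ i ∈ Finset.range n, a ^ i * b ^ (n - 1 - i)‖ ≤ n * M ^ (n - 1) := by
    refine (norm_sum_le_of_le (f := fun i => a ^ i * b ^ (n - 1 - i))
      (n := fun _ => M ^ (n - 1)) _ fun i hi => ?_).trans (by simp)
    rw [norm_mul, norm_pow, norm_pow]
    have hi' : i + (n - 1 - i) = n - 1 := by
      have := Finset.mem_range.1 hi; omega
    calc ‖a‖ ^ i * ‖b‖ ^ (n - 1 - i) ≤ M ^ i * M ^ (n - 1 - i) := by gcongr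
      _ = M ^ (n - 1) := by rw [← pow_add, hi']
  calc _ ≤ n * M ^ (n - 1) * ‖a - b‖ := by gcongr
    _ = _ := by ring

/-- Taylor expansion of the exponential to second order; of the square only `w1²/g²` is kept, the
products `w1 w2/g³` and `w2²/g⁴` joining the error. The bound `E` on the exponential remains a
parameter, later to be absorbed by `exp (-v)`. -/
lemma abs_exp_sub_second_order_le {K g V E w1 w2 : ℝ} (hK : 1 ≤ K) (hg : 1 ≤ g) (hV : 1 ≤ V)
    (hE : 1 ≤ E) (hw1 : |w1| ≤ V ^ 2) (hw2 : |w2| ≤ K * V ^ 3)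
    (hw : Real.exp |w1 / g + w2 / g ^ 2| ≤ E) :
    |Real.exp (w1 / g + w2 / g ^ 2) - (1 + w1 / g + (w2 + w1 ^ 2 / 2) / g ^ 2)| ≤
      10 * K ^ 3 * V ^ 9 / g ^ 3 * E := by
  have hg0 : 0 < g := by linarith
  have hV0 : 0 < V := by linarith
  have hK0 : 0 < K := by linarith
  have hK3 : K ≤ K ^ 3 := le_self_pow₀ hK (by norm_num)
  have hK23 : K ^ 2 ≤ K ^ 3 := pow_le_pow_right₀ hK (by norm_num)
  have hV59 : V ^ 5 ≤ V ^ 9 := pow_le_pow_right₀ hV (by norm_num)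
  have hV69 : V ^ 6 ≤ V ^ 9 := pow_le_pow_right₀ hV (by norm_num)
  have hV23 : V ^ 2 ≤ V ^ 3 := pow_le_pow_right₀ hV (by norm_num)
  have hg34 : g ^ 3 ≤ g ^ 4 := pow_le_pow_right₀ hg (by norm_num)
  have hgg : g ≤ g ^ 2 := le_self_pow₀ hg (by norm_num)
  set w := w1 / g + w2 / g ^ 2 with hwdef
  have hwabs : |w| ≤ 2 * K * V ^ 3 / g := by
    have c1 : |w1 / g| ≤ K * V ^ 3 / g := by
      rw [abs_div, abs_of_pos hg0]
      refine div_le_div_of_nonneg_right (hw1.trans (hV23.trans ?_)) hg0.le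
      exact le_mul_of_one_le_left (by positivity) hK
    have c2 : |w2 / g ^ 2| ≤ K * V ^ 3 / g := by
      rw [abs_div, abs_of_pos (by positivity : 0 < g ^ 2)]
      exact div_le_div₀ (by positivity) hw2 hg0 hgg
    calc |w| ≤ |w1 / g| + |w2 / g ^ 2| := abs_add_le _ _
      _ ≤ K * V ^ 3 / g + K * V ^ 3 / g := add_le_add c1 c2
      _ = _ := by ring
  have hexp := abs_exp_sub_sum_le w 3
  have hsum : ∑ i ∈ Finset.range 3, w ^ i / (i.factorial : ℝ) = 1 + w + w ^ 2 / 2 := by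
    simp [Finset.sum_range_succ, Nat.factorial]
  rw [hsum] at hexp
  have hterm1 : |Real.exp w - (1 + w + w ^ 2 / 2)| ≤ 8 * K ^ 3 * V ^ 9 / g ^ 3 * E := by
    refine hexp.trans ?_
    calc |w| ^ 3 * Real.exp |w| ≤ (2 * K * V ^ 3 / g) ^ 3 * E :=
          mul_le_mul (pow_le_pow_left₀ (abs_nonneg w) hwabs 3) hw (Real.exp_pos _).le (by positivity)
      _ = _ := by ring
  have d1 : |w1 * w2 / g ^ 3| ≤ K ^ 3 * V ^ 9 / g ^ 3 := by
    rw [abs_div, abs_mul, abs_of_pos (by positivity : 0 < g ^ 3)]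
    refine div_le_div_of_nonneg_right ?_ (by positivity)
    calc |w1| * |w2| ≤ V ^ 2 * (K * V ^ 3) :=
          mul_le_mul hw1 hw2 (abs_nonneg _) (by positivity)
      _ = K * V ^ 5 := by ring
      _ ≤ K ^ 3 * V ^ 9 := mul_le_mul hK3 hV59 (by positivity) (by positivity)
  have d2 : |w2 ^ 2 / (2 * g ^ 4)| ≤ K ^ 3 * V ^ 9 / g ^ 3 := by
    rw [abs_div, abs_pow, abs_of_pos (by positivity : 0 < 2 * g ^ 4)]
    refine div_le_div₀ (by positivity) ?_ (by positivity) (by linarith [pow_pos hg0 4])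
    calc |w2| ^ 2 ≤ (K * V ^ 3) ^ 2 := pow_le_pow_left₀ (abs_nonneg _) hw2 2
      _ = K ^ 2 * V ^ 6 := by ring
      _ ≤ K ^ 3 * V ^ 9 := mul_le_mul hK23 hV69 (by positivity) (by positivity)
  have hterm2 : |w1 * w2 / g ^ 3 + w2 ^ 2 / (2 * g ^ 4)| ≤ 2 * K ^ 3 * V ^ 9 / g ^ 3 * E := by
    calc _ ≤ K ^ 3 * V ^ 9 / g ^ 3 + K ^ 3 * V ^ 9 / g ^ 3 :=
          (abs_add_le _ _).trans (add_le_add d1 d2)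
      _ = 2 * K ^ 3 * V ^ 9 / g ^ 3 * 1 := by ring
      _ ≤ _ := mul_le_mul_of_nonneg_left hE (by positivity)
  have e : Real.exp w - (1 + w1 / g + (w2 + w1 ^ 2 / 2) / g ^ 2) =
      (Real.exp w - (1 + w + w ^ 2 / 2)) + (w1 * w2 / g ^ 3 + w2 ^ 2 / (2 * g ^ 4)) := by
    rw [hwdef]; field_simp; ring
  rw [e]
  refine (abs_add_le _ _).trans ((add_le_add hterm1 hterm2).trans (le_of_eq ?_))
  ring

lemma abs_exp_mul_logExpansion_sub_charExpansion_le {s X g v : ℝ} (hs0 : 0 ≤ s) (hsX : s ≤ X)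
    (hg : 1 ≤ g) (hgX : 2 * Real.pi * X ≤ g) (hv0 : 0 ≤ v) (hv : v ≤ g) :
    |Real.exp (g * logExpansion (Real.pi * s / g) (v / g)) - charExpansion s g v| ≤
      (10 * (1 + Real.pi * X) ^ 3) * (1 + v) ^ 9 * Real.exp (-(v / 16)) / g ^ 3 := by
  have hpi := Real.pi_pos
  have hg0 : 0 < g := by linarith
  obtain ⟨c, hc⟩ : ∃ c, c = Real.pi * s := ⟨_, rfl⟩
  have hc0 : 0 ≤ c := by rw [hc]; positivity
  have hcX : c ≤ Real.pi * X := by rw [hc]; gcongr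
  have hcg : c ≤ g / 2 := by linarith
  have e0 : g * logExpansion (c / g) (v / g) =
      -v + (-(v ^ 2 / 4) / g + (c * v ^ 2 / 2 - v ^ 3 / 12) / g ^ 2) := by
    rw [logExpansion]; field_simp; ring
  have e1 : charExpansion s g v = Real.exp (-v) * (1 + -(v ^ 2 / 4) / g +
      ((c * v ^ 2 / 2 - v ^ 3 / 12) + (-(v ^ 2 / 4)) ^ 2 / 2) / g ^ 2) := by
    rw [charExpansion, ← hc]; field_simp; ring
  -- From `v ≤ g` and `c ≤ g / 2`, with `7/12 = 1/4 + 1/4 + 1/12`. Any coefficient up to `15/16`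
  -- would leave the decay `exp (-(v / 16))`.
  have hw7 : |-(v ^ 2 / 4) / g + (c * v ^ 2 / 2 - v ^ 3 / 12) / g ^ 2| ≤ 7 / 12 * v := by
    have a1 : v ^ 2 / g ≤ v := by rw [div_le_iff₀ hg0]; nlinarith
    have a1' : 0 ≤ v ^ 2 / g := by positivity
    have a2 : v ^ 3 / g ^ 2 ≤ v := by
      rw [div_le_iff₀ (by positivity)]
      calc v ^ 3 = v * v ^ 2 := by ring
        _ ≤ v * g ^ 2 := by gcongr
    have a2' : 0 ≤ v ^ 3 / g ^ 2 := by positivity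
    have a3 : c * v ^ 2 / g ^ 2 ≤ v / 2 := by
      rw [div_le_iff₀ (by positivity)]
      calc c * v ^ 2 ≤ g / 2 * (v * g) := by
            rw [sq]; gcongr
        _ = v / 2 * g ^ 2 := by ring
    have a3' : 0 ≤ c * v ^ 2 / g ^ 2 := by positivity
    have : -(v ^ 2 / 4) / g + (c * v ^ 2 / 2 - v ^ 3 / 12) / g ^ 2 =
        -(v ^ 2 / g / 4) + c * v ^ 2 / g ^ 2 / 2 - v ^ 3 / g ^ 2 / 12 := by ring
    rw [this, abs_le]
    constructor <;> linarith
  have hV : 1 ≤ 1 + v := by linarith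
  have hw2abs : |c * v ^ 2 / 2 - v ^ 3 / 12| ≤ (1 + Real.pi * X) * (1 + v) ^ 3 := by
    have b1 : v ^ 2 ≤ (1 + v) ^ 3 := by nlinarith [pow_nonneg hv0 3, pow_nonneg hv0 2]
    have b2 : v ^ 3 ≤ (1 + v) ^ 3 := pow_le_pow_left₀ hv0 (by linarith) 3
    have b3 : c * v ^ 2 ≤ (Real.pi * X) * (1 + v) ^ 3 :=
      mul_le_mul hcX b1 (by positivity) (hc0.trans hcX)
    have b3' : 0 ≤ c * v ^ 2 := by positivity
    have b4 : 0 ≤ v ^ 3 := by positivity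
    rw [abs_le, add_mul]
    constructor <;> linarith
  have hw1abs : |-(v ^ 2 / 4)| ≤ (1 + v) ^ 2 := by
    rw [abs_neg, abs_of_nonneg (by positivity)]
    nlinarith
  have hK1 : 1 ≤ 1 + Real.pi * X := by linarith
  have hmain := abs_exp_sub_second_order_le hK1 hg hV (Real.one_le_exp (by positivity)) hw1abs
    hw2abs (Real.exp_le_exp.2 hw7)
  have hX : 0 < 1 + Real.pi * X := by linarith
  rw [← hc, e0, e1, Real.exp_add, ← mul_sub, abs_mul, abs_of_pos (Real.exp_pos _)]
  have hle : Real.exp (-v + 7 / 12 * v) ≤ Real.exp (-(v / 16)) := Real.exp_le_exp.2 (by linarith)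
  calc _ ≤ Real.exp (-v) * (10 * (1 + Real.pi * X) ^ 3 * (1 + v) ^ 9 / g ^ 3 *
        Real.exp (7 / 12 * v)) := mul_le_mul_of_nonneg_left hmain (Real.exp_pos _).le
    _ = 10 * (1 + Real.pi * X) ^ 3 * (1 + v) ^ 9 / g ^ 3 * Real.exp (-v + 7 / 12 * v) := by
        rw [Real.exp_add]; ring
    _ ≤ 10 * (1 + Real.pi * X) ^ 3 * (1 + v) ^ 9 / g ^ 3 * Real.exp (-(v / 16)) :=
        mul_le_mul_of_nonneg_left hle (by positivity)
    _ = _ := by ring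

/-- From an expansion of the characteristic function of one star to that of `g` stars. -/
lemma norm_pow_sub_charExpansion_le {s X v C : ℝ} {g : ℕ} {φ : ℂ} (hs0 : 0 ≤ s) (hsX : s ≤ X)
    (hg : 1 ≤ g) (hgX : 2 * Real.pi * X ≤ g) (hv0 : 0 ≤ v) (hv : v ≤ g) (hC : 0 ≤ C)
    (hφ1 : ‖φ‖ ≤ Real.exp (-(v / g / 16)))
    (hφ2 : ‖φ - ((1 - v / g + (v / g) ^ 2 / 4 + Real.pi * s / g * (v / g) ^ 2 / 2 : ℝ) : ℂ)‖ ≤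
      C * ((v / g) ^ 2 / g ^ 2 + (v / g) ^ 3 / g + (v / g) ^ 4)) :
    ‖φ ^ g - (charExpansion s g v : ℂ)‖ ≤
      (6 * C + 1200 + 6 * (Real.pi * X) + 10 * (1 + Real.pi * X) ^ 3) *
        (1 + v) ^ 9 * Real.exp (-(v / 16)) / g ^ 3 := by
  have hpi := Real.pi_pos
  have hg1 : (1 : ℝ) ≤ g := by exact_mod_cast hg
  have hg0 : (0 : ℝ) < g := by linarith
  have hX0 : 0 ≤ X := hs0.trans hsX
  set T := v / g with hT
  set q := Real.pi * s / g with hq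
  have hT0 : 0 ≤ T := by positivity
  have hT1 : T ≤ 1 := by rw [hT, div_le_one hg0]; exact hv
  have hq0 : 0 ≤ q := by positivity
  have hqX : q ≤ Real.pi * X / g := by rw [hq]; gcongr
  have hq12 : q ≤ 1 / 2 := by
    refine hqX.trans ?_
    rw [div_le_iff₀ hg0]; linarith
  have hvT : v = g * T := by rw [hT]; field_simp
  have h1 := abs_exp_logExpansion_sub_le hq0 hq12 hT0 hT1
  have h2 : ‖φ - (Real.exp (logExpansion q T) : ℂ)‖ ≤
      (C + 200 + Real.pi * X) * (T ^ 2 / g ^ 2 + T ^ 3 / g + T ^ 4) := by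
    have e : φ - (Real.exp (logExpansion q T) : ℂ) =
        (φ - ((1 - T + T ^ 2 / 4 + q * T ^ 2 / 2 : ℝ) : ℂ)) -
        ((Real.exp (logExpansion q T) - (1 - T + T ^ 2 / 4 + q * T ^ 2 / 2) : ℝ) : ℂ) := by
      push_cast; ring
    rw [e]
    refine (norm_sub_le _ _).trans ?_
    rw [Complex.norm_real, Real.norm_eq_abs]
    have f1 : q * T ^ 3 ≤ Real.pi * X * (T ^ 3 / g) := by
      calc q * T ^ 3 ≤ Real.pi * X / g * T ^ 3 := by gcongr
        _ = _ := by ring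
    have f2 : 0 ≤ T ^ 2 / (g : ℝ) ^ 2 := by positivity
    have f3 : 0 ≤ T ^ 3 / (g : ℝ) := by positivity
    have f4 : 0 ≤ T ^ 4 := by positivity
    have f5 : 0 ≤ Real.pi * X := by positivity
    nlinarith [mul_nonneg f5 f2, mul_nonneg f5 f4]
  have hexpY : ‖(Real.exp (logExpansion q T) : ℂ)‖ ≤ Real.exp (-(T / 16)) := by
    rw [Complex.norm_real, Real.norm_of_nonneg (Real.exp_pos _).le]
    refine Real.exp_le_exp.2 ?_
    rw [logExpansion]
    have : q * T ^ 2 ≤ T := by nlinarith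
    nlinarith [pow_nonneg hT0 2, pow_nonneg hT0 3]
  have h3 := norm_pow_sub_pow_le hφ1 hexpY g
  -- The exponent `g - 1` loses one factor `exp (T / 16)`, which is at most `2` because `T ≤ 1`.
  have h4 : Real.exp (-(T / 16)) ^ (g - 1) ≤ 2 * Real.exp (-(v / 16)) := by
    rw [← Real.exp_nat_mul, Nat.cast_sub hg, Nat.cast_one]
    have : ((g : ℝ) - 1) * -(T / 16) = T / 16 + -(v / 16) := by rw [hvT]; ring
    rw [this, Real.exp_add]
    gcongr
    have h5 : Real.exp (T / 16) ≤ Real.exp (1 / 2) := Real.exp_le_exp.2 (by linarith)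
    have h6 : Real.exp (1 / 2) ^ 2 = Real.exp 1 := by rw [← Real.exp_nat_mul]; norm_num
    have h7 := Real.exp_one_lt_d9
    have h8 := Real.exp_pos (1 / 2)
    nlinarith
  have h5 : ‖φ ^ g - (Real.exp (g * logExpansion q T) : ℂ)‖ ≤
      (6 * C + 1200 + 6 * (Real.pi * X)) * (1 + v) ^ 9 * Real.exp (-(v / 16)) / g ^ 3 := by
    have e : (Real.exp (g * logExpansion q T) : ℂ) = (Real.exp (logExpansion q T) : ℂ) ^ g := by
      rw [← Complex.ofReal_pow, ← Real.exp_nat_mul]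
    rw [e]
    refine h3.trans ?_
    have hV : 1 ≤ 1 + v := by linarith
    -- This explains the form of the one-star error: multiplied by `g`, each of its three terms is a
    -- power of `v` over `g³`.
    have g1 : g * (T ^ 2 / g ^ 2 + T ^ 3 / g + T ^ 4) ≤ 3 * (1 + v) ^ 9 / g ^ 3 := by
      have e2 : g * (T ^ 2 / g ^ 2 + T ^ 3 / g + T ^ 4) = (v ^ 2 + v ^ 3 + v ^ 4) / g ^ 3 := by
        rw [hT]; field_simp
      rw [e2]
      gcongr
      have p2 : v ^ 2 ≤ (1 + v) ^ 9 := (pow_le_pow_left₀ hv0 (by linarith) 2).trans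
        (pow_le_pow_right₀ hV (by norm_num))
      have p3 : v ^ 3 ≤ (1 + v) ^ 9 := (pow_le_pow_left₀ hv0 (by linarith) 3).trans
        (pow_le_pow_right₀ hV (by norm_num))
      have p4 : v ^ 4 ≤ (1 + v) ^ 9 := (pow_le_pow_left₀ hv0 (by linarith) 4).trans
        (pow_le_pow_right₀ hV (by norm_num))
      linarith
    calc g * ‖φ - (Real.exp (logExpansion q T) : ℂ)‖ * Real.exp (-(T / 16)) ^ (g - 1)
        ≤ g * ((C + 200 + Real.pi * X) * (T ^ 2 / g ^ 2 + T ^ 3 / g + T ^ 4)) *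
          (2 * Real.exp (-(v / 16))) := by gcongr
      _ = (C + 200 + Real.pi * X) * (g * (T ^ 2 / g ^ 2 + T ^ 3 / g + T ^ 4)) *
          (2 * Real.exp (-(v / 16))) := by ring
      _ ≤ (C + 200 + Real.pi * X) * (3 * (1 + v) ^ 9 / g ^ 3) *
          (2 * Real.exp (-(v / 16))) := by gcongr
      _ = _ := by ring
  have h6 := abs_exp_mul_logExpansion_sub_charExpansion_le hs0 hsX hg1 hgX hv0 hv
  have e : φ ^ g - (charExpansion s g v : ℂ) = (φ ^ g - (Real.exp (g * logExpansion q T) : ℂ)) +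
      ((Real.exp (g * logExpansion q T) - charExpansion s g v : ℝ) : ℂ) := by push_cast; ring
  rw [e]
  refine (norm_add_le _ _).trans ?_
  rw [Complex.norm_real, Real.norm_eq_abs]
  refine (add_le_add h5 h6).trans (le_of_eq ?_)
  ring

/-! ### Inverse Fourier transform of the expansion -/

lemma one_add_pow_mul_exp_neg_le (n : ℕ) {c r : ℝ} (hc : 0 < c) (hr : 0 ≤ r) :
    (1 + r) ^ n * Real.exp (-(c * r)) ≤ n.factorial * Real.exp c / c ^ n := by
  have h := Real.pow_div_factorial_le_exp (x := c * (1 + r)) (by positivity) n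
  rw [div_le_iff₀ (by positivity), mul_pow, mul_add, mul_one, Real.exp_add] at h
  rw [le_div_iff₀ (by positivity)]
  have h2 : Real.exp (c * r) * Real.exp (-(c * r)) = 1 := by rw [← Real.exp_add]; simp
  calc (1 + r) ^ n * Real.exp (-(c * r)) * c ^ n = c ^ n * (1 + r) ^ n * Real.exp (-(c * r)) := by ring
    _ ≤ Real.exp c * Real.exp (c * r) * n.factorial * Real.exp (-(c * r)) :=
        mul_le_mul_of_nonneg_right h (Real.exp_pos _).le
    _ = n.factorial * Real.exp c * (Real.exp (c * r) * Real.exp (-(c * r))) := by ring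
    _ = _ := by rw [h2, mul_one]

lemma integrable_one_add_norm_pow_mul_exp (n : ℕ) {c : ℝ} (hc : 0 < c) :
    Integrable fun t : Plane => (1 + ‖t‖) ^ n * Real.exp (-(c * ‖t‖)) := by
  have h := (integrable_one_add_norm (E := Plane) (μ := volume) (r := 3)
    (by rw [finrank_euclideanSpace]; norm_num)).const_mul
    (((n + 3).factorial : ℝ) * Real.exp c / c ^ (n + 3))
  refine h.mono' (by fun_prop) (ae_of_all _ fun t => ?_)
  have hpos : 0 < 1 + ‖t‖ := by positivity
  rw [Real.norm_of_nonneg (by positivity), Real.rpow_neg hpos.le, ← div_eq_mul_inv,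
    le_div_iff₀ (by positivity)]
  refine le_trans (le_of_eq ?_) (one_add_pow_mul_exp_neg_le (n + 3) hc (norm_nonneg t))
  rw [show (3 : ℝ) = ((3 : ℕ) : ℝ) by norm_num, Real.rpow_natCast]
  ring

lemma tendsto_pow_mul_exp_neg_complex (n : ℕ) {w : ℂ} (hw : 0 < w.re) :
    Tendsto (fun r : ℝ => (r : ℂ) ^ n * Complex.exp (-(w * r))) atTop (𝓝 0) := by
  rw [tendsto_zero_iff_norm_tendsto_zero]
  have h := tendsto_rpow_mul_exp_neg_mul_atTop_nhds_zero n w.re hw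
  refine h.congr' ?_
  filter_upwards [eventually_ge_atTop 0] with r hr
  rw [norm_mul, norm_pow, Complex.norm_real, Real.norm_of_nonneg hr, Complex.norm_exp,
    Real.rpow_natCast]
  simp

lemma integrableOn_pow_mul_exp_neg_complex (n : ℕ) {w : ℂ} (hw : 0 < w.re) :
    IntegrableOn (fun r : ℝ => (r : ℂ) ^ n * Complex.exp (-(w * r))) (Set.Ioi 0) := by
  have h : IntegrableOn (fun r : ℝ => r ^ (n : ℝ) * Real.exp (-w.re * r)) (Set.Ioi 0) := by
    have := integrableOn_rpow_mul_exp_neg_mul_rpow (p := 1) (s := n) (b := w.re)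
      (by have : (0 : ℝ) ≤ n := n.cast_nonneg
          linarith) one_pos hw
    simpa using this
  refine h.mono' (by fun_prop) ?_
  filter_upwards [ae_restrict_mem measurableSet_Ioi] with r hr
  rw [norm_mul, norm_pow, Complex.norm_real, Real.norm_of_nonneg (le_of_lt hr), Complex.norm_exp,
    Real.rpow_natCast]
  simp

lemma integral_pow_mul_exp_neg_complex (n : ℕ) {w : ℂ} (hw : 0 < w.re) :
    ∫ r in Set.Ioi (0 : ℝ), (r : ℂ) ^ n * Complex.exp (-(w * r)) = n.factorial / w ^ (n + 1) := by
  have hw0 : w ≠ 0 := fun h => by simp [h] at hw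
  induction n with
  | zero =>
    have := integral_exp_mul_complex_Ioi (a := -w) (by simpa using hw) 0
    simpa [hw0, neg_mul] using this
  | succ n ih =>
    have hderiv : ∀ r ∈ Set.Ici (0 : ℝ), HasDerivAt
        (fun r : ℝ => -((r : ℂ) ^ (n + 1) * Complex.exp (-(w * r))) / w)
        ((r : ℂ) ^ (n + 1) * Complex.exp (-(w * r)) -
          (n + 1) / w * ((r : ℂ) ^ n * Complex.exp (-(w * r)))) r := by
      intro r _
      have e2 : HasDerivAt (fun u : ℝ => (u : ℂ)) 1 r := Complex.ofRealCLM.hasDerivAt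
      have e3 := ((e2.pow (n + 1)).mul ((e2.const_mul w).neg.cexp)).neg.div_const w
      refine e3.congr_deriv ?_
      simp only [Pi.neg_apply, Pi.pow_apply, Nat.add_one_sub_one, mul_one]
      push_cast
      field_simp
      ring
    have hint := (integrableOn_pow_mul_exp_neg_complex (n + 1) hw).sub
      ((integrableOn_pow_mul_exp_neg_complex n hw).const_mul ((n + 1) / w))
    have hlim : Tendsto (fun r : ℝ => -((r : ℂ) ^ (n + 1) * Complex.exp (-(w * r))) / w)
        atTop (𝓝 0) := by
      simpa using (tendsto_pow_mul_exp_neg_complex (n + 1) hw).neg.div_const w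
    have h := integral_Ioi_of_hasDerivAt_of_tendsto' hderiv hint hlim
    rw [integral_sub (integrableOn_pow_mul_exp_neg_complex (n + 1) hw)
      ((integrableOn_pow_mul_exp_neg_complex n hw).const_mul _), integral_const_mul, ih] at h
    simp only [Complex.ofReal_zero, ne_eq, Nat.add_eq_zero_iff, one_ne_zero, and_false,
      not_false_eq_true, zero_pow, zero_mul, neg_zero, zero_div, sub_zero] at h
    rw [sub_eq_zero.1 h, Nat.factorial_succ]
    push_cast
    field_simp
    ring

/-- The integrals `∫ (k + i G cos θ)^{-n} dθ` over a period. -/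
def cosIntegral (k G : ℝ) (n : ℕ) : ℂ :=
  ∫ θ in (-Real.pi)..Real.pi, (((k : ℂ) + Complex.I * G * Real.cos θ) ^ n)⁻¹

lemma add_I_mul_ne_zero {k : ℝ} (hk : 0 < k) (y : ℝ) : (k : ℂ) + Complex.I * y ≠ 0 := fun h => by
  have := congrArg Complex.re h
  simp at this
  exact hk.ne' this

lemma cosIntegral_denom_ne_zero {k : ℝ} (hk : 0 < k) (G θ : ℝ) :
    (k : ℂ) + Complex.I * G * Real.cos θ ≠ 0 := by
  have := add_I_mul_ne_zero hk (G * Real.cos θ)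
  rwa [Complex.ofReal_mul, ← mul_assoc] at this

lemma continuous_cosIntegrand {k : ℝ} (hk : 0 < k) (G : ℝ) (n : ℕ) :
    Continuous fun θ : ℝ => (((k : ℂ) + Complex.I * G * Real.cos θ) ^ n)⁻¹ := by
  refine Continuous.inv₀ ?_ fun θ => pow_ne_zero _ (cosIntegral_denom_ne_zero hk G θ)
  have : Continuous fun θ : ℝ => ((Real.cos θ : ℝ) : ℂ) :=
    Complex.continuous_ofReal.comp Real.continuous_cos
  fun_prop

/-- The function `i G sin θ / (k + i G cos θ)^(n+1)` takes equal values at the ends of the period,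
so its derivative integrates to zero. For `n = 0` the term in `cosIntegral k G 0` drops out, and
`cosIntegral k G 1` determines all higher orders. -/
lemma cosIntegral_recurrence {k : ℝ} (hk : 0 < k) (G : ℝ) (n : ℕ) :
    (n + 1) * ((k ^ 2 + G ^ 2 : ℝ) : ℂ) * cosIntegral k G (n + 2) =
      (2 * n + 1) * k * cosIntegral k G (n + 1) - n * cosIntegral k G n := by
  have hd : ∀ θ ∈ Set.uIcc (-Real.pi) Real.pi, HasDerivAt
      (fun θ : ℝ => Complex.I * G * Real.sin θ *
        (((k : ℂ) + Complex.I * G * Real.cos θ) ^ (n + 1))⁻¹)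
      (-n * (((k : ℂ) + Complex.I * G * Real.cos θ) ^ n)⁻¹ +
        (2 * n + 1) * k * (((k : ℂ) + Complex.I * G * Real.cos θ) ^ (n + 1))⁻¹ -
        (n + 1) * ((k ^ 2 + G ^ 2 : ℝ) : ℂ) *
          (((k : ℂ) + Complex.I * G * Real.cos θ) ^ (n + 2))⁻¹) θ := by
    intro θ _
    have h0 := cosIntegral_denom_ne_zero hk G θ
    have e1 := (Real.hasDerivAt_sin θ).ofReal_comp
    have e2 := (Real.hasDerivAt_cos θ).ofReal_comp
    have e3 : HasDerivAt (fun θ : ℝ => ((k : ℂ) + Complex.I * G * Real.cos θ) ^ (n + 1))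
        (((n + 1 : ℕ) : ℂ) * ((k : ℂ) + Complex.I * G * Real.cos θ) ^ n *
          (Complex.I * G * ((-Real.sin θ : ℝ) : ℂ))) θ :=
      ((e2.const_mul (Complex.I * (G : ℂ))).const_add (k : ℂ)).fun_pow (n + 1)
    have e4 := (e1.const_mul (Complex.I * (G : ℂ))).mul (e3.fun_inv (pow_ne_zero _ h0))
    refine e4.congr_deriv ?_
    have hsc : ((Real.sin θ : ℝ) : ℂ) ^ 2 = 1 - ((Real.cos θ : ℝ) : ℂ) ^ 2 := by
      rw [← Complex.ofReal_pow, Real.sin_sq, Complex.ofReal_sub, Complex.ofReal_pow,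
        Complex.ofReal_one]
    have hI : Complex.I ^ 2 = -1 := Complex.I_sq
    rw [Complex.ofReal_neg]
    generalize ((Real.sin θ : ℝ) : ℂ) = S at *
    generalize ((Real.cos θ : ℝ) : ℂ) = c at *
    obtain ⟨d, hdd⟩ : ∃ d, d = (k : ℂ) + Complex.I * G * c := ⟨_, rfl⟩
    rw [← hdd] at h0 ⊢
    have hc : Complex.I * G * c = d - k := by rw [hdd]; ring
    have hS : (Complex.I * G * S) * (Complex.I * G * S) = -(G : ℂ) ^ 2 - (d - k) ^ 2 := by
      rw [← hc]; linear_combination (Complex.I ^ 2 * G ^ 2) * hsc + (G : ℂ) ^ 2 * hI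
    rw [hc, show Complex.I * (G : ℂ) * S * (-(((n + 1 : ℕ) : ℂ) * d ^ n *
      (Complex.I * G * -S)) / (d ^ (n + 1)) ^ 2) = ((Complex.I * G * S) * (Complex.I * G * S)) *
        ((n + 1 : ℕ) * d ^ n / (d ^ (n + 1)) ^ 2) by ring, hS]
    push_cast
    field_simp
    ring
  have hc := continuous_cosIntegrand hk G
  have h := intervalIntegral.integral_eq_sub_of_hasDerivAt hd
    (Continuous.intervalIntegrable (by
      have := hc n; have := hc (n + 1); have := hc (n + 2); fun_prop) _ _)
  rw [intervalIntegral.integral_sub (Continuous.intervalIntegrable (by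
      have := hc n; have := hc (n + 1); fun_prop) _ _) (Continuous.intervalIntegrable (by
      have := hc (n + 2); fun_prop) _ _), intervalIntegral.integral_add
      (Continuous.intervalIntegrable (by have := hc n; fun_prop) _ _)
      (Continuous.intervalIntegrable (by have := hc (n + 1); fun_prop) _ _),
      intervalIntegral.integral_const_mul, intervalIntegral.integral_const_mul,
      intervalIntegral.integral_const_mul] at h
  change -n * cosIntegral k G n + (2 * n + 1) * k * cosIntegral k G (n + 1) -
    (n + 1) * ((k ^ 2 + G ^ 2 : ℝ) : ℂ) * cosIntegral k G (n + 2) = _ at h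
  simp only [Real.sin_neg, Real.sin_pi, neg_zero, Complex.ofReal_zero, mul_zero, zero_mul,
    sub_zero] at h
  linear_combination -h

lemma integral_inv_one_sub_mul_circleMap {q : ℂ} (hq : ‖q‖ < 1) :
    ∫ θ in (0 : ℝ)..2 * Real.pi, (1 - q * Complex.exp (θ * Complex.I))⁻¹ = 2 * Real.pi := by
  have hne : ∀ z : ℂ, ‖z‖ ≤ 1 → 1 - q * z ≠ 0 := by
    intro z hz h
    have h1 : ‖q * z‖ = 1 := by rw [← sub_eq_zero.1 h, norm_one]
    rw [norm_mul] at h1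
    nlinarith [norm_nonneg z, norm_nonneg q]
  have hd : DiffContOnCl ℂ (fun z : ℂ => (1 - q * z)⁻¹) (Metric.ball 0 |1|) := by
    refine DifferentiableOn.diffContOnCl ?_
    intro z hz
    have hz' : ‖z‖ ≤ 1 := by simpa using Metric.closure_ball_subset_closedBall hz
    have : DifferentiableAt ℂ (fun z : ℂ => 1 - q * z) z := by fun_prop
    exact (this.inv (hne z hz')).differentiableWithinAt
  have h := hd.circleAverage
  rw [Real.circleAverage_def] at h
  simp only [circleMap, zero_add, Complex.ofReal_one, one_mul, mul_zero, sub_zero, inv_one] at h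
  have hpi : (2 * Real.pi : ℂ) ≠ 0 := by
    simp
  rw [Complex.real_smul] at h
  push_cast at h
  field_simp at h
  simpa [one_div] using h

/-- With `z = exp (iθ)`, `σ = √(k² + G²)` and `q = -iG/(σ + k)`, partial fractions write the
integrand as `((1 - qz)⁻¹ + (1 - q/z)⁻¹ - 1)/σ`. Since `|q| < 1`, the mean value property gives each
reciprocal mean `1`. -/
lemma cosIntegral_one {k : ℝ} (hk : 0 < k) (G : ℝ) :
    cosIntegral k G 1 = 2 * Real.pi / (Real.sqrt (k ^ 2 + G ^ 2) : ℝ) := by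
  set σ := Real.sqrt (k ^ 2 + G ^ 2) with hσ
  have hσ2 : σ ^ 2 = k ^ 2 + G ^ 2 := Real.sq_sqrt (by positivity)
  have hσ0 : 0 < σ := Real.sqrt_pos.2 (by positivity)
  have hσk : k ≤ σ := by nlinarith [sq_nonneg G]
  set q : ℂ := -Complex.I * (G / (σ + k) : ℝ) with hq
  have hsk : 0 < σ + k := by positivity
  have hqn : ‖q‖ < 1 := by
    rw [hq, norm_mul, norm_neg, Complex.norm_I, one_mul, Complex.norm_real, Real.norm_eq_abs,
      abs_div, abs_of_pos hsk, div_lt_one hsk]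
    exact abs_lt_of_sq_lt_sq (by nlinarith) hsk.le
  have h1 := integral_inv_one_sub_mul_circleMap hqn
  have hne : ∀ z : ℂ, ‖z‖ = 1 → 1 - q * z ≠ 0 := by
    intro z hz h
    have h1 : ‖q * z‖ = 1 := by rw [← sub_eq_zero.1 h, norm_one]
    rw [norm_mul, hz] at h1
    linarith
  have hne1 : ∀ θ : ℝ, 1 - q * Complex.exp (θ * Complex.I) ≠ 0 := fun θ =>
    hne _ (Complex.norm_exp_ofReal_mul_I θ)
  set f : ℝ → ℂ := fun θ => (1 - q * Complex.exp (θ * Complex.I))⁻¹ with hf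
  have hfc : Continuous f := by
    refine Continuous.inv₀ (by fun_prop) hne1
  have hfp : Function.Periodic f (2 * Real.pi) := fun θ => by
    simp only [hf]
    congr 3
    push_cast
    rw [add_mul, Complex.exp_add, Complex.exp_two_pi_mul_I, mul_one]
  have h2 : ∫ θ in (-Real.pi)..Real.pi, f θ = 2 * Real.pi := by
    have := hfp.intervalIntegral_add_eq (-Real.pi) 0
    rw [show -Real.pi + 2 * Real.pi = Real.pi by ring, zero_add] at this
    rw [this, h1]
  have h3 : ∫ θ in (-Real.pi)..Real.pi, f (-θ) = 2 * Real.pi := by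
    rw [intervalIntegral.integral_comp_neg, neg_neg, h2]
  have hpt : ∀ θ : ℝ, (((k : ℂ) + Complex.I * G * Real.cos θ) ^ 1)⁻¹ =
      (f θ + f (-θ) - 1) / σ := by
    intro θ
    have h0 := cosIntegral_denom_ne_zero hk G θ
    have ha := hne1 θ
    have hb := hne1 (-θ)
    simp only [hf]
    set z := Complex.exp (θ * Complex.I) with hz
    have hz' : Complex.exp ((-θ : ℝ) * Complex.I) = z⁻¹ := by
      rw [hz, ← Complex.exp_neg]; congr 1; push_cast; ring
    have hz0 : z ≠ 0 := Complex.exp_ne_zero _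
    rw [hz'] at hb ⊢
    have hcos : (Real.cos θ : ℂ) = (z + z⁻¹) / 2 := by
      rw [Complex.ofReal_cos, Complex.cos, hz, ← Complex.exp_neg]; ring_nf
    rw [hcos] at h0 ⊢
    have hσ0' : (σ : ℂ) ≠ 0 := by exact_mod_cast hσ0.ne'
    have hsk' : (σ : ℂ) + k ≠ 0 := by exact_mod_cast hsk.ne'
    have hσ2' : (σ : ℂ) ^ 2 = k ^ 2 + G ^ 2 := by exact_mod_cast hσ2
    have hnum : (1 - q * z)⁻¹ + (1 - q * z⁻¹)⁻¹ - 1 =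
        (1 - q ^ 2) / ((1 - q * z) * (1 - q * z⁻¹)) := by
      rw [eq_div_iff (mul_ne_zero ha hb)]
      have hzz : z * z⁻¹ = 1 := mul_inv_cancel₀ hz0
      have ha' := mul_inv_cancel₀ ha
      have hb' := mul_inv_cancel₀ hb
      linear_combination (1 - q * z⁻¹) * ha' + (1 - q * z) * hb' - q ^ 2 * hzz
    have hden : ((k : ℂ) + Complex.I * G * ((z + z⁻¹) / 2)) * (1 - q ^ 2) =
        σ * ((1 - q * z) * (1 - q * z⁻¹)) := by
      have e1 : (1 - q * z) * (1 - q * z⁻¹) = 1 + q ^ 2 - q * (z + z⁻¹) := by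
        field_simp; ring
      have e2 : q * (σ + k) = -Complex.I * G := by
        rw [hq]; push_cast; field_simp
      have e3 : q ^ 2 * (σ + k) = k - σ := by
        have : q ^ 2 * (σ + k) ^ 2 = (k - σ) * (σ + k) := by
          rw [← mul_pow, e2, mul_pow, neg_sq, Complex.I_sq]; linear_combination hσ2'
        have h5 : (q ^ 2 * (σ + k) - (k - σ)) * (σ + k) = 0 := by linear_combination this
        rcases mul_eq_zero.1 h5 with h | h
        · linear_combination h
        · exact absurd h hsk'
      rw [e1]
      apply mul_left_cancel₀ hsk'
      linear_combination
        (-(k + Complex.I * G * ((z + z⁻¹) / 2)) - σ) * e3 + σ * (z + z⁻¹) * e2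
    rw [hnum, pow_one, inv_eq_one_div, div_div, div_eq_div_iff h0 (by
      exact mul_ne_zero (mul_ne_zero ha hb) hσ0')]
    linear_combination -hden
  unfold cosIntegral
  simp_rw [hpt]
  rw [intervalIntegral.integral_div, intervalIntegral.integral_sub, intervalIntegral.integral_add,
    h2, h3, intervalIntegral.integral_const]
  · rw [Complex.real_smul]; push_cast; ring
  · exact hfc.intervalIntegrable _ _
  · exact (hfc.comp continuous_neg).intervalIntegrable _ _
  · exact (hfc.add (hfc.comp continuous_neg)).intervalIntegrable _ _
  · simp

lemma cosIntegrand_periodic (k G : ℝ) (n : ℕ) :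
    Function.Periodic (fun θ : ℝ => (((k : ℂ) + Complex.I * G * Real.cos θ) ^ n)⁻¹)
      (2 * Real.pi) := fun θ => by
  simp only [Real.cos_add_two_pi]

lemma integrable_pow_norm_mul_exp_mul_cexp {k : ℝ} (hk : 0 < k) (j : ℕ) (p : Plane) :
    Integrable fun t : Plane => ((‖t‖ ^ j * Real.exp (-(k * ‖t‖)) : ℝ) : ℂ) *
      Complex.exp (-(inner ℝ t p : ℝ) * Complex.I) := by
  refine (integrable_one_add_norm_pow_mul_exp j hk).mono' (by fun_prop) (ae_of_all _ fun t => ?_)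
  rw [norm_mul, ← Complex.ofReal_neg, Complex.norm_exp_ofReal_mul_I, mul_one, Complex.norm_real,
    Real.norm_of_nonneg (by positivity)]
  gcongr
  linarith

/-- Along a fixed ray the radial integral is a Gamma integral with complex rate `k + i ‖p‖ cos`, the
cosine being that of the angle to `p`. -/
lemma integral_pow_norm_mul_exp_mul_cexp {k : ℝ} (hk : 0 < k) (j : ℕ) (p : Plane) :
    ∫ t : Plane, ((‖t‖ ^ j * Real.exp (-(k * ‖t‖)) : ℝ) : ℂ) *
      Complex.exp (-(inner ℝ t p : ℝ) * Complex.I) =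
      (j + 1).factorial * cosIntegral k ‖p‖ (j + 2) := by
  obtain ⟨β, hβ⟩ := exists_eq_norm_smul_dirVec p
  set G := ‖p‖ with hG
  rw [(integral_eq_polar (by fun_prop) (integrable_pow_norm_mul_exp_mul_cexp hk j p)).2]
  have hin : ∀ θ : ℝ, (∫ r in Set.Ioi (0 : ℝ), (r : ℂ) *
      (((‖r • dirVec θ‖ ^ j * Real.exp (-(k * ‖r • dirVec θ‖)) : ℝ) : ℂ) *
        Complex.exp (-(inner ℝ (r • dirVec θ) p : ℝ) * Complex.I))) =
      (j + 1).factorial * (((k : ℂ) + Complex.I * G * Real.cos (θ + -β)) ^ (j + 2))⁻¹ := by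
    intro θ
    have hre : 0 < ((k : ℂ) + Complex.I * G * Real.cos (θ + -β)).re := by
      simpa [← Complex.ofReal_cos, ← Complex.ofReal_neg, ← Complex.ofReal_add,
        -Complex.ofReal_cos, mul_assoc] using hk
    rw [← div_eq_mul_inv, ← integral_pow_mul_exp_neg_complex (j + 1) hre]
    refine setIntegral_congr_fun measurableSet_Ioi fun r hr => ?_
    have hr0 : 0 < r := hr
    have hinner : inner ℝ (r • dirVec θ) p = r * (G * Real.cos (θ + -β)) := by
      rw [hβ, inner_smul_left, inner_smul_right, Plane.inner_eq, Real.cos_add, Real.cos_neg,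
        Real.sin_neg]
      simp
    simp only [norm_smul, norm_dirVec, mul_one, Real.norm_of_nonneg hr0.le, hinner]
    rw [Complex.ofReal_mul, Complex.ofReal_exp, mul_assoc, ← Complex.exp_add, ← mul_assoc,
      Complex.ofReal_pow, ← pow_succ']
    congr 2
    push_cast
    ring
  simp_rw [hin]
  rw [← integral_Ioc_eq_integral_Ioo, ← intervalIntegral.integral_of_le (by linarith [Real.pi_pos]),
    intervalIntegral.integral_const_mul,
    integral_add_eq_of_periodic (cosIntegrand_periodic k G (j + 2)) (-β)]
  rfl

lemma integrable_charExpansion {k : ℝ} (hk : 0 < k) (s g : ℝ) (p : Plane) :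
    Integrable fun t : Plane => (charExpansion s g (k * ‖t‖) : ℂ) *
      Complex.exp (-(inner ℝ t p : ℝ) * Complex.I) := by
  have h := fun j => integrable_pow_norm_mul_exp_mul_cexp hk j p
  refine (((h 0).add ((h 2).const_mul ((-(k ^ 2 / (4 * g)) + Real.pi * s * k ^ 2 / 2 / g ^ 2 : ℝ) : ℂ))).add
    (((h 3).const_mul ((-(k ^ 3 / 12 / g ^ 2) : ℝ) : ℂ)).add
      ((h 4).const_mul ((k ^ 4 / 32 / g ^ 2 : ℝ) : ℂ)))).congr (ae_of_all _ fun t => ?_)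
  simp only [Pi.add_apply, charExpansion]
  push_cast
  ring

/-- The expansion is a combination of `‖t‖^j exp (-k‖t‖)` with `j = 0, 2, 3, 4`, whose transforms
are cosine integrals of orders `2, 4, 5, 6`; the recurrence evaluates these and the result is
collected into `H₁` and `H₂`. -/
lemma integral_charExpansion {m g : ℝ} (hm : 0 < m) (s : ℝ) (p : Plane) :
    (4 * Real.pi ^ 2 : ℂ)⁻¹ * ∫ t : Plane, (charExpansion s g (kappaStar m * ‖t‖) : ℂ) *
      Complex.exp (-(inner ℝ t p : ℝ) * Complex.I) =
      (kappaStar m / (2 * Real.pi) * (((kappaStar m ^ 2 + ‖p‖ ^ 2) ^ (3 / 2 : ℝ))⁻¹ *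
        (1 + H₁ m ‖p‖ / g + H₂ m ‖p‖ s / g ^ 2)) : ℝ) := by
  have hsm : kappaStar m * s / m = Real.pi * s := by rw [kappaStar]; field_simp
  unfold H₁ H₂
  rw [hsm]
  have hk : 0 < kappaStar m := mul_pos Real.pi_pos hm
  generalize kappaStar m = k at *
  have h := fun j => integrable_pow_norm_mul_exp_mul_cexp hk j p
  have hM := fun j => integral_pow_norm_mul_exp_mul_cexp hk j p
  have hexp : ∫ t : Plane, (charExpansion s g (k * ‖t‖) : ℂ) *
      Complex.exp (-(inner ℝ t p : ℝ) * Complex.I) =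
      cosIntegral k ‖p‖ 2 + ((-(k ^ 2 / (4 * g)) + Real.pi * s * k ^ 2 / 2 / g ^ 2 : ℝ) : ℂ) *
        (6 * cosIntegral k ‖p‖ 4) + (((-(k ^ 3 / 12 / g ^ 2) : ℝ) : ℂ) *
        (24 * cosIntegral k ‖p‖ 5) + ((k ^ 4 / 32 / g ^ 2 : ℝ) : ℂ) *
        (120 * cosIntegral k ‖p‖ 6)) := by
    have e : ∀ t : Plane, (charExpansion s g (k * ‖t‖) : ℂ) *
        Complex.exp (-(inner ℝ t p : ℝ) * Complex.I) =
        (((‖t‖ ^ 0 * Real.exp (-(k * ‖t‖)) : ℝ) : ℂ) *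
          Complex.exp (-(inner ℝ t p : ℝ) * Complex.I) +
        ((-(k ^ 2 / (4 * g)) + Real.pi * s * k ^ 2 / 2 / g ^ 2 : ℝ) : ℂ) *
          (((‖t‖ ^ 2 * Real.exp (-(k * ‖t‖)) : ℝ) : ℂ) *
          Complex.exp (-(inner ℝ t p : ℝ) * Complex.I))) +
        (((-(k ^ 3 / 12 / g ^ 2) : ℝ) : ℂ) * (((‖t‖ ^ 3 * Real.exp (-(k * ‖t‖)) : ℝ) : ℂ) *
          Complex.exp (-(inner ℝ t p : ℝ) * Complex.I)) +
        ((k ^ 4 / 32 / g ^ 2 : ℝ) : ℂ) * (((‖t‖ ^ 4 * Real.exp (-(k * ‖t‖)) : ℝ) : ℂ) *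
          Complex.exp (-(inner ℝ t p : ℝ) * Complex.I))) := by
      intro t
      simp only [charExpansion]
      push_cast
      ring
    simp_rw [e]
    rw [integral_add, integral_add, integral_add, integral_const_mul, integral_const_mul,
      integral_const_mul, hM, hM, hM, hM]
    · norm_num [Nat.factorial]
    · exact (h 3).const_mul _
    · exact (h 4).const_mul _
    · exact h 0
    · exact (h 2).const_mul _
    · exact (h 0).add ((h 2).const_mul _)
    · exact ((h 3).const_mul _).add ((h 4).const_mul _)
  rw [hexp]
  have r := cosIntegral_recurrence hk ‖p‖
  have r0 := r 0
  have r1 := r 1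
  have r2 := r 2
  have r3 := r 3
  have r4 := r 4
  have j1 := cosIntegral_one hk ‖p‖
  generalize ‖p‖ = G at *
  have hB0 : 0 < k ^ 2 + G ^ 2 := by positivity
  have h32 : (k ^ 2 + G ^ 2) ^ (3 / 2 : ℝ) = (k ^ 2 + G ^ 2) * Real.sqrt (k ^ 2 + G ^ 2) := by
    rw [Real.sqrt_eq_rpow, show (3 / 2 : ℝ) = 1 + 1 / 2 by norm_num, Real.rpow_add hB0,
      Real.rpow_one]
  rw [h32]
  have hσ0 : 0 < Real.sqrt (k ^ 2 + G ^ 2) := Real.sqrt_pos.2 hB0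
  generalize Real.sqrt (k ^ 2 + G ^ 2) = σ at *
  obtain ⟨B, hB⟩ : ∃ B, B = k ^ 2 + G ^ 2 := ⟨_, rfl⟩
  rw [← hB] at r0 r1 r2 r3 r4 hB0 ⊢
  have hBc : (B : ℂ) ≠ 0 := by exact_mod_cast hB0.ne'
  have hσc : (σ : ℂ) ≠ 0 := by exact_mod_cast hσ0.ne'
  have hG : (G : ℝ) ^ 2 = B - k ^ 2 := by rw [hB]; ring
  have hG4 : (G : ℝ) ^ 4 = (B - k ^ 2) ^ 2 := by rw [← hG]; ring
  rw [hG, hG4]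
  norm_num at r0 r1 r2 r3 r4
  rw [j1] at r0 r1
  have q2 : cosIntegral k G 2 = 2 * Real.pi * k / (σ * B) := by
    rw [eq_div_iff (mul_ne_zero hσc hBc)]; field_simp at r0; linear_combination r0
  have q3 : cosIntegral k G 3 = 2 * Real.pi * (3 * k ^ 2 - B) / (2 * σ * B ^ 2) := by
    rw [q2] at r1
    refine mul_left_cancel₀ (mul_ne_zero two_ne_zero hBc) ?_
    field_simp at r1 ⊢
    linear_combination r1
  have q4 : cosIntegral k G 4 = 2 * Real.pi * (5 * k ^ 3 - 3 * k * B) / (2 * σ * B ^ 3) := by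
    rw [q2, q3] at r2
    refine mul_left_cancel₀ (mul_ne_zero three_ne_zero hBc) ?_
    field_simp at r2 ⊢
    linear_combination r2 / 3
  have q5 : cosIntegral k G 5 =
      2 * Real.pi * (35 * k ^ 4 - 30 * k ^ 2 * B + 3 * B ^ 2) / (8 * σ * B ^ 4) := by
    rw [q3, q4] at r3
    refine mul_left_cancel₀ (mul_ne_zero (by norm_num : (4 : ℂ) ≠ 0) hBc) ?_
    field_simp at r3 ⊢
    linear_combination 2 * r3
  have q6 : cosIntegral k G 6 =
      2 * Real.pi * (63 * k ^ 5 - 70 * k ^ 3 * B + 15 * k * B ^ 2) / (8 * σ * B ^ 5) := by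
    rw [q4, q5] at r4
    refine mul_left_cancel₀ (mul_ne_zero (by norm_num : (5 : ℂ) ≠ 0) hBc) ?_
    field_simp at r4 ⊢
    linear_combination r4 / 5
  rw [q2, q4, q5, q6]
  have hpi : (Real.pi : ℂ) ≠ 0 := by exact_mod_cast Real.pi_ne_zero
  -- The identity is polynomial in the reciprocal of `g`, so `g = 0` needs no separate treatment.
  obtain ⟨w, hw⟩ : ∃ w : ℂ, w = (g : ℂ)⁻¹ := ⟨_, rfl⟩
  push_cast
  simp only [div_eq_mul_inv, mul_inv, ← hw]
  field_simp
  ring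

/-! ### Gaussian smoothing -/

/-- The centred isotropic Gaussian density of standard deviation `ε` on the plane. -/
def gaussianKernel (ε : ℝ) (z : Plane) : ℝ :=
  (2 * Real.pi * ε ^ 2)⁻¹ * Real.exp (-(2 * ε ^ 2)⁻¹ * ‖z‖ ^ 2)

lemma integral_exp_neg_mul_sq_norm {b : ℝ} (hb : 0 < b) :
    ∫ z : Plane, Real.exp (-b * ‖z‖ ^ 2) = Real.pi / b := by
  rw [GaussianFourier.integral_rexp_neg_mul_sq_norm hb, finrank_euclideanSpace]
  simp

lemma integrable_exp_neg_mul_sq_norm {b : ℝ} (hb : 0 < b) :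
    Integrable fun z : Plane => Real.exp (-b * ‖z‖ ^ 2) := by
  refine Integrable.of_integral_ne_zero ?_
  rw [integral_exp_neg_mul_sq_norm hb]
  exact (div_pos Real.pi_pos hb).ne'

lemma continuous_gaussianKernel (ε : ℝ) : Continuous (gaussianKernel ε) := by
  unfold gaussianKernel; fun_prop

lemma gaussianKernel_nonneg (ε : ℝ) (z : Plane) : 0 ≤ gaussianKernel ε z := by
  have := Real.pi_pos
  unfold gaussianKernel; positivity

lemma gaussianKernel_le (ε : ℝ) (z : Plane) : gaussianKernel ε z ≤ (2 * Real.pi * ε ^ 2)⁻¹ := by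
  have := Real.pi_pos
  refine mul_le_of_le_one_right (by positivity) (Real.exp_le_one_iff.2 ?_)
  have : 0 ≤ (2 * ε ^ 2)⁻¹ * ‖z‖ ^ 2 := by positivity
  linarith

lemma integrable_gaussianKernel {ε : ℝ} (hε : 0 < ε) : Integrable (gaussianKernel ε) :=
  (integrable_exp_neg_mul_sq_norm (by positivity)).const_mul _

lemma integral_gaussianKernel {ε : ℝ} (hε : 0 < ε) : ∫ z, gaussianKernel ε z = 1 := by
  have := Real.pi_pos
  simp only [gaussianKernel]
  rw [integral_const_mul, integral_exp_neg_mul_sq_norm (by positivity)]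
  field_simp

/-- Half of the exponent absorbs the factor `‖z‖ / ε`, through `y exp (-y²/4) ≤ 1`, and the other
half stays integrable. -/
lemma norm_mul_gaussianKernel_le {ε : ℝ} (hε : 0 < ε) (z : Plane) :
    ‖z‖ * gaussianKernel ε z ≤
      ε * ((2 * Real.pi * ε ^ 2)⁻¹ * Real.exp (-(4 * ε ^ 2)⁻¹ * ‖z‖ ^ 2)) := by
  have hpi := Real.pi_pos
  set y := ‖z‖ / ε with hy
  have hz : ‖z‖ = ε * y := by rw [hy]; field_simp
  have e1 : Real.exp (-(2 * ε ^ 2)⁻¹ * ‖z‖ ^ 2) =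
      Real.exp (-(4 * ε ^ 2)⁻¹ * ‖z‖ ^ 2) * Real.exp (-(y ^ 2 / 4)) := by
    rw [← Real.exp_add, hz]; congr 1; field_simp; ring
  have e2 : y * Real.exp (-(y ^ 2 / 4)) ≤ 1 := by
    rw [Real.exp_neg, ← div_eq_mul_inv, div_le_one (Real.exp_pos _)]
    have := Real.add_one_le_exp (y ^ 2 / 4)
    nlinarith [sq_nonneg (y / 2 - 1)]
  unfold gaussianKernel
  rw [e1]
  calc ‖z‖ * ((2 * Real.pi * ε ^ 2)⁻¹ *
        (Real.exp (-(4 * ε ^ 2)⁻¹ * ‖z‖ ^ 2) * Real.exp (-(y ^ 2 / 4))))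
      = ε * ((2 * Real.pi * ε ^ 2)⁻¹ * Real.exp (-(4 * ε ^ 2)⁻¹ * ‖z‖ ^ 2)) *
          (y * Real.exp (-(y ^ 2 / 4))) := by nth_rewrite 1 [hz]; ring
    _ ≤ _ := mul_le_of_le_one_right (by positivity) e2

lemma integrable_norm_mul_gaussianKernel {ε : ℝ} (hε : 0 < ε) :
    Integrable fun z : Plane => ‖z‖ * gaussianKernel ε z := by
  refine (((integrable_exp_neg_mul_sq_norm (b := (4 * ε ^ 2)⁻¹) (by positivity)).const_mul
    (2 * Real.pi * ε ^ 2)⁻¹).const_mul ε).mono'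
    (continuous_norm.mul (continuous_gaussianKernel ε)).aestronglyMeasurable
    (ae_of_all _ fun z => ?_)
  rw [Real.norm_of_nonneg (mul_nonneg (norm_nonneg z) (gaussianKernel_nonneg ε z))]
  exact norm_mul_gaussianKernel_le hε z

lemma integral_norm_mul_gaussianKernel_le {ε : ℝ} (hε : 0 < ε) :
    ∫ z : Plane, ‖z‖ * gaussianKernel ε z ≤ 2 * ε := by
  have hpi := Real.pi_pos
  refine (integral_mono (integrable_norm_mul_gaussianKernel hε)
    (((integrable_exp_neg_mul_sq_norm (b := (4 * ε ^ 2)⁻¹) (by positivity)).const_mul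
    (2 * Real.pi * ε ^ 2)⁻¹).const_mul ε) (norm_mul_gaussianKernel_le hε)).trans (le_of_eq ?_)
  rw [integral_const_mul, integral_const_mul, integral_exp_neg_mul_sq_norm (by positivity)]
  field_simp
  ring

lemma integrable_cexp_neg_mul_sq_norm_mul {ε : ℝ} (hε : 0 < ε) (z : Plane) :
    Integrable fun t : Plane => Complex.exp (-(ε ^ 2 / 2 : ℝ) * ‖t‖ ^ 2) *
      Complex.exp (-(inner ℝ t z : ℝ) * Complex.I) := by
  have hb : 0 < ((ε ^ 2 / 2 : ℝ) : ℂ).re := by rw [Complex.ofReal_re]; positivity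
  refine (GaussianFourier.integrable_cexp_neg_mul_sq_norm_add hb (-Complex.I) z).congr
    (ae_of_all _ fun t => ?_)
  dsimp only
  rw [Complex.exp_add, real_inner_comm]
  congr 2
  ring

lemma gaussianKernel_eq_integral {ε : ℝ} (hε : 0 < ε) (z : Plane) :
    (gaussianKernel ε z : ℂ) = (4 * Real.pi ^ 2 : ℂ)⁻¹ *
      ∫ t : Plane, Complex.exp (-(ε ^ 2 / 2 : ℝ) * ‖t‖ ^ 2) *
        Complex.exp (-(inner ℝ t z : ℝ) * Complex.I) := by
  have hb : 0 < ((ε ^ 2 / 2 : ℝ) : ℂ).re := by rw [Complex.ofReal_re]; positivity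
  have h := GaussianFourier.integral_cexp_neg_mul_sq_norm_add hb (-Complex.I) z
  have e : ∀ t : Plane, Complex.exp (-(ε ^ 2 / 2 : ℝ) * ‖t‖ ^ 2) *
      Complex.exp (-(inner ℝ t z : ℝ) * Complex.I) =
      Complex.exp (-((ε ^ 2 / 2 : ℝ) : ℂ) * ‖t‖ ^ 2 + -Complex.I * (inner ℝ z t : ℝ)) := fun t => by
    rw [Complex.exp_add, real_inner_comm]; congr 2; ring
  simp_rw [e]
  have hπ : (Real.pi : ℂ) ≠ 0 := by exact_mod_cast Real.pi_ne_zero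
  have hε' : (ε : ℂ) ≠ 0 := by exact_mod_cast hε.ne'
  rw [h, finrank_euclideanSpace, neg_sq, Complex.I_sq, gaussianKernel]
  push_cast
  rw [Fintype.card_fin, show ((2 : ℕ) : ℂ) / 2 = 1 by norm_num, Complex.cpow_one,
    show -1 * (‖z‖ : ℂ) ^ 2 / (4 * (ε ^ 2 / 2)) = -(2 * (ε : ℂ) ^ 2)⁻¹ * ‖z‖ ^ 2 by
      field_simp; norm_num]
  field_simp
  norm_num

lemma integral_gaussianKernel_sub_eq {μ : Measure Plane} [IsProbabilityMeasure μ] {ε : ℝ}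
    (hε : 0 < ε) (p : Plane) :
    ((∫ q, gaussianKernel ε (p - q) ∂μ : ℝ) : ℂ) = (4 * Real.pi ^ 2 : ℂ)⁻¹ *
      ∫ t : Plane, charFun μ t * Complex.exp (-(ε ^ 2 / 2 : ℝ) * ‖t‖ ^ 2) *
        Complex.exp (-(inner ℝ t p : ℝ) * Complex.I) := by
  rw [← integral_complex_ofReal]
  simp_rw [gaussianKernel_eq_integral hε]
  rw [integral_const_mul, integral_integral_swap]
  · congr 1
    refine integral_congr_ae (ae_of_all _ fun t => ?_)
    dsimp only
    rw [charFun_apply, mul_assoc, ← integral_mul_const]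
    refine integral_congr_ae (ae_of_all _ fun q => ?_)
    dsimp only
    have e : Complex.exp (-(inner ℝ t (p - q) : ℝ) * Complex.I) =
        Complex.exp ((inner ℝ q t : ℝ) * Complex.I) *
          Complex.exp (-(inner ℝ t p : ℝ) * Complex.I) := by
      rw [← Complex.exp_add, inner_sub_right, real_inner_comm q t]
      congr 1
      push_cast
      ring
    rw [e]
    ring
  · have hi := (integrable_exp_neg_mul_sq_norm (b := ε ^ 2 / 2) (by positivity)).comp_snd μ
    refine hi.mono' ?_ (ae_of_all _ fun z => ?_)
    · refine Continuous.aestronglyMeasurable ?_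
      simp only [Function.uncurry_def]
      fun_prop
    · simp only [Function.uncurry_def, norm_mul]
      rw [← Complex.ofReal_neg (inner ℝ _ _), Complex.norm_exp_ofReal_mul_I, mul_one,
        Complex.norm_exp]
      refine le_of_eq (congrArg Real.exp ?_)
      rw [← Complex.ofReal_neg, ← Complex.ofReal_pow, ← Complex.ofReal_mul, Complex.ofReal_re]

/-- Comparison of a law with an approximate density `f` whose Fourier transform is `F`. Smoothing
the law moves the integral of a `K`-Lipschitz function by at most `K` times the mean length of the
Gaussian vector; the smoothed law has a density given by Fourier inversion, compared with `f`
uniformly. -/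
lemma abs_integral_sub_integral_mul_le {μ : Measure Plane} [IsProbabilityMeasure μ]
    {h F f : Plane → ℝ} {K M ε : ℝ} (hK : ∀ p q, |h p - h q| ≤ K * ‖p - q‖)
    (hM : ∀ p, |h p| ≤ M) (hc : Continuous h) (hint : Integrable h)
    (hfm : Measurable f) (hF : Integrable F)
    (hf : ∀ p, (4 * Real.pi ^ 2 : ℂ)⁻¹ * ∫ t : Plane, (F t : ℂ) *
      Complex.exp (-(inner ℝ t p : ℝ) * Complex.I) = f p) (hε : 0 < ε) :
    |(∫ p, h p ∂μ) - ∫ p, h p * f p| ≤ K * (2 * ε) + (∫ p, |h p|) * ((4 * Real.pi ^ 2)⁻¹ *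
      ∫ t : Plane, ‖charFun μ t * Complex.exp (-(ε ^ 2 / 2 : ℝ) * ‖t‖ ^ 2) - F t‖) := by
  have hpi := Real.pi_pos
  set B := (4 * Real.pi ^ 2)⁻¹ *
      ∫ t : Plane, ‖charFun μ t * Complex.exp (-(ε ^ 2 / 2 : ℝ) * ‖t‖ ^ 2) - F t‖ with hB
  have hkc : Continuous fun z : Plane × Plane => gaussianKernel ε (z.1 - z.2) :=
    (continuous_gaussianKernel ε).comp (continuous_fst.sub continuous_snd)
  have hρi : ∀ q, Integrable fun p => gaussianKernel ε (p - q) := fun q =>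
    (integrable_gaussianKernel hε).comp_sub_right q
  have hprod : Integrable (Function.uncurry fun p q => h p * gaussianKernel ε (p - q))
      (volume.prod μ) := by
    refine ((hint.comp_fst μ).mul_const (2 * Real.pi * ε ^ 2)⁻¹).norm.mono'
      (((hc.comp continuous_fst).mul hkc).aestronglyMeasurable) (ae_of_all _ fun z => ?_)
    simp only [Function.uncurry_def, norm_mul]
    rw [Real.norm_of_nonneg (gaussianKernel_nonneg _ _),
      Real.norm_of_nonneg (by positivity : 0 ≤ (2 * Real.pi * ε ^ 2)⁻¹)]
    exact mul_le_mul_of_nonneg_left (gaussianKernel_le _ _) (norm_nonneg _)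
  set d : Plane → ℝ := fun p => ∫ q, gaussianKernel ε (p - q) ∂μ with hd
  have hχi : ∀ p, Integrable fun t : Plane =>
      charFun μ t * Complex.exp (-(ε ^ 2 / 2 : ℝ) * ‖t‖ ^ 2) *
        Complex.exp (-(inner ℝ t p : ℝ) * Complex.I) := fun p => by
    refine (integrable_cexp_neg_mul_sq_norm_mul hε p).norm.mono' ?_ (ae_of_all _ fun t => ?_)
    · exact (measurable_charFun.mul (by fun_prop)).mul (by fun_prop) |>.aestronglyMeasurable
    · rw [norm_mul, norm_mul, norm_mul]
      refine mul_le_mul_of_nonneg_right ?_ (norm_nonneg _)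
      exact mul_le_of_le_one_left (norm_nonneg _) (norm_charFun_le_one t)
  have hFi : ∀ p, Integrable fun t : Plane => (F t : ℂ) *
        Complex.exp (-(inner ℝ t p : ℝ) * Complex.I) := fun p => by
    refine hF.norm.mono' (hF.ofReal.aestronglyMeasurable.mul (by fun_prop))
      (ae_of_all _ fun t => ?_)
    rw [norm_mul, ← Complex.ofReal_neg, Complex.norm_exp_ofReal_mul_I, mul_one, Complex.norm_real]
  have hdf : ∀ p, |d p - f p| ≤ B := fun p => by
    rw [← Real.norm_eq_abs, ← Complex.norm_real, Complex.ofReal_sub,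
      integral_gaussianKernel_sub_eq hε p, ← hf p, ← mul_sub, ← integral_sub (hχi p) (hFi p),
      norm_mul, hB]
    have e : ‖(4 * Real.pi ^ 2 : ℂ)⁻¹‖ = (4 * Real.pi ^ 2)⁻¹ := by
      rw [norm_inv, norm_mul, norm_pow, Complex.norm_real, Real.norm_of_nonneg hpi.le]; norm_num
    rw [e]
    refine mul_le_mul_of_nonneg_left ((norm_integral_le_integral_norm _).trans (le_of_eq ?_))
      (by positivity)
    refine integral_congr_ae (ae_of_all _ fun t => ?_)
    dsimp only
    rw [← sub_mul, norm_mul, ← Complex.ofReal_neg (inner ℝ _ _), Complex.norm_exp_ofReal_mul_I,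
      mul_one]
  have hhd : Integrable fun p => h p * d p := by
    have := hprod.integral_prod_left
    simpa only [Function.uncurry_def, integral_const_mul] using this
  have hhdf : Integrable fun p => h p * (d p - f p) := by
    have hdm : AEStronglyMeasurable d :=
      (hkc.stronglyMeasurable.integral_prod_right' (ν := μ)).aestronglyMeasurable
    refine (hint.norm.mul_const B).mono' (hc.aestronglyMeasurable.mul
      (hdm.sub hfm.aestronglyMeasurable)) (ae_of_all _ fun p => ?_)
    rw [norm_mul]
    exact mul_le_mul_of_nonneg_left (hdf p) (norm_nonneg _)
  have hμ : Integrable h μ :=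
    Integrable.of_bound hc.aestronglyMeasurable M (ae_of_all _ hM)
  have e1 : ∫ p, h p * d p = ∫ q, (∫ p, h p * gaussianKernel ε (p - q)) ∂μ := by
    rw [← integral_integral_swap hprod]
    simp only [integral_const_mul, hd]
  have e2 : (∫ p, h p * d p) - (∫ p, h p * f p) = ∫ p, h p * (d p - f p) := by
    have : ∫ p, h p * f p = ∫ p, (h p * d p - h p * (d p - f p)) := by
      congr 1; ext p; ring
    rw [this, integral_sub hhd hhdf]
    ring
  have b2 : |∫ p, h p * (d p - f p)| ≤ (∫ p, |h p|) * B := by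
    rw [← integral_mul_const]
    refine (abs_integral_le_integral_abs).trans
      (integral_mono hhdf.norm (hint.norm.mul_const B) fun p => ?_)
    simp only [abs_mul]
    exact mul_le_mul_of_nonneg_left (hdf p) (abs_nonneg _)
  have b1 : |(∫ p, h p ∂μ) - ∫ p, h p * d p| ≤ K * (2 * ε) := by
    have hi : Integrable (fun q => ∫ p, h p * gaussianKernel ε (p - q)) μ :=
      hprod.integral_prod_right
    rw [e1, ← integral_sub hμ hi, ← Real.norm_eq_abs]
    -- The Lipschitz bound at two points at distance `1`.
    have hK0 : 0 ≤ K := by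
      have := (abs_nonneg _).trans (hK (EuclideanSpace.single 0 1) 0)
      simpa using this
    refine (norm_integral_le_of_norm_le_const (C := K * (2 * ε)) (ae_of_all _ fun q => ?_)).trans
      (by simp)
    have hhρ : Integrable fun p => h p * gaussianKernel ε (p - q) := by
      refine (hρi q).bdd_mul (c := M) hc.aestronglyMeasurable (ae_of_all _ hM)
    have e3 : h q - ∫ p, h p * gaussianKernel ε (p - q) =
        ∫ p, (h q - h p) * gaussianKernel ε (p - q) := by
      simp_rw [sub_mul]
      rw [integral_sub ((hρi q).const_mul _) hhρ, integral_const_mul,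
        integral_sub_right_eq_self (gaussianKernel ε) q, integral_gaussianKernel hε, mul_one]
    have hKi : Integrable fun p => K * (‖p - q‖ * gaussianKernel ε (p - q)) :=
      ((integrable_norm_mul_gaussianKernel hε).comp_sub_right q).const_mul K
    rw [e3]
    refine (norm_integral_le_of_norm_le hKi (ae_of_all _ fun p => ?_)).trans ?_
    · rw [norm_mul, Real.norm_of_nonneg (gaussianKernel_nonneg _ _), ← mul_assoc, norm_sub_rev]
      exact mul_le_mul_of_nonneg_right (hK p q) (gaussianKernel_nonneg _ _)
    · rw [integral_const_mul,
        integral_sub_right_eq_self (fun z => ‖z‖ * gaussianKernel ε z) q]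
      exact mul_le_mul_of_nonneg_left (integral_norm_mul_gaussianKernel_le hε) hK0
  calc |(∫ p, h p ∂μ) - ∫ p, h p * f p|
      = |((∫ p, h p ∂μ) - ∫ p, h p * d p) + ∫ p, h p * (d p - f p)| := by rw [← e2]; congr 1; ring
    _ ≤ _ := (abs_add_le _ _).trans (add_le_add b1 b2)

/-! ### Characteristic function of the shear of uniformly distributed stars -/

/-- Characteristic function at `t` of the shear at `x` due to one star, uniformly distributed over
the disc of area `g` centred at the origin. -/
def starChar (g : ℕ) (m : ℝ) (x t : Plane) : ℂ :=
  (g : ℂ)⁻¹ * ∫ ζ in Metric.closedBall x (Real.sqrt (g / Real.pi)),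
    Complex.exp ((inner ℝ (m • t) (starShear ζ) : ℝ) * Complex.I)

lemma smul_eq_smul_dirVec (m : ℝ) (t : Plane) : ∃ α, m • t = (m * ‖t‖) • dirVec α := by
  obtain ⟨α, hα⟩ := exists_eq_norm_smul_dirVec t
  exact ⟨α, by rw [mul_smul, ← hα]⟩

lemma norm_starChar_le {g : ℕ} (hg : 1 ≤ g) {m : ℝ} (hm : 0 < m) {x : Plane} (t : Plane)
    (hx : 4 * Real.pi * ‖x‖ ^ 2 ≤ g) :
    ‖starChar g m x t‖ ≤ 1 - (kappaStar m * ‖t‖ / g) /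
      (2 * (4 * (kappaStar m * ‖t‖ / g) + Real.pi)) := by
  have hpi := Real.pi_pos
  have hg0 : (0 : ℝ) < g := by exact_mod_cast hg
  have hR2 : Real.sqrt (g / Real.pi) ^ 2 = g / Real.pi := Real.sq_sqrt (by positivity)
  have hR : 0 < Real.sqrt (g / Real.pi) := Real.sqrt_pos.2 (by positivity)
  have h2x : 2 * ‖x‖ ≤ Real.sqrt (g / Real.pi) := by
    refine Real.le_sqrt_of_sq_le ?_
    rw [le_div_iff₀ hpi]; linarith
  obtain ⟨α, hα⟩ := smul_eq_smul_dirVec m t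
  have h := norm_integral_disc_exp_le (τ := m * ‖t‖) (by positivity) α hR h2x
  rw [starChar, norm_mul, norm_inv, Complex.norm_natCast, hα, inv_mul_le_iff₀ hg0]
  refine h.trans (le_of_eq ?_)
  rw [hR2, kappaStar]
  field_simp
  ring

lemma norm_starChar_le_exp {g : ℕ} (hg : 1 ≤ g) {m : ℝ} (hm : 0 < m) {x t : Plane}
    (hx : 4 * Real.pi * ‖x‖ ^ 2 ≤ g) (ht : kappaStar m * ‖t‖ ≤ g) :
    ‖starChar g m x t‖ ≤ Real.exp (-(kappaStar m * ‖t‖ / g / 16)) := by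
  have hpi := Real.pi_pos
  have hpi4 := Real.pi_lt_four
  have hg0 : (0 : ℝ) < g := by exact_mod_cast hg
  refine (norm_starChar_le hg hm t hx).trans ?_
  have hv : 0 ≤ kappaStar m * ‖t‖ := mul_nonneg (mul_pos hpi hm).le (norm_nonneg t)
  have hT0 : 0 ≤ kappaStar m * ‖t‖ / g := by positivity
  have hT1 : kappaStar m * ‖t‖ / g ≤ 1 := (div_le_one hg0).2 ht
  generalize kappaStar m * ‖t‖ / g = T at *
  have h1 : T / 16 ≤ T / (2 * (4 * T + Real.pi)) := by gcongr; linarith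
  linarith [Real.add_one_le_exp (-(T / 16))]

/-- A fixed gap below `1` is enough: the `g`-th power is exponentially small, and the Gaussian
factor provides integrability. -/
lemma norm_starChar_le_of_le {g : ℕ} (hg : 1 ≤ g) {m : ℝ} (hm : 0 < m) {x t : Plane}
    (hx : 4 * Real.pi * ‖x‖ ^ 2 ≤ g) (ht : g ≤ kappaStar m * ‖t‖) :
    ‖starChar g m x t‖ ≤ 15 / 16 := by
  have hpi := Real.pi_pos
  have hpi4 := Real.pi_lt_four
  have hg0 : (0 : ℝ) < g := by exact_mod_cast hg
  refine (norm_starChar_le hg hm t hx).trans ?_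
  have hT1 : 1 ≤ kappaStar m * ‖t‖ / g := (one_le_div hg0).2 ht
  generalize kappaStar m * ‖t‖ / g = T at *
  have h1 : 1 / 16 ≤ T / (2 * (4 * T + Real.pi)) := by
    rw [div_le_div_iff₀ (by norm_num) (by positivity)]; linarith
  linarith

lemma abs_one_sub_inv_sq_sub_le {q : ℝ} (hq0 : 0 ≤ q) (hq : q ≤ 1 / 2) :
    |((1 - q) ^ 2)⁻¹ - (1 + 2 * q)| ≤ 12 * q ^ 2 := by
  have h1 : 0 < 1 - q := by linarith
  have e : ((1 - q) ^ 2)⁻¹ - (1 + 2 * q) = q ^ 2 * (3 - 2 * q) / (1 - q) ^ 2 := by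
    field_simp; ring
  rw [e, abs_of_nonneg (div_nonneg (mul_nonneg (sq_nonneg q) (by linarith)) (by positivity)),
    div_le_iff₀ (by positivity), mul_comm 12, mul_assoc]
  refine mul_le_mul_of_nonneg_left ?_ (sq_nonneg q)
  nlinarith [mul_nonneg hq0 hq0]

/-- With `R² = g/π` and `W = (R² - ‖x‖²)⁻¹`, the sum `W + ‖x‖² W²` is exactly `(π/g) (1 - q)⁻²`,
where `q = π‖x‖²/g`. Replacing `(1 - q)⁻²` by `1 + 2q` causes the error `T²/g²`; the disc estimate
causes the other two. -/
lemma norm_starChar_sub_le {g : ℕ} (hg : 1 ≤ g) {m X : ℝ} (hm : 0 < m) {x : Plane} (t : Plane)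
    (hX : ‖x‖ ^ 2 ≤ X) (hx : 4 * Real.pi * X ≤ g) {T : ℝ} (hT : T = kappaStar m * ‖t‖ / g) :
    ‖starChar g m x t - ((1 - T + T ^ 2 / 4 + Real.pi * ‖x‖ ^ 2 / g * T ^ 2 / 2 : ℝ) : ℂ)‖ ≤
      (3 * (Real.pi * X) ^ 2 + 16 * (Real.pi * X) + 8032) *
        (T ^ 2 / g ^ 2 + T ^ 3 / g + T ^ 4) := by
  have hpi := Real.pi_pos
  have hg0 : (0 : ℝ) < g := by exact_mod_cast hg
  set s := ‖x‖ ^ 2 with hs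
  have hs0 : 0 ≤ s := by positivity
  have hX0 : 0 ≤ X := hs0.trans hX
  have hR2 : Real.sqrt (g / Real.pi) ^ 2 = g / Real.pi := Real.sq_sqrt (by positivity)
  have hR : 0 < Real.sqrt (g / Real.pi) := Real.sqrt_pos.2 (by positivity)
  have hT0 : 0 ≤ T := by
    rw [hT]; exact div_nonneg (mul_nonneg (mul_pos hpi hm).le (norm_nonneg t)) hg0.le
  set q := Real.pi * s / g with hq
  have hq0 : 0 ≤ q := by positivity
  have hπs : Real.pi * s ≤ Real.pi * X := mul_le_mul_of_nonneg_left hX hpi.le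
  have hqX : q ≤ Real.pi * X / g := by rw [hq]; gcongr
  have hq12 : q ≤ 1 / 2 := hqX.trans (by rw [div_le_iff₀ hg0]; nlinarith)
  have h1q : 0 < 1 - q := by linarith
  set τ := m * ‖t‖ with hτ
  have hτT : τ = g * T / Real.pi := by rw [hT, hτ, kappaStar]; field_simp
  have hW : Real.pi / g * (1 - q)⁻¹ = (Real.sqrt (g / Real.pi) ^ 2 - ‖x‖ ^ 2)⁻¹ := by
    rw [hR2, ← hs, show (g : ℝ) / Real.pi - s = g / Real.pi * (1 - q) by rw [hq]; field_simp,
      mul_inv, inv_div]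
  obtain ⟨α, hα⟩ := smul_eq_smul_dirVec m t
  have h := norm_integral_disc_one_sub_exp_sub_le (τ := τ) (by positivity) α hR
    (x := x) (by rw [hR2, ← hs, le_div_iff₀ hpi]; nlinarith) hW
  rw [← hs] at h
  set f : Plane → ℂ := fun ζ =>
    Complex.exp ((inner ℝ (τ • dirVec α) (starShear ζ) : ℝ) * Complex.I) with hf
  have hfi : IntegrableOn f (Metric.closedBall x (Real.sqrt (g / Real.pi))) := by
    refine IntegrableOn.of_bound measure_closedBall_lt_top ?_ 1
      (ae_of_all _ fun ζ => (Complex.norm_exp_ofReal_mul_I _).le)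
    have : Measurable fun ζ => inner ℝ (τ • dirVec α) (starShear ζ) :=
      measurable_const.inner measurable_starShear
    exact Measurable.aestronglyMeasurable (by fun_prop)
  have hvol : (volume : Measure Plane).real (Metric.closedBall x (Real.sqrt (g / Real.pi))) = g := by
    rw [Measure.real, EuclideanSpace.volume_closedBall_fin_two, ENNReal.toReal_mul,
      ENNReal.toReal_pow, ENNReal.toReal_ofReal hR.le, hR2, ENNReal.toReal_ofReal]
    · field_simp
    · exact hpi.le
  have e1 : ∫ ζ in Metric.closedBall x (Real.sqrt (g / Real.pi)), (1 - f ζ) =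
      g - g * starChar g m x t := by
    have : IsFiniteMeasure
        ((volume : Measure Plane).restrict (Metric.closedBall x (Real.sqrt (g / Real.pi)))) :=
      isFiniteMeasure_restrict.2 measure_closedBall_lt_top.ne
    have hgc : (g : ℂ) ≠ 0 := by exact_mod_cast hg0.ne'
    rw [integral_sub (integrable_const _) hfi, setIntegral_const,
      hvol, starChar, hα, ← hτ, mul_inv_cancel_left₀ hgc, Complex.real_smul, mul_one,
      Complex.ofReal_natCast]
  rw [e1] at h
  set A := Real.pi * τ - Real.pi * τ ^ 2 / 4 *
    (Real.pi / g * (1 - q)⁻¹ + s * (Real.pi / g * (1 - q)⁻¹) ^ 2) with hA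
  have hAe : A = g * (T - T ^ 2 / 4 * ((1 - q) ^ 2)⁻¹) := by
    have hs' : s = q * g / Real.pi := by rw [hq]; field_simp
    rw [hA, hs', hτT]
    field_simp
    ring
  have h2 : ‖starChar g m x t - ((1 - T + T ^ 2 / 4 * ((1 - q) ^ 2)⁻¹ : ℝ) : ℂ)‖ ≤
      16 * (Real.pi * X) * (T ^ 3 / g) + 8032 * T ^ 4 := by
    have hgc : (g : ℂ) ≠ 0 := by exact_mod_cast hg0.ne'
    have e2 : starChar g m x t - ((1 - T + T ^ 2 / 4 * ((1 - q) ^ 2)⁻¹ : ℝ) : ℂ) =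
        -(g : ℂ)⁻¹ * (g - g * starChar g m x t - (A : ℂ)) := by
      rw [hAe]; push_cast; field_simp; ring
    rw [e2, norm_mul, norm_neg, norm_inv, Complex.norm_natCast, inv_mul_le_iff₀ hg0]
    refine h.trans ?_
    have hi : (1 - q)⁻¹ ≤ 2 := by
      rw [inv_le_comm₀ h1q two_pos]; linarith
    have hi3 : (1 - q)⁻¹ ^ 3 ≤ 2 ^ 3 := pow_le_pow_left₀ (by positivity) hi 3
    calc Real.pi * (2 * τ ^ 3 * s * (Real.pi / g * (1 - q)⁻¹) ^ 3 +
          1004 * τ ^ 4 * (Real.pi / g * (1 - q)⁻¹) ^ 3)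
        = (2 * (Real.pi * s) * T ^ 3 + 1004 * g * T ^ 4) * (1 - q)⁻¹ ^ 3 := by
          rw [hτT]; field_simp
      _ ≤ (2 * (Real.pi * X) * T ^ 3 + 1004 * g * T ^ 4) * 2 ^ 3 := by gcongr
      _ = _ := by field_simp; ring
  have h3 : ‖(((1 - T + T ^ 2 / 4 * ((1 - q) ^ 2)⁻¹ : ℝ) : ℂ)) -
      ((1 - T + T ^ 2 / 4 + q * T ^ 2 / 2 : ℝ) : ℂ)‖ ≤ 3 * (Real.pi * X) ^ 2 * (T ^ 2 / g ^ 2) := by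
    rw [← Complex.ofReal_sub, Complex.norm_real, Real.norm_eq_abs,
      show 1 - T + T ^ 2 / 4 * ((1 - q) ^ 2)⁻¹ - (1 - T + T ^ 2 / 4 + q * T ^ 2 / 2) =
        T ^ 2 / 4 * (((1 - q) ^ 2)⁻¹ - (1 + 2 * q)) by ring, abs_mul,
      abs_of_nonneg (by positivity : 0 ≤ T ^ 2 / 4)]
    calc T ^ 2 / 4 * |((1 - q) ^ 2)⁻¹ - (1 + 2 * q)| ≤ T ^ 2 / 4 * (12 * q ^ 2) := by
          gcongr; exact abs_one_sub_inv_sq_sub_le hq0 hq12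
      _ ≤ T ^ 2 / 4 * (12 * (Real.pi * X / g) ^ 2) := by gcongr
      _ = _ := by ring
  refine (norm_sub_le_norm_sub_add_norm_sub _ _ _).trans ((add_le_add h2 h3).trans ?_)
  have n1 : 0 ≤ T ^ 2 / (g : ℝ) ^ 2 := by positivity
  have n2 : 0 ≤ T ^ 3 / (g : ℝ) := by positivity
  have n3 : 0 ≤ T ^ 4 := by positivity
  have n4 : 0 ≤ Real.pi * X := by positivity
  have n5 : 0 ≤ (Real.pi * X) ^ 2 := sq_nonneg _
  rw [mul_add, mul_add]
  have b1 := mul_le_mul_of_nonneg_right (by linarith : 3 * (Real.pi * X) ^ 2 ≤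
    3 * (Real.pi * X) ^ 2 + 16 * (Real.pi * X) + 8032) n1
  have b2 := mul_le_mul_of_nonneg_right (by linarith : 16 * (Real.pi * X) ≤
    3 * (Real.pi * X) ^ 2 + 16 * (Real.pi * X) + 8032) n2
  have b3 := mul_le_mul_of_nonneg_right (by linarith : 8032 ≤
    3 * (Real.pi * X) ^ 2 + 16 * (Real.pi * X) + 8032) n3
  linarith

lemma abs_charExpansion_le {s X v : ℝ} {g : ℕ} (hs0 : 0 ≤ s) (hsX : s ≤ X) (hg : 1 ≤ g)
    (hv : 0 ≤ v) : |charExpansion s g v| ≤ (1 + Real.pi * X) * (1 + v) ^ 4 * Real.exp (-v) := by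
  have hpi := Real.pi_pos
  have hg1 : (1 : ℝ) ≤ g := by exact_mod_cast hg
  have hg0 : (0 : ℝ) < g := by linarith
  have hX0 : 0 ≤ X := hs0.trans hsX
  rw [charExpansion, abs_mul, abs_of_pos (Real.exp_pos _), mul_comm]
  refine mul_le_mul_of_nonneg_right ?_ (Real.exp_pos _).le
  have h1 : |v ^ 2 / (4 * (g : ℝ))| ≤ v ^ 2 / 4 := by
    rw [abs_of_nonneg (by positivity)]
    gcongr
    linarith
  have h2 : |(Real.pi * s * v ^ 2 / 2 - v ^ 3 / 12 + v ^ 4 / 32) / (g : ℝ) ^ 2| ≤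
      Real.pi * X * v ^ 2 / 2 + v ^ 3 / 12 + v ^ 4 / 32 := by
    rw [abs_div, abs_of_pos (by positivity : (0 : ℝ) < (g : ℝ) ^ 2)]
    refine (div_le_self (abs_nonneg _) (one_le_pow₀ hg1)).trans ?_
    have a1 : Real.pi * s * v ^ 2 ≤ Real.pi * X * v ^ 2 := by gcongr
    have a2 : 0 ≤ Real.pi * s * v ^ 2 := by positivity
    have a3 : 0 ≤ v ^ 3 := by positivity
    have a4 : 0 ≤ v ^ 4 := by positivity
    rw [abs_le]
    constructor <;> linarith
  have h3 := abs_add_le (1 - v ^ 2 / (4 * (g : ℝ)))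
    ((Real.pi * s * v ^ 2 / 2 - v ^ 3 / 12 + v ^ 4 / 32) / (g : ℝ) ^ 2)
  have h4 := abs_sub (1 : ℝ) (v ^ 2 / (4 * (g : ℝ)))
  rw [abs_one] at h4
  have h5 : 0 ≤ Real.pi * X := by positivity
  have h6 : v ^ 2 / 2 ≤ (1 + v) ^ 4 := by nlinarith [pow_nonneg hv 3, pow_nonneg hv 4, sq_nonneg v]
  have h7 : 1 + v ^ 2 / 4 + v ^ 3 / 12 + v ^ 4 / 32 ≤ (1 + v) ^ 4 := by
    nlinarith [pow_nonneg hv 3, pow_nonneg hv 4, sq_nonneg v]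
  have h8 := mul_le_mul_of_nonneg_left h6 h5
  linarith

/-- For `κ_*‖t‖ ≤ g` the expansion of the power applies, and dropping the Gaussian factor costs
`O(g⁻⁶ ‖t‖²)`. For `κ_*‖t‖ ≥ g` both terms are estimated separately: the expansion is small because
`g³` is at most a power of `1 + κ_*‖t‖`. -/
lemma norm_starChar_pow_mul_exp_sub_le {m X : ℝ} (hm : 0 < m) (hX0 : 0 ≤ X) :
    ∃ C, 0 ≤ C ∧ ∀ (g : ℕ) (x t : Plane), 1 ≤ g → ‖x‖ ^ 2 ≤ X → 4 * Real.pi * X ≤ g →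
      ‖starChar g m x t ^ g * Complex.exp (-((((g : ℝ) ^ 3)⁻¹) ^ 2 / 2 : ℝ) * ‖t‖ ^ 2) -
        charExpansion (‖x‖ ^ 2) g (kappaStar m * ‖t‖)‖ ≤
      C * ((1 + kappaStar m * ‖t‖) ^ 9 * Real.exp (-(kappaStar m * ‖t‖ / 16))) / g ^ 3 +
        (15 / 16) ^ g * Real.exp (-(((g : ℝ) ^ 3)⁻¹ ^ 2 / 2) * ‖t‖ ^ 2) := by
  have hpi := Real.pi_pos
  have hk : 0 < kappaStar m := mul_pos hpi hm
  set B := 3 * (Real.pi * X) ^ 2 + 16 * (Real.pi * X) + 8032 with hB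
  have hB0 : 0 ≤ B := by positivity
  set C₁ := 6 * B + 1200 + 6 * (Real.pi * X) + 10 * (1 + Real.pi * X) ^ 3 with hC₁
  have hC₁0 : 0 ≤ C₁ := by positivity
  refine ⟨C₁ + (1 + Real.pi * X) * (1 + (kappaStar m ^ 2)⁻¹), by positivity, ?_⟩
  intro g x t hg hxX hgX
  have hg1 : (1 : ℝ) ≤ g := by exact_mod_cast hg
  have hg0 : (0 : ℝ) < g := by linarith
  have hx4 : 4 * Real.pi * ‖x‖ ^ 2 ≤ g := le_trans (by gcongr) hgX
  set v := kappaStar m * ‖t‖ with hv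
  have hv0 : 0 ≤ v := by positivity
  have hc := abs_charExpansion_le (g := g) (sq_nonneg ‖x‖) hxX hg hv0
  set w := ((g : ℝ) ^ 3)⁻¹ ^ 2 / 2 * ‖t‖ ^ 2 with hw
  have hw0 : 0 ≤ w := by positivity
  have he : Complex.exp (-((((g : ℝ) ^ 3)⁻¹) ^ 2 / 2 : ℝ) * ‖t‖ ^ 2) = (Real.exp (-w) : ℝ) := by
    rw [Complex.ofReal_exp, hw]; congr 1; push_cast; ring
  have he' : Real.exp (-(((g : ℝ) ^ 3)⁻¹ ^ 2 / 2) * ‖t‖ ^ 2) = Real.exp (-w) := by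
    rw [hw]; congr 1; ring
  rw [he, he']
  have hew : Real.exp (-w) ≤ 1 := Real.exp_le_one_iff.2 (by linarith)
  have hg3 : 0 < (g : ℝ) ^ 3 := by positivity
  have hexp : Real.exp (-v) ≤ Real.exp (-(v / 16)) := Real.exp_le_exp.2 (by linarith)
  have hP : 0 ≤ 1 + Real.pi * X := by positivity
  have h1v : 1 ≤ 1 + v := by linarith
  set E := Real.exp (-(v / 16)) with hE
  have hE0 : 0 < E := Real.exp_pos _
  rcases le_total v g with hvg | hvg
  · have h1 := norm_pow_sub_charExpansion_le (sq_nonneg ‖x‖) hxX hg (by linarith) hv0 hvg hB0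
      (norm_starChar_le_exp hg hm hx4 hvg) (norm_starChar_sub_le hg hm t hxX hgX rfl)
    rw [← hC₁] at h1
    set φ := starChar g m x t ^ g
    set F := charExpansion (‖x‖ ^ 2) g v
    have h2 : ‖φ * (Real.exp (-w) : ℝ) - (F : ℂ)‖ ≤ ‖φ - F‖ + |F| * w := by
      have e : φ * (Real.exp (-w) : ℝ) - (F : ℂ) =
          (φ - F) * (Real.exp (-w) : ℝ) + F * ((Real.exp (-w) - 1 : ℝ) : ℂ) := by
        push_cast; ring
      rw [e]
      refine (norm_add_le _ _).trans (add_le_add ?_ ?_)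
      · rw [norm_mul, Complex.norm_real, Real.norm_of_nonneg (Real.exp_pos _).le]
        exact mul_le_of_le_one_right (norm_nonneg _) hew
      · rw [norm_mul, Complex.norm_real, Complex.norm_real, Real.norm_eq_abs, Real.norm_eq_abs]
        refine mul_le_mul_of_nonneg_left ?_ (abs_nonneg _)
        rw [abs_le]
        constructor <;> linarith [Real.add_one_le_exp (-w)]
    have h3 : |F| * w ≤ (1 + Real.pi * X) * (kappaStar m ^ 2)⁻¹ * ((1 + v) ^ 9 * E) / g ^ 3 := by
      have e : w = (kappaStar m ^ 2)⁻¹ * (v ^ 2 * (((g : ℝ) ^ 3)⁻¹ ^ 2 / 2)) := by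
        rw [hw, hv]; field_simp
      have hi : ((g : ℝ) ^ 3)⁻¹ ^ 2 / 2 ≤ ((g : ℝ) ^ 3)⁻¹ := by
        have : ((g : ℝ) ^ 3)⁻¹ ≤ 1 := inv_le_one_of_one_le₀ (one_le_pow₀ hg1)
        have : 0 < ((g : ℝ) ^ 3)⁻¹ := by positivity
        nlinarith
      have hv2 : v ^ 2 ≤ (1 + v) ^ 5 :=
        (pow_le_pow_left₀ hv0 (by linarith) 2).trans (pow_le_pow_right₀ h1v (by norm_num))
      calc |F| * w ≤ ((1 + Real.pi * X) * (1 + v) ^ 4 * E) *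
            ((kappaStar m ^ 2)⁻¹ * ((1 + v) ^ 5 * ((g : ℝ) ^ 3)⁻¹)) := by
            rw [e]
            refine mul_le_mul (hc.trans ?_) ?_ (by positivity) (by positivity)
            · gcongr
            · gcongr
        _ = _ := by field_simp
    refine h2.trans ?_
    have h4 : 0 ≤ (15 / 16 : ℝ) ^ g * Real.exp (-w) := by positivity
    have h5 : 0 ≤ (1 + Real.pi * X) * ((1 + v) ^ 9 * E) / (g : ℝ) ^ 3 := by positivity
    calc ‖φ - F‖ + |F| * w ≤ C₁ * (1 + v) ^ 9 * E / g ^ 3 +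
          (1 + Real.pi * X) * (kappaStar m ^ 2)⁻¹ * ((1 + v) ^ 9 * E) / g ^ 3 := add_le_add h1 h3
      _ ≤ C₁ * (1 + v) ^ 9 * E / g ^ 3 +
          (1 + Real.pi * X) * (kappaStar m ^ 2)⁻¹ * ((1 + v) ^ 9 * E) / g ^ 3 +
          (1 + Real.pi * X) * ((1 + v) ^ 9 * E) / (g : ℝ) ^ 3 := by linarith
      _ = (C₁ + (1 + Real.pi * X) * (1 + (kappaStar m ^ 2)⁻¹)) * ((1 + v) ^ 9 * E) / g ^ 3 := by
          ring
      _ ≤ _ := by linarith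
  · have h1 := pow_le_pow_left₀ (norm_nonneg _) (norm_starChar_le_of_le hg hm hx4 hvg) g
    have h2 : |charExpansion (‖x‖ ^ 2) g v| ≤
        (1 + Real.pi * X) * ((1 + v) ^ 9 * E) / g ^ 3 := by
      refine hc.trans ?_
      rw [le_div_iff₀ hg3]
      have h3 : (g : ℝ) ^ 3 ≤ (1 + v) ^ 5 :=
        (pow_le_pow_left₀ hg0.le (by linarith) 3).trans (pow_le_pow_right₀ h1v (by norm_num))
      calc (1 + Real.pi * X) * (1 + v) ^ 4 * Real.exp (-v) * (g : ℝ) ^ 3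
          ≤ (1 + Real.pi * X) * (1 + v) ^ 4 * E * (1 + v) ^ 5 := by gcongr
        _ = _ := by ring
    refine (norm_sub_le _ _).trans ?_
    rw [norm_mul, norm_pow, Complex.norm_real, Complex.norm_real, Real.norm_eq_abs,
      Real.norm_eq_abs, abs_of_pos (Real.exp_pos _), add_comm]
    refine add_le_add (h2.trans ?_) (mul_le_mul_of_nonneg_right h1 (Real.exp_pos _).le)
    have : 1 + Real.pi * X ≤ C₁ + (1 + Real.pi * X) * (1 + (kappaStar m ^ 2)⁻¹) := by
      have : 0 ≤ (1 + Real.pi * X) * (kappaStar m ^ 2)⁻¹ := by positivity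
      linarith
    gcongr

/-! ### Law of the shear -/

/-- The joint law of `g` independent stars, uniformly distributed over the disc of area `g`. -/
def starLaw (g : ℕ) : Measure (Fin g → Plane) :=
  Measure.pi fun _ => cond volume (Metric.closedBall (0 : Plane) (Real.sqrt (g / Real.pi)))

lemma volume_starDisc (g : ℕ) (x : Plane) :
    volume (Metric.closedBall x (Real.sqrt (g / Real.pi))) = g := by
  have hpi := Real.pi_pos
  rw [EuclideanSpace.volume_closedBall_fin_two, ← ENNReal.ofReal_pow (Real.sqrt_nonneg _),
    Real.sq_sqrt (by positivity), ← ENNReal.ofReal_mul (by positivity),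
    div_mul_cancel₀ _ hpi.ne', ENNReal.ofReal_natCast]

lemma aemeasurable_stars {g : ℕ} {Ω : Type*} [MeasurableSpace Ω] {P : Measure Ω}
    {ξ : Fin g → Ω → Plane} (hunif : ∀ j, pdf.IsUniform (ξ j)
      (Metric.closedBall (0 : Plane) (Real.sqrt (g / Real.pi))) P volume) (j : Fin g) :
    AEMeasurable (ξ j) P := by
  have hg : g ≠ 0 := (Fin.pos j).ne'
  refine (hunif j).aemeasurable ?_ ?_
  · rw [volume_starDisc]; exact_mod_cast hg
  · rw [volume_starDisc]; exact ENNReal.natCast_ne_top g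

lemma map_stars_eq_starLaw {g : ℕ} {Ω : Type*} [MeasurableSpace Ω] {P : Measure Ω}
    [IsProbabilityMeasure P] {ξ : Fin g → Ω → Plane} (hindep : iIndepFun ξ P)
    (hunif : ∀ j, pdf.IsUniform (ξ j)
      (Metric.closedBall (0 : Plane) (Real.sqrt (g / Real.pi))) P volume) :
    (P.map fun ω j => ξ j ω) = starLaw g := by
  rw [(iIndepFun_iff_map_fun_eq_pi_map (aemeasurable_stars hunif)).1 hindep, starLaw]
  congr 1
  ext1 j
  exact hunif j

lemma isProbabilityMeasure_cond_starDisc {g : ℕ} (hg : 1 ≤ g) :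
    IsProbabilityMeasure
      (cond volume (Metric.closedBall (0 : Plane) (Real.sqrt (g / Real.pi)))) := by
  refine cond_isProbabilityMeasure_of_finite ?_ ?_
  · rw [volume_starDisc]; exact_mod_cast (Nat.one_le_iff_ne_zero.1 hg)
  · rw [volume_starDisc]; exact ENNReal.natCast_ne_top g

lemma measurable_shear {g : ℕ} (m : ℝ) :
    Measurable fun p : Plane × (Fin g → Plane) => shear m p.2 p.1 := by
  unfold shear
  have h : ∀ j, Measurable fun p : Plane × (Fin g → Plane) => starShear (p.1 - p.2 j) :=
    fun j => measurable_starShear.comp (by fun_prop)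
  exact (Finset.measurable_fun_sum _ fun j _ => h j).const_smul m

lemma measurable_shear_left {g : ℕ} (m : ℝ) (x : Plane) :
    Measurable fun ζ : Fin g → Plane => shear m ζ x := by
  unfold shear
  have h : ∀ j, Measurable fun ζ : Fin g → Plane => starShear (x - ζ j) :=
    fun j => measurable_starShear.comp (by fun_prop)
  exact (Finset.measurable_fun_sum _ fun j _ => h j).const_smul m

/-- Independence factors the exponential of the sum, and `ζ ↦ x - ζ` carries the disc about the
origin to the disc about `x`. -/
lemma charFun_map_shear {g : ℕ} (hg : 1 ≤ g) (m : ℝ) (x t : Plane) :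
    charFun ((starLaw g).map fun ζ => shear m ζ x) t = starChar g m x t ^ g := by
  have := isProbabilityMeasure_cond_starDisc hg
  rw [charFun_apply, integral_map (measurable_shear_left m x).aemeasurable (by fun_prop)]
  have e : ∀ ζ : Fin g → Plane, Complex.exp ((inner ℝ (shear m ζ x) t : ℝ) * Complex.I) =
      ∏ j, Complex.exp ((inner ℝ (m • t) (starShear (x - ζ j)) : ℝ) * Complex.I) := by
    intro ζ
    rw [← Complex.exp_sum, ← Finset.sum_mul, shear, real_inner_smul_left, sum_inner, Finset.mul_sum]
    congr 2
    push_cast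
    refine Finset.sum_congr rfl fun j _ => ?_
    rw [real_inner_smul_left, real_inner_comm]
    push_cast
    rfl
  simp_rw [e]
  rw [starLaw, integral_fintype_prod_eq_pow
    (fun y => Complex.exp ((inner ℝ (m • t) (starShear (x - y)) : ℝ) * Complex.I)),
    Fintype.card_fin]
  congr 1
  have h := (Measure.measurePreserving_sub_left (volume : Measure Plane) x).setIntegral_preimage_emb
    (MeasurableEquiv.subLeft x).measurableEmbedding
    (fun z => Complex.exp ((inner ℝ (m • t) (starShear z) : ℝ) * Complex.I))
    (Metric.closedBall x (Real.sqrt (g / Real.pi)))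
  have hpre : (fun y => x - y) ⁻¹' Metric.closedBall x (Real.sqrt (g / Real.pi)) =
      Metric.closedBall (0 : Plane) (Real.sqrt (g / Real.pi)) := by
    ext y; simp [dist_eq_norm]
  rw [hpre] at h
  rw [ProbabilityTheory.cond, integral_smul_measure, h, volume_starDisc, starChar,
    ENNReal.toReal_inv, ENNReal.toReal_natCast, Complex.real_smul, Complex.ofReal_inv,
    Complex.ofReal_natCast]

/-! ### The density of minima as a function of the shear -/

/-- Positive part of the Jacobian determinant of the lensing map, as a function of the shear of
the stars. -/
def minimaDensity (κc γ : ℝ) (p : Plane) : ℝ := max 0 ((1 - κc) ^ 2 - ‖!₂[γ, 0] + p‖ ^ 2)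

lemma minimaDensity_nonneg (κc γ : ℝ) (p : Plane) : 0 ≤ minimaDensity κc γ p := le_max_left _ _

lemma minimaDensity_le (κc γ : ℝ) (p : Plane) : minimaDensity κc γ p ≤ (1 - κc) ^ 2 :=
  max_le (sq_nonneg _) (sub_le_self _ (sq_nonneg _))

lemma abs_minimaDensity_le (κc γ : ℝ) (p : Plane) : |minimaDensity κc γ p| ≤ (1 - κc) ^ 2 := by
  rw [abs_of_nonneg (minimaDensity_nonneg κc γ p)]; exact minimaDensity_le κc γ p

lemma continuous_minimaDensity (κc γ : ℝ) : Continuous (minimaDensity κc γ) := by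
  unfold minimaDensity; fun_prop

/-- Only radii up to `a` contribute, and there `r ↦ r²` has slope at most `2 a`. -/
lemma max_zero_sq_sub_sq_sub_le {a r s : ℝ} (ha : 0 ≤ a) (hr : 0 ≤ r)
    (hs0 : 0 ≤ s) :
    max 0 (a ^ 2 - r ^ 2) - max 0 (a ^ 2 - s ^ 2) ≤ 2 * a * |r - s| := by
  have h0 : 0 ≤ 2 * a * |r - s| := by positivity
  have h1 := le_max_left 0 (a ^ 2 - s ^ 2)
  have h2 := le_max_right 0 (a ^ 2 - s ^ 2)
  rcases le_total (a ^ 2 - r ^ 2) 0 with h | h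
  · rw [max_eq_left h]; linarith
  · rw [max_eq_right h]
    have hra : r ≤ a := by nlinarith
    have h3 : -(r - s) ≤ |r - s| := neg_le_abs _
    rcases le_total s r with hs | hs
    · nlinarith [abs_nonneg (r - s)]
    · rcases le_total s a with hsa | hsa
      · nlinarith
      · nlinarith

lemma abs_minimaDensity_sub_le {κc : ℝ} (hκ1 : κc < 1) (γ : ℝ) (p q : Plane) :
    |minimaDensity κc γ p - minimaDensity κc γ q| ≤ 2 * (1 - κc) * ‖p - q‖ := by
  have ha : 0 ≤ 1 - κc := by linarith
  have h : ∀ p q : Plane, minimaDensity κc γ p - minimaDensity κc γ q ≤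
      2 * (1 - κc) * ‖p - q‖ := by
    intro p q
    refine (max_zero_sq_sub_sq_sub_le ha (norm_nonneg _) (norm_nonneg _)).trans
      (mul_le_mul_of_nonneg_left ?_ (by linarith))
    refine (abs_norm_sub_norm_le _ _).trans (le_of_eq ?_)
    rw [add_sub_add_left_eq_sub]
  rw [abs_le]
  have h1 := h p q
  have h2 := h q p
  rw [norm_sub_rev] at h2
  constructor <;> linarith

lemma norm_add_sq_eq (γ : ℝ) (p : Plane) :
    ‖(!₂[γ, 0] : Plane) + p‖ ^ 2 = (γ + p 0) ^ 2 + p 1 ^ 2 := by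
  rw [Plane.norm_sq]; simp

lemma minimaDensity_of_mem {κc γ : ℝ} (hκ1 : κc < 1) {p : Plane}
    (hp : p ∈ Metric.closedBall (!₂[-γ, 0] : Plane) (1 - κc)) :
    minimaDensity κc γ p = (1 - κc) ^ 2 - (γ + p 0) ^ 2 - p 1 ^ 2 := by
  have e : (!₂[γ, 0] : Plane) + p = p - !₂[-γ, 0] := by
    apply Plane.ext <;> simp [add_comm]
  rw [mem_closedBall_iff_norm, ← e] at hp
  have h2 := norm_add_sq_eq γ p
  rw [minimaDensity, max_eq_right, h2]
  · ring
  · have := norm_nonneg ((!₂[γ, 0] : Plane) + p)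
    nlinarith

lemma minimaDensity_of_notMem {κc γ : ℝ} (hκ1 : κc < 1) {p : Plane}
    (hp : p ∉ Metric.closedBall (!₂[-γ, 0] : Plane) (1 - κc)) :
    minimaDensity κc γ p = 0 := by
  have e : (!₂[γ, 0] : Plane) + p = p - !₂[-γ, 0] := by
    apply Plane.ext <;> simp [add_comm]
  rw [mem_closedBall_iff_norm, ← e, not_le] at hp
  rw [minimaDensity, max_eq_left]
  nlinarith

lemma integrable_minimaDensity {κc : ℝ} (hκ1 : κc < 1) (γ : ℝ) :
    Integrable (minimaDensity κc γ) := by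
  refine (integrableOn_iff_integrable_of_support_subset
    (s := Metric.closedBall (!₂[-γ, 0] : Plane) (1 - κc)) ?_).1
    ((continuous_minimaDensity κc γ).continuousOn.integrableOn_compact
      (isCompact_closedBall _ _))
  intro p hp
  by_contra h
  exact hp (minimaDensity_of_notMem hκ1 h)

/-- Second order approximation of the density of the shear at `x`, with `s = ‖x‖ ^ 2`. -/
def shearDensity (m s g : ℝ) (p : Plane) : ℝ :=
  kappaStar m / (2 * Real.pi) * (((kappaStar m ^ 2 + ‖p‖ ^ 2) ^ (3 / 2 : ℝ))⁻¹ *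
    (1 + H₁ m ‖p‖ / g + H₂ m ‖p‖ s / g ^ 2))

lemma continuous_shearDensity {m : ℝ} (hm : 0 < m) (s g : ℝ) :
    Continuous (shearDensity m s g) := by
  have hk : 0 < kappaStar m := mul_pos Real.pi_pos hm
  have h1 : Continuous fun p : Plane => H₁ m ‖p‖ :=
    Continuous.div (by fun_prop) (by fun_prop) fun p => by positivity
  have h2 : Continuous fun p : Plane => H₂ m ‖p‖ s := by
    refine ((continuous_const.mul ?_).sub ?_).add ?_ <;>
    exact Continuous.div (by fun_prop) (by fun_prop) fun p => by positivity
  have h3 : Continuous fun p : Plane => ((kappaStar m ^ 2 + ‖p‖ ^ 2) ^ (3 / 2 : ℝ))⁻¹ :=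
    Continuous.inv₀ (Continuous.rpow_const (by fun_prop) fun p => Or.inr (by norm_num))
      fun p => by positivity
  unfold shearDensity
  fun_prop

lemma integral_minimaDensity_mul_shearDensity {κc m : ℝ} (hκ1 : κc < 1) (γ s : ℝ) (g : ℕ) :
    ∫ p, minimaDensity κc γ p * shearDensity m s g p =
      kappaStar m / (2 * Real.pi) * shearIntegral κc γ m s g := by
  rw [← setIntegral_eq_integral_of_forall_compl_eq_zero
    (s := Metric.closedBall (!₂[-γ, 0] : Plane) (1 - κc))
    (fun p hp => by rw [minimaDensity_of_notMem hκ1 hp, zero_mul]), shearIntegral,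
    ← integral_const_mul]
  refine setIntegral_congr_fun Metric.isClosed_closedBall.measurableSet fun p hp => ?_
  dsimp only
  rw [minimaDensity_of_mem hκ1 hp, shearDensity]
  ring

lemma shearDensity_affine (m s g : ℝ) (p : Plane) : shearDensity m s g p =
    shearDensity m 0 g p + s * (shearDensity m 1 g p - shearDensity m 0 g p) := by
  unfold shearDensity H₂
  ring

lemma exists_integral_shearDensity_eq {κc m : ℝ} (hκ1 : κc < 1) (hm : 0 < m) (γ : ℝ) (g : ℕ) :
    ∃ a b, ∀ s, kappaStar m / (2 * Real.pi) * shearIntegral κc γ m s g = a + s * b := by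
  have hi : ∀ s, Integrable fun p => minimaDensity κc γ p * shearDensity m s g p := fun s => by
    refine (integrableOn_iff_integrable_of_support_subset
      (s := Metric.closedBall (!₂[-γ, 0] : Plane) (1 - κc)) ?_).1
      (((continuous_minimaDensity κc γ).mul
        (continuous_shearDensity hm s g)).continuousOn.integrableOn_compact
        (isCompact_closedBall _ _))
    intro p hp
    by_contra h
    exact hp (by dsimp only; rw [minimaDensity_of_notMem hκ1 h, zero_mul])
  refine ⟨∫ p, minimaDensity κc γ p * shearDensity m 0 g p,
    (∫ p, minimaDensity κc γ p * shearDensity m 1 g p) -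
      ∫ p, minimaDensity κc γ p * shearDensity m 0 g p, fun s => ?_⟩
  have hd : Integrable fun p => s * (minimaDensity κc γ p * shearDensity m 1 g p -
      minimaDensity κc γ p * shearDensity m 0 g p) := ((hi 1).sub (hi 0)).const_mul s
  rw [← integral_minimaDensity_mul_shearDensity hκ1, ← integral_sub (hi 1) (hi 0),
    ← integral_const_mul, ← integral_add (hi 0) hd]
  refine integral_congr_ae (ae_of_all _ fun p => ?_)
  dsimp only
  rw [shearDensity_affine]
  ring

/-- The squared distance enters only through `H₂`, affinely, so averaging over `D` amounts to
inserting the mean square. -/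
lemma setIntegral_shearIntegral {κc m : ℝ} (hκ1 : κc < 1) (hm : 0 < m) (γ : ℝ) (g : ℕ)
    {D : Set Plane} (hD : IsCompact D) (hD0 : volume D ≠ 0) :
    IntegrableOn (fun x => kappaStar m / (2 * Real.pi) * shearIntegral κc γ m (‖x‖ ^ 2) g) D ∧
    ∫ x in D, kappaStar m / (2 * Real.pi) * shearIntegral κc γ m (‖x‖ ^ 2) g =
      volume.real D * (kappaStar m / (2 * Real.pi) * shearIntegral κc γ m (meanSq D) g) := by
  obtain ⟨a, b, hab⟩ := exists_integral_shearDensity_eq hκ1 hm γ g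
  simp_rw [hab]
  have hc : ∀ f : Plane → ℝ, Continuous f → IntegrableOn f D := fun f hf =>
    hf.continuousOn.integrableOn_compact hD
  refine ⟨hc _ (by fun_prop), ?_⟩
  have hv : volume.real D ≠ 0 := (ENNReal.toReal_ne_zero.2 ⟨hD0, hD.measure_lt_top.ne⟩)
  rw [integral_add (hc _ (by fun_prop)) (hc _ (by fun_prop)), setIntegral_const,
    integral_mul_const, meanSq, smul_eq_mul]
  field_simp

/-! ### Expected density of minima -/

lemma integrable_one_add_mul_norm_pow_mul_exp (n : ℕ) {k c : ℝ} (hk : 0 ≤ k) (hc : 0 < c) :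
    Integrable fun t : Plane => (1 + k * ‖t‖) ^ n * Real.exp (-(c * ‖t‖)) := by
  refine ((integrable_one_add_norm_pow_mul_exp n hc).const_mul ((1 + k) ^ n)).mono'
    (by fun_prop) (ae_of_all _ fun t => ?_)
  rw [Real.norm_of_nonneg (by positivity), ← mul_assoc, ← mul_pow]
  gcongr
  nlinarith [norm_nonneg t]

/-- The Gaussian width `g⁻³` is small enough for the Lipschitz cost to be `O(g⁻³)`, yet only
polynomially small, so that the high frequencies stay negligible. -/
lemma abs_integral_minimaDensity_sub_le {κc m X : ℝ} (hκ1 : κc < 1) (hm : 0 < m) (γ : ℝ)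
    (hX0 : 0 ≤ X) : ∃ C, ∀ᶠ g : ℕ in atTop, ∀ x : Plane, ‖x‖ ^ 2 ≤ X →
      |(∫ ζ, minimaDensity κc γ (shear m ζ x) ∂(starLaw g)) -
        kappaStar m / (2 * Real.pi) * shearIntegral κc γ m (‖x‖ ^ 2) g| ≤ C * ((g : ℝ) ^ 3)⁻¹ := by
  have hpi := Real.pi_pos
  have hk : 0 < kappaStar m := mul_pos hpi hm
  obtain ⟨C, hC0, hC⟩ := norm_starChar_pow_mul_exp_sub_le hm hX0
  set I := ∫ t : Plane, (1 + kappaStar m * ‖t‖) ^ 9 * Real.exp (-(kappaStar m * ‖t‖ / 16)) with hI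
  have hIi : Integrable fun t : Plane =>
      (1 + kappaStar m * ‖t‖) ^ 9 * Real.exp (-(kappaStar m * ‖t‖ / 16)) := by
    refine (integrable_one_add_mul_norm_pow_mul_exp 9 hk.le
      (by positivity : 0 < kappaStar m / 16)).congr (ae_of_all _ fun t => ?_)
    dsimp only
    congr 2
    ring
  refine ⟨2 * (1 - κc) * 2 + (∫ p, |minimaDensity κc γ p|) *
    ((4 * Real.pi ^ 2)⁻¹ * (C * I + 2 * Real.pi)), ?_⟩
  -- The Gaussian integral over frequencies is `2π g⁶`, and a further `g³` is needed to reach the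
  -- target `g⁻³`.
  have hlim : ∀ᶠ g : ℕ in atTop, (g : ℝ) ^ 9 * (15 / 16) ^ g < 1 :=
    (tendsto_pow_const_mul_const_pow_of_abs_lt_one 9 (by norm_num [abs_of_pos])).eventually_lt_const
      one_pos
  filter_upwards [hlim, eventually_ge_atTop 1, eventually_ge_atTop ⌈4 * Real.pi * X⌉₊]
    with g hg9 hg1 hgX x hx
  have hgX' : 4 * Real.pi * X ≤ g := (Nat.le_ceil _).trans (by exact_mod_cast hgX)
  have hg0 : (0 : ℝ) < g := by exact_mod_cast hg1
  have := isProbabilityMeasure_cond_starDisc hg1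
  have : IsProbabilityMeasure (starLaw g) := by unfold starLaw; infer_instance
  have hsm := measurable_shear_left (g := g) m x
  have : IsProbabilityMeasure ((starLaw g).map fun ζ => shear m ζ x) :=
    Measure.isProbabilityMeasure_map hsm.aemeasurable
  have hε : 0 < ((g : ℝ) ^ 3)⁻¹ := by positivity
  have hFi : Integrable fun t : Plane => charExpansion (‖x‖ ^ 2) g (kappaStar m * ‖t‖) := by
    have := (integrable_charExpansion hk (‖x‖ ^ 2) g 0).re
    refine this.congr (ae_of_all _ fun t => ?_)
    simp
  have h := abs_integral_sub_integral_mul_le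
    (μ := (starLaw g).map fun ζ => shear m ζ x) (abs_minimaDensity_sub_le hκ1 γ)
    (abs_minimaDensity_le κc γ) (continuous_minimaDensity κc γ) (integrable_minimaDensity hκ1 γ)
    (continuous_shearDensity hm (‖x‖ ^ 2) g).measurable hFi
    (integral_charExpansion hm (‖x‖ ^ 2)) hε
  rw [integral_map hsm.aemeasurable (continuous_minimaDensity κc γ).aestronglyMeasurable,
    integral_minimaDensity_mul_shearDensity hκ1] at h
  refine h.trans ?_
  have hgauss : 0 < ((g : ℝ) ^ 3)⁻¹ ^ 2 / 2 := by positivity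
  have hbi : Integrable fun t : Plane =>
      C * ((1 + kappaStar m * ‖t‖) ^ 9 * Real.exp (-(kappaStar m * ‖t‖ / 16))) / g ^ 3 +
        (15 / 16) ^ g * Real.exp (-(((g : ℝ) ^ 3)⁻¹ ^ 2 / 2) * ‖t‖ ^ 2) :=
    ((hIi.const_mul C).div_const _).add ((integrable_exp_neg_mul_sq_norm hgauss).const_mul _)
  have hint : ∫ t : Plane, ‖charFun ((starLaw g).map fun ζ => shear m ζ x) t *
      Complex.exp (-((((g : ℝ) ^ 3)⁻¹) ^ 2 / 2 : ℝ) * ‖t‖ ^ 2) -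
        charExpansion (‖x‖ ^ 2) g (kappaStar m * ‖t‖)‖ ≤
      (C * I + 2 * Real.pi) * ((g : ℝ) ^ 3)⁻¹ := by
    refine (integral_mono_of_nonneg (ae_of_all _ fun t => norm_nonneg _) hbi
      (ae_of_all _ fun t => ?_)).trans ?_
    · dsimp only
      rw [charFun_map_shear hg1]
      exact hC g x t hg1 hx hgX'
    · rw [integral_add ((hIi.const_mul C).div_const _)
        ((integrable_exp_neg_mul_sq_norm hgauss).const_mul _), integral_div, integral_const_mul,
        integral_const_mul, integral_exp_neg_mul_sq_norm hgauss, ← hI]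
      have e : (15 / 16 : ℝ) ^ g * (Real.pi / (((g : ℝ) ^ 3)⁻¹ ^ 2 / 2)) =
          (g : ℝ) ^ 9 * (15 / 16) ^ g * (2 * Real.pi) * ((g : ℝ) ^ 3)⁻¹ := by field_simp
      rw [e, add_mul, div_eq_mul_inv]
      exact add_le_add_right (mul_le_mul_of_nonneg_right
        (mul_le_of_le_one_left Real.two_pi_pos.le hg9.le) hε.le) _
  have hh : 0 ≤ ∫ p, |minimaDensity κc γ p| := integral_nonneg fun p => abs_nonneg _
  have h4 := mul_le_mul_of_nonneg_left (mul_le_mul_of_nonneg_left hint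
    (by positivity : 0 ≤ (4 * Real.pi ^ 2)⁻¹)) hh
  exact (add_le_add_right h4 _).trans (le_of_eq (by ring))

/-! ### Global expectation -/

lemma lintegral_ofReal_eq_ofReal_integral {g : ℕ} {κc γ m : ℝ} (μ : Measure (Fin g → Plane))
    [IsProbabilityMeasure μ] (x : Plane) :
    ∫⁻ ζ, ENNReal.ofReal ((1 - κc) ^ 2 - ‖totalShear γ m ζ x‖ ^ 2) ∂μ =
      ENNReal.ofReal (∫ ζ, minimaDensity κc γ (shear m ζ x) ∂μ) := by
  rw [ofReal_integral_eq_lintegral_ofReal]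
  · refine lintegral_congr fun ζ => ?_
    rw [minimaDensity, ENNReal.ofReal_max]
    simp [totalShear]
  · exact Integrable.of_bound ((continuous_minimaDensity κc γ).measurable.comp
      (measurable_shear_left m x)).aestronglyMeasurable ((1 - κc) ^ 2)
      (ae_of_all _ fun ζ => abs_minimaDensity_le κc γ _)
  · exact ae_of_all _ fun ζ => minimaDensity_nonneg κc γ _

lemma stronglyMeasurable_integral_minimaDensity {g : ℕ} (κc γ m : ℝ) (μ : Measure (Fin g → Plane))
    [SFinite μ] : StronglyMeasurable fun x : Plane =>
      ∫ ζ, minimaDensity κc γ (shear m ζ x) ∂μ :=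
  ((continuous_minimaDensity κc γ).measurable.comp
    (measurable_shear m)).stronglyMeasurable.integral_prod_right'

lemma integrableOn_integral_minimaDensity {g : ℕ} (κc γ m : ℝ) (μ : Measure (Fin g → Plane))
    [IsProbabilityMeasure μ] {D : Set Plane} (hD : volume D < ⊤) :
    IntegrableOn (fun x : Plane => ∫ ζ, minimaDensity κc γ (shear m ζ x) ∂μ) D := by
  refine IntegrableOn.of_bound hD
    (stronglyMeasurable_integral_minimaDensity κc γ m μ).aestronglyMeasurable ((1 - κc) ^ 2)
    (ae_of_all _ fun x => ?_)
  refine (norm_integral_le_of_norm_le_const (ae_of_all _ fun ζ =>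
    abs_minimaDensity_le κc γ _)).trans (by simp)

lemma globalExpectedMinima_eq_ofReal {g : ℕ} {κc γ m : ℝ} (hκ1 : κc < 1) {Ω : Type*}
    [MeasurableSpace Ω] {P : Measure Ω} [IsProbabilityMeasure P] {ξ : Fin g → Ω → Plane}
    (hξ : ∀ j, AEMeasurable (ξ j) P) {D : Set Plane} (hD : IsCompact D)
    {ι : Type*} [Countable ι] {S : ι → Set Plane} {A : ℝ} (hS : IsSourceCover S A) :
    globalExpectedMinima P κc γ m ξ D S = ENNReal.ofReal (A⁻¹ * ∫ x in D,
      ∫ ζ, minimaDensity κc γ (shear m ζ x) ∂(P.map fun ω j => ξ j ω)) := by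
  have hξ' : AEMeasurable (fun ω j => ξ j ω) P := aemeasurable_pi_lambda _ hξ
  have : IsProbabilityMeasure (P.map fun ω j => ξ j ω) := Measure.isProbabilityMeasure_map hξ'
  rw [globalExpectedMinima_eq P ξ D hS, lintegral_expectedMinima hκ1 P hξ' hD.measurableSet,
    ENNReal.ofReal_mul (inv_nonneg.2 hS.area_pos.le), ENNReal.ofReal_inv_of_pos hS.area_pos,
    ofReal_integral_eq_lintegral_ofReal]
  · simp_rw [lintegral_ofReal_eq_ofReal_integral]
  · exact integrableOn_integral_minimaDensity κc γ m _ hD.measure_lt_top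
  · exact ae_of_all _ fun x => integral_nonneg fun ζ => minimaDensity_nonneg κc γ _

end Microlensing

end

/-! ### The asymptotic expansion of the global expectation -/

theorem mainTheorem9
    (κc γ m : ℝ) (hκ0 : 0 ≤ κc) (hκ1 : κc < 1) (hγ : 0 ≤ γ) (hm : 0 < m)
    {Ω : ℕ → Type*} [∀ g, MeasurableSpace (Ω g)] (P : ∀ g, Measure (Ω g))
    [∀ g, IsProbabilityMeasure (P g)]
    (ξ : ∀ g, Fin g → Ω g → Plane)
    (hindep : ∀ g, iIndepFun (ξ g) (P g))
    (hunif : ∀ g j, pdf.IsUniform (ξ g j)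
      (Metric.closedBall (0 : Plane) (Real.sqrt (g / Real.pi))) (P g) volume)
    (c : Plane) (ρ : ℝ) (hρ : 0 < ρ) (D : Set Plane) (hD : D = Metric.closedBall c ρ)
    {ι : Type*} [Countable ι] (S : ι → Set Plane) (A : ℝ) (hS : IsSourceCover S A) :
    (∀ g, globalExpectedMinima (P g) κc γ m (ξ g) D S ≠ ⊤) ∧
    (fun g : ℕ => (globalExpectedMinima (P g) κc γ m (ξ g) D S).toReal -
        kappaStar m * (volume.real D / A) / (2 * Real.pi) *
          shearIntegral κc γ m (meanSq D) g)
      =O[atTop] (fun g : ℕ => ((g : ℝ) ^ 3)⁻¹) := by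
  have hDc : IsCompact D := hD ▸ isCompact_closedBall c ρ
  have hD0 : volume D ≠ 0 := by
    rw [hD]; exact (Metric.measure_closedBall_pos volume c hρ).ne'
  -- Valid for `g = 0` too, where there are no stars and every condition on them is vacuous; this
  -- yields finiteness for every `g`.
  have hE : ∀ g, globalExpectedMinima (P g) κc γ m (ξ g) D S =
      ENNReal.ofReal (A⁻¹ * ∫ x in D, ∫ ζ, minimaDensity κc γ (shear m ζ x) ∂(starLaw g)) :=
    fun g => by
      rw [globalExpectedMinima_eq_ofReal hκ1 (aemeasurable_stars (hunif g)) hDc hS,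
        map_stars_eq_starLaw (hindep g) (hunif g)]
  refine ⟨fun g => by rw [hE]; exact ENNReal.ofReal_ne_top, ?_⟩
  -- A bound on `‖x‖²` over `D` is what makes the pointwise estimate uniform, so that it can be
  -- integrated.
  obtain ⟨X, hX⟩ := hDc.exists_bound_of_continuousOn
    (f := fun x : Plane => ‖x‖ ^ 2) (by fun_prop)
  have hXD : ∀ x ∈ D, ‖x‖ ^ 2 ≤ X := fun x hx => (le_abs_self _).trans (hX x hx)
  have hX0 : 0 ≤ X := (sq_nonneg ‖c‖).trans
    (hXD c (hD ▸ Metric.mem_closedBall_self hρ.le))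
  obtain ⟨C, hC⟩ := abs_integral_minimaDensity_sub_le hκ1 hm γ hX0
  refine IsBigO.of_bound (A⁻¹ * (C * volume.real D)) ?_
  filter_upwards [hC, eventually_ge_atTop 1] with g hg hg1
  have hA := hS.area_pos
  have := isProbabilityMeasure_cond_starDisc hg1
  have : IsProbabilityMeasure (starLaw g) := by unfold starLaw; infer_instance
  obtain ⟨hi, he⟩ := setIntegral_shearIntegral hκ1 hm γ g hDc hD0
  have hi' := integrableOn_integral_minimaDensity κc γ m (starLaw g) hDc.measure_lt_top
  have h0 : 0 ≤ A⁻¹ * ∫ x in D, ∫ ζ, minimaDensity κc γ (shear m ζ x) ∂(starLaw g) :=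
    mul_nonneg (inv_nonneg.2 hA.le) (integral_nonneg fun x =>
      integral_nonneg fun ζ => minimaDensity_nonneg κc γ _)
  have e : kappaStar m * (volume.real D / A) / (2 * Real.pi) * shearIntegral κc γ m (meanSq D) g =
      A⁻¹ * ∫ x in D, kappaStar m / (2 * Real.pi) * shearIntegral κc γ m (‖x‖ ^ 2) g := by
    rw [he]; ring
  rw [hE, ENNReal.toReal_ofReal h0, e, ← mul_sub, ← integral_sub hi' hi, norm_mul,
    Real.norm_of_nonneg (inv_nonneg.2 hA.le), Real.norm_of_nonneg (by positivity : 0 ≤ ((g : ℝ) ^ 3)⁻¹),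
    mul_assoc]
  refine mul_le_mul_of_nonneg_left ?_ (inv_nonneg.2 hA.le)
  refine (norm_setIntegral_le_of_norm_le_const hDc.measure_lt_top fun x hx =>
    hg x (hXD x hx)).trans (le_of_eq (by ring))
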